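/- Let $K$ be a field of characteristic $0$; graded means $\mathbb Z$-graded, and all structures are uncurved. **Semifree algebras.** For a graded vector space $V$ let $\mathcal E(V)$ be the (reduced) free algebra on $V$ with bilinear products $\oslash_i$ of degree $i\in\mathbb N$ subject to the quadratic identities of the operad $\mathcal{E}ilh$: for homogeneous $a,b,c$ and all $i<j$, $$a\oslash_i(b\oslash_i c)=(-1)^{i(|a|+1)}\big((a\oslash_i b)\oslash_i c+(-1)^{i+|a||b|}(b\oslash_i a)\oslash_i c\big),\qquad a\oslash_i(b\oslash_j c)=(-1)^{ij+j|a|}(a\oslash_i b)\oslash_j c,$$ $$a\oslash_j(b\oslash_i c)=(-1)^{i|a|+|a||b|}(b\oslash_i a)\oslash_j c+X+Y,$$ where $X=(-1)^{i(|a|+j+1)+(|a|+|b|)|c|}(c\oslash_{j-1}a)\oslash_{i+1}b$ if $j-i\ge 2$ and $X=0$ otherwise, and $Y=(-1)^{j+|a|(|b|+i)+(|a|+|b|)|c|}(c\oslash_{i+1}b)\oslash_{j-1}a$ if $j-i>2$ and $Y=0$ otherwise. A differential on $\mathcal E(V)$ is a linear map $Q$ of degree $1$ with $Q^2=0$ and,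 for homogeneous $a,b$ and all $i$, $$Q(a\oslash_i b)=(-1)^i\big(Qa\oslash_i b+(-1)^{|a|}a\oslash_i Qb\big)+(-1)^i a\oslash_{i+1}b-(-1)^{|a||b|}b\oslash_{i+1}a.$$ Let $\bigoslash_0^\bullet V\subset\mathcal E(V)$ be the span of the products $(\cdots(v_1\oslash_0 v_2)\oslash_0\cdots)\oslash_0 v_n$, $n\ge 1$, $v_i\in V$. Let $\bigodot^\bullet V$ be the free graded commutative algebra on $V$; a differential on it is a derivation $\tilde Q$ of degree $1$ with $\tilde Q^2=0$ that maps $V$ into the augmentation ideal $\bigodot^{\ge 1}V$. **$EL_\infty$-algebras.** An $EL_\infty$-algebra is a graded vector space $E$ with multilinear higher products $\varepsilon_n^I:E^{\otimes n}\to E$, $n\ge1$, $I\in\mathbb N^{n-1}$, of degree $2-n-|I|$, such that the derivation $Q$ determined by $$QX=-\sum_{n,I}\varepsilon^I_n(X,\dots,X)$$ satisfies $Q^2=0$. Precisely: for homogeneous $x_1,\dots,x_N\in E$ take letters $t_j$ of degree $1-|x_j|$ and $X=\sum_j t_j\otimes x_j$; extend $\varepsilon_n^I$ by $$\varepsilon_n^I(a_1\otimes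 y_1,\dots,a_n\otimes y_n)=(-1)^{(2-n-|I|)\sum_j|a_j|+\sum_{j<l}|y_j||a_l|}\,(\cdots(a_1\oslash_{I_1}a_2)\cdots)\oslash_{I_{n-1}}a_n\otimes\varepsilon_n^I(y_1,\dots,y_n),$$ and expand $Q^2X$ formally by the deformed Leibniz rule. For each $N$ and $p$, the part of the result that is multilinear in $x_1,\dots,x_N$ and in which the indices of the products $\oslash$ add up to $p$ is required to vanish in $\mathcal E(t_1,\dots,t_N)\otimes E$. The algebra is semistrict if $\varepsilon_n^I=0$ for $I\neq(0,\dots,0)$. An $L_\infty$-algebra is a graded vector space $E$ with graded antisymmetric multilinear products $\mu_n:E^{\otimes n}\to E$, $n\ge1$, of degree $2-n$ satisfying $$\sum_{j+k=n}\ \sum_{\sigma\in \mathrm{Sh}(j;n)}\chi(\sigma;x)\,(-1)^k\mu_{k+1}\big(\mu_j(x_{\sigma(1)},\dots,x_{\sigma(j)}),x_{\sigma(j+1)},\dots,x_{\sigma(n)}\big)=0,$$ where $j\ge 1$, $\mathrm{Sh}(j;n)$ is the set of permutations increasing on $\{1,\dots,j\}$ and on $\{j+1,\dots,n\}$, and $\chi$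 is the graded antisymmetric Koszul sign. **Theorem.** (1) For every graded vector space $E$, semistrict $EL_\infty$-algebra structures on $E$ are exactly $L_\infty$-algebra structures on $E$: the assignment $\mu_n=\varepsilon_n^{(0,\dots,0)}$ is a bijection from the semistrict $EL_\infty$-structures to the $L_\infty$-structures. (2) For every graded vector space $V$ there is a linear map $\mathsf E_0:\bigodot^\bullet V\to\mathcal E(V)$ with $\mathsf E_0(1)=0$ and $$\mathsf E_0(v_1\odot\cdots\odot v_n)=\sum_{\sigma\in S_n}\pm(\cdots(v_{\sigma(1)}\oslash_0 v_{\sigma(2)})\oslash_0\cdots)\oslash_0 v_{\sigma(n)}\qquad(n\ge1,\ \text{Koszul signs}),$$ and the relation $Q|_V=\mathsf E_0\circ\tilde Q|_V$ is a bijection between the differentials $Q$ on $\mathcal E(V)$ with $Q(V)\subset\bigoslash_0^\bullet V$ and the differentials $\tilde Q$ on $\bigodot^\bullet V$. -/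

import Mathlib

/-! ## Signs -/

/-- The sign `(-1)^z`. -/
abbrev paritySign (z : ℤ) : ℤˣ := z.negOnePow

/-- The Koszul sign of a permutation: `v₀ ⊙ ⋯ ⊙ vₙ₋₁ = koszulSign σ d • (v_{σ 0} ⊙ ⋯ ⊙ v_{σ (n-1)})`
in a graded commutative algebra, where `d i` is the degree of `vᵢ`. -/
def koszulSign {n : ℕ} (σ : Equiv.Perm (Fin n)) (d : Fin n → ℤ) : ℤˣ :=
  ∏ i : Fin n, ∏ j : Fin n,
    if i < j ∧ σ j < σ i then paritySign (d (σ i) * d (σ j)) else 1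

/-- The graded antisymmetric Koszul sign `χ(σ; x₀, …, xₙ₋₁)`, defined by
`x₀ ∧ ⋯ ∧ xₙ₋₁ = χ • (x_{σ 0} ∧ ⋯ ∧ x_{σ (n-1)})`. -/
def koszulAltSign {n : ℕ} (σ : Equiv.Perm (Fin n)) (d : Fin n → ℤ) : ℤˣ :=
  Equiv.Perm.sign σ * koszulSign σ d

/-! ## Finite sequences

Finite families indexed by `Fin (n + 1)` are extended to sequences indexed by `ℕ`;
only the entries with index at most `n` are ever used. -/

/-- The permuted family `(f (σ 0), …, f (σ n))` as a sequence. -/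
def permSeq {α : Type*} {n : ℕ} (f : Fin (n + 1) → α) (σ : Equiv.Perm (Fin (n + 1))) : ℕ → α :=
  fun l => f (σ (Fin.ofNat (n + 1) l))

/-- The sequence `f 0, …, f (k-1), y, f (k+m+1), f (k+m+2), …`: the `m + 1` consecutive
entries `f k, …, f (k+m)` are replaced by the single entry `y`. -/
def splice {α : Type*} (f : ℕ → α) (m k : ℕ) (y : α) : ℕ → α :=
  fun l => if l < k then f l else if l = k then y else f (l + m)

/-! ## The free algebra over the operad `Eilh` on a graded vector space -/

section Eilh

variable {K V : Type*} [Field K] [AddCommGroup V] [Module K V]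

/-- Nonassociative monomials in the binary products `⊘ᵢ`, `i ∈ ℕ`, in homogeneous elements of a
graded vector space. -/
inductive EilhTree (𝒱 : ℤ → Submodule K V) : Type _
  | leaf (d : ℤ) (v : 𝒱 d) : EilhTree 𝒱
  | op (i : ℕ) (a b : EilhTree 𝒱) : EilhTree 𝒱

namespace EilhTree

variable {𝒱 : ℤ → Submodule K V}

/-- The degree of a monomial; the product `⊘ᵢ` has degree `i`. -/
def deg : EilhTree 𝒱 → ℤ
  | leaf d _ => d
  | op i a b => a.deg + b.deg + i

/-- A monomial as an element of the vector space spanned by all monomials. -/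
noncomputable def mon (a : EilhTree 𝒱) : EilhTree 𝒱 →₀ K := Finsupp.single a 1

/-- The left-nested monomial `(⋯((T 0 ⊘_{I 0} T 1) ⊘_{I 1} T 2)⋯) ⊘_{I (n-1)} T n`. -/
def word : (n : ℕ) → (Fin n → ℕ) → (ℕ → EilhTree 𝒱) → EilhTree 𝒱
  | 0, _, T => T 0
  | n + 1, I, T => op (I (Fin.last n)) (word n (fun j => I j.castSucc) T) (T (n + 1))

/-- The linear extension of the product `⊘ᵢ` to linear combinations of monomials. -/
noncomputable def opFree (i : ℕ) :
    (EilhTree 𝒱 →₀ K) →ₗ[K] (EilhTree 𝒱 →₀ K) →ₗ[K] (EilhTree 𝒱 →₀ K) :=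
  Finsupp.linearCombination K fun a => Finsupp.lmapDomain K K (op i a)

/-- The operation `Q₀` on monomials: it vanishes on leaves and is continued by the deformed
Leibniz rule
`Q₀ (a ⊘ᵢ b) = (-1)^i (Q₀ a ⊘ᵢ b + (-1)^|a| a ⊘ᵢ Q₀ b) + (-1)^i a ⊘ᵢ₊₁ b - (-1)^(|a||b|) b ⊘ᵢ₊₁ a`. -/
noncomputable def Q₀ : EilhTree 𝒱 → (EilhTree 𝒱 →₀ K)
  | leaf _ _ => 0
  | op i a b =>
      paritySign i • (opFree i (Q₀ a) (mon b) + paritySign a.deg • opFree i (mon a) (Q₀ b))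
        + paritySign i • mon (op (i + 1) a b)
        - paritySign (a.deg * b.deg) • mon (op (i + 1) b a)

/-- The relations of the free `Eilh`-algebra: monomials are multilinear in their leaves, the
products satisfy the quadratic identities of the operad `Eilh`, and the relations are closed
under multiplication by monomials from either side. -/
inductive Relator : (EilhTree 𝒱 →₀ K) → Prop
  | leaf_add (d : ℤ) (v w : 𝒱 d) :
      Relator (mon (leaf d (v + w)) - mon (leaf d v) - mon (leaf d w))
  | leaf_smul (d : ℤ) (c : K) (v : 𝒱 d) :
      Relator (mon (leaf d (c • v)) - c • mon (leaf d v))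
  -- `a ⊘ᵢ (b ⊘ᵢ c)`
  | eq (i : ℕ) (a b c : EilhTree 𝒱) :
      Relator (mon (op i a (op i b c))
        - paritySign (i * (a.deg + 1)) •
          (mon (op i (op i a b) c)
            + paritySign (i + a.deg * b.deg) • mon (op i (op i b a) c)))
  -- `a ⊘ᵢ (b ⊘ⱼ c)` for `i < j`
  | lt (i j : ℕ) (h : i < j) (a b c : EilhTree 𝒱) :
      Relator (mon (op i a (op j b c))
        - paritySign (i * j + j * a.deg) • mon (op j (op i a b) c))
  -- `a ⊘ⱼ (b ⊘ᵢ c)` for `j - i = 1`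
  | gt_one (i j : ℕ) (h : j = i + 1) (a b c : EilhTree 𝒱) :
      Relator (mon (op j a (op i b c))
        - paritySign (i * a.deg + a.deg * b.deg) • mon (op j (op i b a) c))
  -- `a ⊘ⱼ (b ⊘ᵢ c)` for `j - i = 2`
  | gt_two (i j : ℕ) (h : j = i + 2) (a b c : EilhTree 𝒱) :
      Relator (mon (op j a (op i b c))
        - (paritySign (i * a.deg + a.deg * b.deg) • mon (op j (op i b a) c)
          + paritySign (i * (a.deg + j + 1) + (a.deg + b.deg) * c.deg) •
              mon (op (i + 1) (op (j - 1) c a) b)))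
  -- `a ⊘ⱼ (b ⊘ᵢ c)` for `j - i > 2`
  | gt_many (i j : ℕ) (h : i + 2 < j) (a b c : EilhTree 𝒱) :
      Relator (mon (op j a (op i b c))
        - (paritySign (i * a.deg + a.deg * b.deg) • mon (op j (op i b a) c)
          + paritySign (i * (a.deg + j + 1) + (a.deg + b.deg) * c.deg) •
              mon (op (i + 1) (op (j - 1) c a) b)
          + paritySign (j + a.deg * (b.deg + i) + (a.deg + b.deg) * c.deg) •
              mon (op (j - 1) (op (i + 1) c b) a)))
  | mul_left (i : ℕ) (a : EilhTree 𝒱) (r : EilhTree 𝒱 →₀ K) (h : Relator r) :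
      Relator (opFree i (mon a) r)
  | mul_right (i : ℕ) (b : EilhTree 𝒱) (r : EilhTree 𝒱 →₀ K) (h : Relator r) :
      Relator (opFree i r (mon b))

end EilhTree

open EilhTree

/-- The subspace of relations. -/
noncomputable def eilhIdeal (𝒱 : ℤ → Submodule K V) : Submodule K (EilhTree 𝒱 →₀ K) :=
  Submodule.span K {r | Relator r}

/-- The (reduced) free `Eilh`-algebra `ℰ(V) = V ⊕ V ⊘ V ⊕ ⋯` on a graded vector space. -/
abbrev Eilh (𝒱 : ℤ → Submodule K V) : Type _ := (EilhTree 𝒱 →₀ K) ⧸ eilhIdeal 𝒱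

namespace Eilh

variable {𝒱 : ℤ → Submodule K V}

/-- The class of a monomial. -/
noncomputable def ofTree (a : EilhTree 𝒱) : Eilh 𝒱 := (eilhIdeal 𝒱).mkQ (mon a)

/-- The inclusion of (the homogeneous components of) `V` into `ℰ(V)`. -/
noncomputable def gen {d : ℤ} (v : 𝒱 d) : Eilh 𝒱 := ofTree (leaf d v)

theorem opFree_mem_right (i : ℕ) (x y : EilhTree 𝒱 →₀ K) (hy : y ∈ eilhIdeal 𝒱) :
    opFree i x y ∈ eilhIdeal 𝒱 := by
  induction x using Finsupp.induction_linear with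
  | zero => simp
  | add f g hf hg => simpa using add_mem hf hg
  | single a c =>
    have h1 : (Finsupp.single a c : EilhTree 𝒱 →₀ K) = c • mon a := by simp [mon]
    rw [h1, map_smul, LinearMap.smul_apply]
    refine Submodule.smul_mem _ _ ?_
    have h2 : eilhIdeal 𝒱 ≤ (eilhIdeal 𝒱).comap (opFree i (mon a)) :=
      Submodule.span_le.2 fun r hr => Submodule.subset_span (Relator.mul_left i a r hr)
    exact h2 hy

theorem opFree_mem_left (i : ℕ) (x y : EilhTree 𝒱 →₀ K) (hx : x ∈ eilhIdeal 𝒱) :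
    opFree i x y ∈ eilhIdeal 𝒱 := by
  induction y using Finsupp.induction_linear with
  | zero => simp
  | add f g hf hg => simpa using add_mem hf hg
  | single b c =>
    have h1 : (Finsupp.single b c : EilhTree 𝒱 →₀ K) = c • mon b := by simp [mon]
    rw [h1, map_smul]
    refine Submodule.smul_mem _ _ ?_
    have h2 : eilhIdeal 𝒱 ≤ (eilhIdeal 𝒱).comap ((opFree i).flip (mon b)) :=
      Submodule.span_le.2 fun r hr => Submodule.subset_span (Relator.mul_right i b r hr)
    exact h2 hx

/-- The product `⊘ᵢ` on `ℰ(V)`. -/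
noncomputable def op (i : ℕ) : Eilh 𝒱 →ₗ[K] Eilh 𝒱 →ₗ[K] Eilh 𝒱 :=
  (eilhIdeal 𝒱).liftQ
    (LinearMap.flip
      ((eilhIdeal 𝒱).liftQ
        (LinearMap.flip ((opFree i).compr₂ (eilhIdeal 𝒱).mkQ))
        (by
          intro y hy
          rw [LinearMap.mem_ker]
          ext x
          simpa using opFree_mem_right i _ y hy)))
    (by
      intro x hx
      rw [LinearMap.mem_ker]
      refine LinearMap.ext fun y => ?_
      obtain ⟨y, rfl⟩ := (eilhIdeal 𝒱).mkQ_surjective y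
      simpa using opFree_mem_left i x y hx)

theorem op_mkQ (i : ℕ) (x y : EilhTree 𝒱 →₀ K) :
    op i ((eilhIdeal 𝒱).mkQ x) ((eilhIdeal 𝒱).mkQ y) = (eilhIdeal 𝒱).mkQ (opFree i x y) := rfl

theorem op_ofTree (i : ℕ) (a b : EilhTree 𝒱) :
    op i (ofTree a) (ofTree b) = ofTree (EilhTree.op i a b) := by
  rw [ofTree, ofTree, op_mkQ]
  simp [ofTree, opFree, mon]

/-- The homogeneous component of degree `m` of `ℰ(V)`. -/
noncomputable def homogeneous (𝒱 : ℤ → Submodule K V) (m : ℤ) : Submodule K (Eilh 𝒱) :=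
  Submodule.span K {x | ∃ a : EilhTree 𝒱, a.deg = m ∧ x = ofTree a}

/-- The left-nested `⊘₀`-product `(⋯((v₀ ⊘₀ v₁) ⊘₀ v₂)⋯) ⊘₀ vₙ` of homogeneous elements `v i`
of degree `d i`, taken in the order given by the permutation `σ`. -/
noncomputable def zeroWord {n : ℕ} (d : Fin (n + 1) → ℤ) (v : ∀ i, 𝒱 (d i))
    (σ : Equiv.Perm (Fin (n + 1))) : Eilh 𝒱 :=
  ofTree (word n 0 (permSeq (fun i => leaf (d i) (v i)) σ))

/-- The subspace `⊘₀^• V` of `ℰ(V)` spanned by the left-nested products in which only `⊘₀`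
occurs. -/
noncomputable def zeroWords (𝒱 : ℤ → Submodule K V) : Submodule K (Eilh 𝒱) :=
  Submodule.span K {x | ∃ (n : ℕ) (d : Fin (n + 1) → ℤ) (v : ∀ i, 𝒱 (d i)), x = zeroWord d v 1}

end Eilh

/-- A differential on the semifree `Eilh`-algebra `ℰ(V)`: a linear map of degree one which squares
to zero and satisfies the deformed Leibniz rule. -/
structure EilhDifferential (𝒱 : ℤ → Submodule K V) where
  Q : Eilh 𝒱 →ₗ[K] Eilh 𝒱
  degree_one : ∀ (m : ℤ), ∀ a ∈ Eilh.homogeneous 𝒱 m, Q a ∈ Eilh.homogeneous 𝒱 (m + 1)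
  leibniz : ∀ (i : ℕ) (m k : ℤ), ∀ a ∈ Eilh.homogeneous 𝒱 m, ∀ b ∈ Eilh.homogeneous 𝒱 k,
    Q (Eilh.op i a b) =
      paritySign i • (Eilh.op i (Q a) b + paritySign m • Eilh.op i a (Q b))
        + paritySign i • Eilh.op (i + 1) a b - paritySign (m * k) • Eilh.op (i + 1) b a
  square_zero : ∀ a, Q (Q a) = 0

/-! ## The free graded commutative algebra -/

/-- Graded commutativity of homogeneous elements of `V`. -/
inductive GradedSymRel (𝒱 : ℤ → Submodule K V) : TensorAlgebra K V → TensorAlgebra K V → Prop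
  | comm (d e : ℤ) (v : 𝒱 d) (w : 𝒱 e) :
      GradedSymRel 𝒱 (TensorAlgebra.ι K (v : V) * TensorAlgebra.ι K (w : V))
        (paritySign (d * e) • (TensorAlgebra.ι K (w : V) * TensorAlgebra.ι K (v : V)))

/-- The free graded commutative algebra `⨀^• V` (over a field of characteristic zero). -/
abbrev GradedSym (𝒱 : ℤ → Submodule K V) : Type _ := RingQuot (GradedSymRel 𝒱)

namespace GradedSym

variable {𝒱 : ℤ → Submodule K V}

/-- The inclusion of (the homogeneous components of) `V` into `⨀^• V`. -/
noncomputable def gen {d : ℤ} (v : 𝒱 d) : GradedSym 𝒱 :=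
  RingQuot.mkAlgHom K (GradedSymRel 𝒱) (TensorAlgebra.ι K (v : V))

/-- The product `v₀ ⊙ ⋯ ⊙ vₙ₋₁` of homogeneous elements `v i` of degree `d i`. -/
noncomputable def monomial {n : ℕ} (d : Fin n → ℤ) (v : ∀ i, 𝒱 (d i)) : GradedSym 𝒱 :=
  (List.ofFn fun i => gen (v i)).prod

/-- The homogeneous component of degree `m` of `⨀^• V`. -/
def homogeneous (𝒱 : ℤ → Submodule K V) (m : ℤ) : Submodule K (GradedSym 𝒱) :=
  Submodule.span K
    {x | ∃ (n : ℕ) (d : Fin n → ℤ) (v : ∀ i, 𝒱 (d i)), ∑ i, d i = m ∧ x = monomial d v}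

/-- The augmentation ideal `V ⊕ V ⊙ V ⊕ ⋯` of `⨀^• V`. -/
def augmentation (𝒱 : ℤ → Submodule K V) : Submodule K (GradedSym 𝒱) :=
  Submodule.span K
    {x | ∃ (n : ℕ) (d : Fin (n + 1) → ℤ) (v : ∀ i, 𝒱 (d i)), x = monomial d v}

end GradedSym

/-- An (uncurved) differential on the semifree graded commutative algebra `⨀^• V`: a derivation
of degree one which squares to zero and maps `V` to the augmentation ideal. -/
structure GradedSymDifferential (𝒱 : ℤ → Submodule K V) where
  Q : GradedSym 𝒱 →ₗ[K] GradedSym 𝒱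
  degree_one : ∀ (m : ℤ), ∀ a ∈ GradedSym.homogeneous 𝒱 m,
    Q a ∈ GradedSym.homogeneous 𝒱 (m + 1)
  leibniz : ∀ (m : ℤ), ∀ a ∈ GradedSym.homogeneous 𝒱 m, ∀ b : GradedSym 𝒱,
    Q (a * b) = Q a * b + paritySign m • (a * Q b)
  square_zero : ∀ a, Q (Q a) = 0
  uncurved : ∀ (d : ℤ) (v : 𝒱 d), Q (GradedSym.gen v) ∈ GradedSym.augmentation 𝒱

/-- `S` is the symmetrization map `⨀^• V → ℰ(V)`:
`S (v₀ ⊙ ⋯ ⊙ vₙ) = ∑_σ ± (⋯(v_{σ 0} ⊘₀ v_{σ 1}) ⊘₀ ⋯) ⊘₀ v_{σ n}` with Koszul signs, and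
`S 1 = 0`. These conditions determine `S`. -/
def IsSymmetrization {𝒱 : ℤ → Submodule K V} (S : GradedSym 𝒱 →ₗ[K] Eilh 𝒱) : Prop :=
  S 1 = 0 ∧
  ∀ (n : ℕ) (d : Fin (n + 1) → ℤ) (v : ∀ i, 𝒱 (d i)),
    S (GradedSym.monomial d v) = ∑ σ : Equiv.Perm (Fin (n + 1)),
      koszulSign σ d • Eilh.zeroWord d v σ

end Eilh

/-! ## `EL∞`-algebras and `L∞`-algebras -/

section Algebras

variable {K E : Type*} [Field K] [AddCommGroup E] [Module K E]

/-- The vector space with basis `t₀, …, tₙ`, graded so that `tᵢ` has degree `e i`. -/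
noncomputable def letterGrading (K : Type*) [Field K] {n : ℕ} (e : Fin (n + 1) → ℤ) :
    ℤ → Submodule K (Fin (n + 1) →₀ K) :=
  fun d => Finsupp.supported K K {i | e i = d}

/-- The basis vector `tᵢ` as a monomial. -/
noncomputable def letter (K : Type*) [Field K] {n : ℕ} (e : Fin (n + 1) → ℤ) (i : Fin (n + 1)) :
    EilhTree (letterGrading K e) :=
  EilhTree.leaf (e i) ⟨Finsupp.single i 1, Finsupp.single_mem_supported K 1 rfl⟩

/-- For elements `x₀, …, xₙ` of degrees `d 0, …, d n`, letters `tⱼ` of degree `1 - d j` and an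
operation `ε` with `n + 1` inputs and of degree `2 - (n + 1) - w`, this is the Koszul sign in
`ε (t₀ ⊗ x₀, …, tₙ ⊗ xₙ) = ± (⋯(t₀ ⊘ t₁) ⊘ ⋯ ⊘ tₙ) ⊗ ε (x₀, …, xₙ)`. -/
def extensionSign (n w : ℕ) (d : ℕ → ℤ) : ℤˣ :=
  paritySign ((1 - n - w) * ∑ j ∈ Finset.range (n + 1), (1 - d j)
    + ∑ l ∈ Finset.range (n + 1), ∑ j ∈ Finset.range l, d j * (1 - d l))

/-- The multi-indices `I ∈ ℕⁿ` with `|I| + 1 = p`. -/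
def predTuples (n : ℕ) : ℕ → Finset (Fin n → ℕ)
  | 0 => ∅
  | p + 1 => Finset.Nat.antidiagonalTuple n p

/-- The part of `-Q² X` which is linear in each of `x₀, …, xₙ` and in which the indices of the
products `⊘` add up to `p`. Here `X = ∑ⱼ tⱼ ⊗ xⱼ`, with letters `tⱼ` of degree `1 - d j`, and
`Q` is the derivation (for the deformed Leibniz rule) with
`Q X = - ∑_{m, I} ε_m^I (X, …, X)`.
It lies in `ℰ(t₀, …, tₙ) ⊗ E`. The first sum comes from the deformation of the Leibniz rule. In
the second sum `Q` is applied to the letter in position `k` of the left-nested word belonging to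
`ε^I`, which is dual to the value of `ε^J`. -/
noncomputable def homotopyRelation
    (ε : (n : ℕ) → (Fin n → ℕ) → MultilinearMap K (fun _ : Fin (n + 1) => E) E)
    (n p : ℕ) (d : Fin (n + 1) → ℤ) (x : Fin (n + 1) → E) :
    TensorProduct K (Eilh (letterGrading K fun i => 1 - d i)) E :=
  ∑ σ : Equiv.Perm (Fin (n + 1)),
    let T : ℕ → EilhTree (letterGrading K fun i => 1 - d i) :=
      permSeq (letter K fun i => 1 - d i) σ
    let y : ℕ → E := permSeq x σ
    let c : ℕ → ℤ := permSeq d σ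
    (∑ I ∈ predTuples n p,
      extensionSign n (∑ j, I j) c •
        TensorProduct.tmul K ((eilhIdeal _).mkQ (EilhTree.Q₀ (EilhTree.word n I T)))
          (ε n I fun i => y i))
    - ∑ qm ∈ Finset.HasAntidiagonal.antidiagonal n, ∑ ab ∈ Finset.HasAntidiagonal.antidiagonal p,
        ∑ I ∈ Finset.Nat.antidiagonalTuple qm.1 ab.1,
          ∑ J ∈ Finset.Nat.antidiagonalTuple qm.2 ab.2,
            ∑ k ∈ Finset.range (qm.1 + 1),
              let innerDeg : ℤ :=
                ∑ j ∈ Finset.range (qm.2 + 1), c (k + j) + 1 - qm.2 - ab.2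
              let c' : ℕ → ℤ := splice c qm.2 k innerDeg
              (paritySign (ab.1 + ∑ l ∈ Finset.range k, (1 - c' l))
                  * extensionSign qm.1 ab.1 c'
                  * extensionSign qm.2 ab.2 (fun j => c (k + j))) •
                TensorProduct.tmul K
                  (Eilh.ofTree (EilhTree.word qm.1 I
                    (splice T qm.2 k (EilhTree.word qm.2 J fun j => T (k + j)))))
                  (ε qm.1 I fun i => splice y qm.2 k (ε qm.2 J fun j => y (k + j)) i)

/-- An (uncurved) `EL∞`-algebra structure on a graded vector space `E`: higher products
`ε_{n+1}^I : E^{⊗(n+1)} → E`, for `n ∈ ℕ` and `I ∈ ℕⁿ`, of degree `2 - (n+1) - |I|`, subject to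
the homotopy relations, i.e. to the equation `Q² = 0` for the associated derivation. -/
structure ELInfinityAlgebra (𝓔 : ℤ → Submodule K E) where
  ε : (n : ℕ) → (Fin n → ℕ) → MultilinearMap K (fun _ : Fin (n + 1) => E) E
  degree : ∀ (n : ℕ) (I : Fin n → ℕ) (d : Fin (n + 1) → ℤ) (x : Fin (n + 1) → E),
    (∀ i, x i ∈ 𝓔 (d i)) → ε n I x ∈ 𝓔 (∑ i, d i + 1 - n - ∑ j, (I j : ℤ))
  relation : ∀ (n p : ℕ) (d : Fin (n + 1) → ℤ) (x : Fin (n + 1) → E),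
    (∀ i, x i ∈ 𝓔 (d i)) → homotopyRelation ε n p d x = 0

/-- An `EL∞`-algebra is semistrict if `ε_n^I = 0` for `I ≠ (0, …, 0)`. -/
def ELInfinityAlgebra.Semistrict {𝓔 : ℤ → Submodule K E} (A : ELInfinityAlgebra 𝓔) : Prop :=
  ∀ (n : ℕ) (I : Fin n → ℕ), I ≠ 0 → A.ε n I = 0

/-- An (uncurved) `L∞`-algebra structure on a graded vector space `E`: graded antisymmetric higher
products `μ_{n+1} : E^{⊗(n+1)} → E`, `n ∈ ℕ`, of degree `2 - (n+1)`, subject to the homotopy Jacobi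
identities
`∑_{i+j=n} ∑_σ χ(σ) (-1)^j μ_{j+1} (μ_{i+1} (x_{σ 0}, …, x_{σ i}), x_{σ (i+1)}, …, x_{σ n}) = 0`,
where `σ` runs over the permutations that are increasing on `{0, …, i}` and on `{i+1, …, n}`. -/
structure LInfinityAlgebra (𝓔 : ℤ → Submodule K E) where
  μ : (n : ℕ) → MultilinearMap K (fun _ : Fin (n + 1) => E) E
  degree : ∀ (n : ℕ) (d : Fin (n + 1) → ℤ) (x : Fin (n + 1) → E),
    (∀ i, x i ∈ 𝓔 (d i)) → μ n x ∈ 𝓔 (∑ i, d i + 1 - n)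
  antisymm : ∀ (n : ℕ) (d : Fin (n + 1) → ℤ) (x : Fin (n + 1) → E), (∀ i, x i ∈ 𝓔 (d i)) →
    ∀ σ : Equiv.Perm (Fin (n + 1)), μ n x = koszulAltSign σ d • μ n fun i => x (σ i)
  jacobi : ∀ (n : ℕ) (d : Fin (n + 1) → ℤ) (x : Fin (n + 1) → E), (∀ i, x i ∈ 𝓔 (d i)) →
    ∑ ij ∈ Finset.HasAntidiagonal.antidiagonal n,
      ∑ σ : Equiv.Perm (Fin (n + 1)) with
          ∀ a b : Fin (n + 1), a < b → ((b : ℕ) ≤ ij.1 ∨ ij.1 < (a : ℕ)) → σ a < σ b,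
        (koszulAltSign σ d * paritySign ij.2) •
          μ ij.2 (fun l => splice (permSeq x σ) ij.1 0 (μ ij.1 fun j => permSeq x σ j) l) = 0

end Algebras

open Finset

/-! ## Koszul signs -/

/-! For `i = 0` the first quadratic identity says that `⊘₀` is a graded half-shuffle (Zinbiel)
product: `x ⊘₀ (y ⊘₀ z) = (x * y) ⊘₀ z` with `x * y = x ⊘₀ y ± y ⊘₀ x`. Therefore `*` is associative
and graded commutative (`shuffleMul_assoc`), `K ⊕ ℰ(V)` is a unital graded commutative algebra, and
the inclusion of `V` extends to an algebra map `toShuffle` on `⨀V`. A product of letters is the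
signed sum of all words in them (`prod_incl_ofTree`), so the symmetrization is `toShuffle` followed
by the projection to `ℰ(V)`. In the Leibniz rule for `*` the two pairs of `⊘₁`-terms cancel, so
derivations of `ℰ(V)` are ordinary derivations of `*`. In characteristic zero, weighting `⊘₀` by
word lengths gives an algebra map `toSym` with `toSym ∘ toShuffle = id`.

The second ingredient is the derivation `der₀` that vanishes on `V`. It raises the weight, i.e. the
sum of the product indices, by one. For words in `⊘₀` it measures the failure of symmetry: a
suitable linear functional of `der₀ z` is the difference, up to sign, of two coefficients of `z`
whose words differ by an adjacent transposition (`exists_coeff_swap`). Coefficients are computed by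
stripping last letters, and they separate words (`eq_zero_of_coeff_eq_zero`). Hence an element of
`⊘₀^• V` killed by `der₀` is a symmetrization (`symmetrization_toSym`).

For part (2), let `Q` map `V` to `⊘₀^• V`. The weight-one part of `Q² v = 0` is `der₀ (Q v) = 0`, so
`Q v` is a symmetrization, the image of `toShuffle` is stable under `Q`, and `Q` restricts to a
differential on `⨀V`. Conversely, every degree-one map from `V` to `ℰ(V)` extends to a derivation
(`isEilhMap_derTree`, which checks the deformed Leibniz rule against each quadratic relation). Its
square vanishes as soon as it vanishes on `V` (`IsDerivation.square_zero`), and there it vanishes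
because `toShuffle` intertwines the two differentials.

For part (1), the homotopy relations of a semistrict structure are graded by weight `p`. Those with
`p ≥ 2` are empty. The relation with `p = 1` is `∑ ± der₀ (word of σ) ⊗ μ (x_σ) = 0`, and the same
functionals show it to be graded antisymmetry. For `p = 0` and antisymmetric products, the sum over
the places where the inner product is inserted assembles into a shuffle product of two words
(`sum_insertionTerm`). The coefficient of a word in such a product is the signed indicator function
of shuffles (`coeff_uword_mul_uword`), so the coefficients of the relation are, up to sign, the
homotopy Jacobi expressions (`contract_jacobiTensor`). -/

theorem paritySign_eq_ite (z : ℤ) : paritySign z = if Even z then 1 else -1 := by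
  split_ifs with h
  · exact Int.negOnePow_even z h
  · exact Int.negOnePow_odd z (Int.not_even_iff_odd.1 h)

theorem paritySign_add (a b : ℤ) : paritySign (a + b) = paritySign a * paritySign b :=
  Int.negOnePow_add a b

theorem paritySign_congr {a b : ℤ} (h : Even (a - b)) : paritySign a = paritySign b :=
  (Int.negOnePow_eq_iff a b).2 h

theorem units_mul_self (u : ℤˣ) : u * u = 1 := by
  rcases Int.units_eq_one_or u with h | h <;> simp [h]

theorem units_smul_smul_self {M : Type*} [AddCommGroup M] (u : ℤˣ) (x : M) : u • u • x = x := by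
  rw [smul_smul, units_mul_self, one_smul]

theorem LinearMap.map_units_int_smul {K M N : Type*} [Ring K] [AddCommGroup M] [AddCommGroup N]
    [Module K M] [Module K N] (f : M →ₗ[K] N) (u : ℤˣ) (x : M) : f (u • x) = u • f x := by
  rw [Units.smul_def, Units.smul_def, map_zsmul]

theorem Submodule.units_int_smul_mem {K M : Type*} [Ring K] [AddCommGroup M] [Module K M]
    (p : Submodule K M) (u : ℤˣ) {x : M} (hx : x ∈ p) : u • x ∈ p := by
  rw [Units.smul_def]
  exact zsmul_mem hx _

theorem koszulSign_one {n : ℕ} (d : Fin n → ℤ) : koszulSign 1 d = 1 := by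
  unfold koszulSign
  refine prod_eq_one fun i _ => prod_eq_one fun j _ => if_neg ?_
  rintro ⟨h, h'⟩
  exact absurd h (by simpa using h'.le)

theorem Fin.swap_castSucc_succ_lt_iff {n : ℕ} (k : Fin n) (i j : Fin (n + 1))
    (h : ¬ (i = k.castSucc ∧ j = k.succ)) (h' : ¬ (i = k.succ ∧ j = k.castSucc)) :
    Equiv.swap k.castSucc k.succ i < Equiv.swap k.castSucc k.succ j ↔ i < j := by
  simp only [Equiv.swap_apply_def, Fin.lt_def, Fin.ext_iff, Fin.val_castSucc, Fin.val_succ] at *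
  split_ifs <;> simp <;> omega

/-- Exchanging two neighbouring places changes the relative order of this one pair only, so the
product of the two Koszul signs is the factor of that pair. -/
theorem koszulSign_mul_swap {n : ℕ} (σ : Equiv.Perm (Fin (n + 1))) (k : Fin n)
    (d : Fin (n + 1) → ℤ) :
    koszulSign (σ * Equiv.swap k.castSucc k.succ) d =
      koszulSign σ d * paritySign (d (σ k.castSucc) * d (σ k.succ)) := by
  set s := Equiv.swap k.castSucc k.succ with hs
  have hne : k.castSucc ≠ k.succ := Fin.castSucc_lt_succ.ne
  -- Reindexing both products by `s` moves the transposition from the values to the comparison of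
  -- places, so the two signs can be compared factor by factor.
  have h1 : koszulSign (σ * s) d = ∏ i : Fin (n + 1), ∏ j : Fin (n + 1),
      if s i < s j ∧ σ j < σ i then paritySign (d (σ i) * d (σ j)) else 1 := by
    unfold koszulSign
    rw [← Equiv.prod_comp s]
    refine prod_congr rfl fun i _ => ?_
    rw [← Equiv.prod_comp s]
    refine prod_congr rfl fun j _ => ?_
    simp [hs]
  have h2 : koszulSign (σ * s) d * koszulSign σ d =
      paritySign (d (σ k.castSucc) * d (σ k.succ)) := by
    rw [h1]
    unfold koszulSign
    rw [← prod_mul_distrib]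
    simp_rw [← prod_mul_distrib]
    have key : ∀ i j : Fin (n + 1), ¬ (i = k.castSucc ∧ j = k.succ) →
        ¬ (i = k.succ ∧ j = k.castSucc) →
        ((if s i < s j ∧ σ j < σ i then paritySign (d (σ i) * d (σ j)) else 1) *
          if i < j ∧ σ j < σ i then paritySign (d (σ i) * d (σ j)) else 1) = 1 := by
      intro i j h h'
      simp only [hs, Fin.swap_castSucc_succ_lt_iff k i j h h']
      exact units_mul_self _
    rw [← mul_prod_erase univ _ (mem_univ k.castSucc),
      ← mul_prod_erase (univ.erase k.castSucc) _ (mem_erase.2 ⟨hne.symm, mem_univ k.succ⟩)]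
    rw [prod_eq_one (s := (univ.erase k.castSucc).erase k.succ)]
    · rw [prod_eq_single k.succ, prod_eq_single k.castSucc]
      · have hlt : k.castSucc < k.succ := Fin.castSucc_lt_succ
        have e1 : s k.castSucc = k.succ := Equiv.swap_apply_left _ _
        have e2 : s k.succ = k.castSucc := Equiv.swap_apply_right _ _
        rw [e1, e2]
        have hσ : σ k.castSucc ≠ σ k.succ := fun h => hne (σ.injective h)
        rcases lt_or_gt_of_ne hσ with h | h
        · simp [hlt, hlt.not_gt, h, h.not_gt, mul_comm]
        · simp [hlt, hlt.not_gt, h, h.not_gt]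
      · intro j _ hj
        exact key _ _ (fun h => hne h.1.symm) fun h => hj h.2
      · simp
      · intro j _ hj
        exact key _ _ (fun h => hj h.2) fun h => hne h.1
      · simp
    · intro i hi
      rw [mem_erase, mem_erase] at hi
      exact prod_eq_one fun j _ => key i j (fun h => hi.2.1 h.1) fun h => hi.1 h.1
  rw [← h2, mul_comm, mul_assoc, units_mul_self, mul_one]

/-- The inversions of `σ⁻¹` are those of `σ` with the roles of places and values exchanged. -/
theorem koszulSign_inv {n : ℕ} (σ : Equiv.Perm (Fin n)) (d : Fin n → ℤ) :
    koszulSign σ⁻¹ d = koszulSign σ fun i => d (σ⁻¹ i) := by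
  have h : koszulSign σ⁻¹ d = ∏ i : Fin n, ∏ j : Fin n,
      if σ j < σ i ∧ i < j then paritySign (d i * d j) else 1 := by
    unfold koszulSign
    rw [prod_comm, ← Equiv.prod_comp σ]
    refine prod_congr rfl fun i _ => ?_
    rw [← Equiv.prod_comp σ]
    simp [mul_comm]
  rw [h]
  unfold koszulSign
  simp [and_comm]

theorem koszulAltSign_mul_swap {n : ℕ} (σ : Equiv.Perm (Fin (n + 1))) (k : Fin n)
    (d : Fin (n + 1) → ℤ) :
    koszulAltSign (σ * Equiv.swap k.castSucc k.succ) d =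
      -(koszulAltSign σ d * paritySign (d (σ k.castSucc) * d (σ k.succ))) := by
  unfold koszulAltSign
  rw [koszulSign_mul_swap, Equiv.Perm.sign_mul, Equiv.Perm.sign_swap Fin.castSucc_lt_succ.ne]
  simp [mul_assoc]

theorem koszulAltSign_one {n : ℕ} (d : Fin n → ℤ) : koszulAltSign 1 d = 1 := by
  simp [koszulAltSign, koszulSign_one]

/-- Induction on permutations along right multiplication by adjacent transpositions. -/
theorem Equiv.Perm.adjacent_induction {n : ℕ} {p : Equiv.Perm (Fin (n + 1)) → Prop} (one : p 1)
    (mul_swap : ∀ σ (k : Fin n), p σ → p (σ * Equiv.swap k.castSucc k.succ)) (σ) : p σ := by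
  have h : σ ∈ Submonoid.closure
      (Set.range fun i : Fin n => Equiv.swap i.castSucc i.succ) := by
    rw [Equiv.Perm.mclosure_swap_castSucc_succ]
    trivial
  induction h using Submonoid.closure_induction_right with
  | one => exact one
  | mul_right x _ y hy hx =>
    obtain ⟨k, rfl⟩ := hy
    exact mul_swap x k hx

/-! ### Inserting a first element -/

/-- The permutation of `{0, …, n}` that takes the value `0` at `k`, and the values of `π`, shifted
by one, in order at the other places. -/
def insertPerm {n : ℕ} (k : Fin (n + 1)) (π : Equiv.Perm (Fin n)) : Equiv.Perm (Fin (n + 1)) :=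
  ((finSuccEquiv' k).trans (Equiv.optionCongr π)).trans (finSuccEquiv' 0).symm

@[simp] theorem insertPerm_self {n : ℕ} (k : Fin (n + 1)) (π : Equiv.Perm (Fin n)) :
    insertPerm k π k = 0 := by simp [insertPerm]

@[simp] theorem insertPerm_succAbove {n : ℕ} (k : Fin (n + 1)) (π : Equiv.Perm (Fin n))
    (l : Fin n) : insertPerm k π (k.succAbove l) = (π l).succ := by simp [insertPerm]

/-- The place `k` is recovered as the one with value `0`, and `π` from the remaining places.
Counting then suffices, as `(n+1)! = (n+1) · n!`. -/
theorem insertPerm_bijective (n : ℕ) :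
    Function.Bijective fun x : Fin (n + 1) × Equiv.Perm (Fin n) => insertPerm x.1 x.2 := by
  rw [Fintype.bijective_iff_injective_and_card]
  constructor
  · rintro ⟨k, π⟩ ⟨k', π'⟩ h
    simp only at h
    have hk : k = k' := by
      apply (insertPerm k' π').injective
      rw [insertPerm_self, ← h, insertPerm_self]
    subst hk
    refine Prod.ext rfl (Equiv.ext fun l => ?_)
    have := congrArg (fun e => e (k.succAbove l)) h
    simpa using this
  · simp [Fintype.card_perm, Nat.factorial_succ]

/-- The smallest value `0` forms an inversion exactly with the entries placed before it; all other
inversions are those of `π`. -/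
theorem koszulSign_insertPerm {n : ℕ} (k : Fin (n + 1)) (π : Equiv.Perm (Fin n))
    (d : Fin (n + 1) → ℤ) :
    koszulSign (insertPerm k π) d =
      paritySign (d 0 * ∑ l : Fin n with l.val < k.val, d (π l).succ) *
        koszulSign π fun i => d i.succ := by
  unfold koszulSign
  rw [Fin.prod_univ_succAbove _ k]
  have h1 : (∏ j, if k < j ∧ insertPerm k π j < insertPerm k π k then
      paritySign (d (insertPerm k π k) * d (insertPerm k π j)) else 1) = 1 := by
    refine prod_eq_one fun j _ => if_neg ?_
    simp
  rw [h1, one_mul]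
  simp_rw [Fin.prod_univ_succAbove _ k]
  rw [prod_mul_distrib]
  congr 1
  · simp only [insertPerm_self, insertPerm_succAbove, Fin.succ_pos, and_true, mul_zero]
    rw [mul_sum, sum_filter]
    have h2 : ∀ (s : Finset (Fin n)) (f : Fin n → ℤ),
        paritySign (∑ l ∈ s, f l) = ∏ l ∈ s, paritySign (f l) := by
      intro s f
      induction s using Finset.induction_on with
      | empty => simp [paritySign]
      | insert a s ha ih => rw [sum_insert ha, prod_insert ha, paritySign_add, ih]
    rw [h2]
    refine prod_congr rfl fun l _ => ?_
    have h3 : k.succAbove l < k ↔ (l : ℕ) < k := by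
      rw [Fin.succAbove_lt_iff_castSucc_lt, Fin.lt_def, Fin.val_castSucc]
    simp only [h3]
    split_ifs
    · rw [mul_comm]
    · simp [paritySign]
  · refine prod_congr rfl fun i _ => prod_congr rfl fun j _ => ?_
    simp [Fin.succAbove_lt_succAbove_iff]

/-! ### Extension signs -/

theorem extensionSign_congr (n w : ℕ) {c c' : ℕ → ℤ} (h : ∀ l, l ≤ n → c l = c' l) :
    extensionSign n w c = extensionSign n w c' := by
  unfold extensionSign
  have h1 : ∑ j ∈ range (n + 1), (1 - c j) = ∑ j ∈ range (n + 1), (1 - c' j) :=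
    sum_congr rfl fun j hj => by rw [h j (by simpa [Nat.lt_succ_iff] using hj)]
  have h2 : ∑ l ∈ range (n + 1), ∑ j ∈ range l, c j * (1 - c l) =
      ∑ l ∈ range (n + 1), ∑ j ∈ range l, c' j * (1 - c' l) := by
    refine sum_congr rfl fun l hl => sum_congr rfl fun j hj => ?_
    simp only [mem_range] at hl hj
    rw [h l (by omega), h j (by omega)]
  rw [h1, h2]

theorem sum_range_swap {M : Type*} [AddCommMonoid M] (c : ℕ → M) (k N : ℕ) (h : k + 1 < N) :
    ∑ j ∈ range N, c (Equiv.swap k (k + 1) j) = ∑ j ∈ range N, c j := by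
  refine sum_bij (fun j _ => Equiv.swap k (k + 1) j) ?_ ?_ ?_ ?_
  · intro j hj
    simp only [mem_range, Equiv.swap_apply_def] at *
    split_ifs <;> omega
  · intro a _ b _ hab
    exact (Equiv.swap k (k + 1)).injective hab
  · intro b hb
    refine ⟨Equiv.swap k (k + 1) b, ?_, by simp⟩
    simp only [mem_range, Equiv.swap_apply_def] at *
    split_ifs <;> omega
  · intros; rfl

/-- Only the pair `(k, k+1)` changes its order: `c k * (1 - c (k+1))` becomes `c (k+1) * (1 - c k)`.
-/
theorem sum_pairs_swap (c : ℕ → ℤ) (k N : ℕ) (h : k + 1 < N) :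
    ∑ l ∈ range N, ∑ j ∈ range l,
        c (Equiv.swap k (k + 1) j) * (1 - c (Equiv.swap k (k + 1) l)) =
      (∑ l ∈ range N, ∑ j ∈ range l, c j * (1 - c l)) + c (k + 1) - c k := by
  induction N with
  | zero => omega
  | succ N ih =>
    rw [sum_range_succ, sum_range_succ _ N]
    rcases Nat.lt_or_ge (k + 1) N with hN | hN
    · rw [ih hN]
      have e : Equiv.swap k (k + 1) N = N :=
        Equiv.swap_apply_of_ne_of_ne (by omega) (by omega)
      rw [e, ← sum_mul, ← sum_mul, sum_range_swap c k N hN]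
      ring
    · obtain rfl : N = k + 1 := by omega
      have e : ∀ j, j < k → Equiv.swap k (k + 1) j = j := fun j hj =>
        Equiv.swap_apply_of_ne_of_ne (by omega) (by omega)
      rw [sum_range_succ, sum_range_succ _ k, sum_range_succ _ k, sum_range_succ _ k]
      have e1 : ∑ l ∈ range k, ∑ j ∈ range l,
          c (Equiv.swap k (k + 1) j) * (1 - c (Equiv.swap k (k + 1) l)) =
          ∑ l ∈ range k, ∑ j ∈ range l, c j * (1 - c l) := by
        refine sum_congr rfl fun l hl => sum_congr rfl fun j hj => ?_
        simp only [mem_range] at hl hj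
        rw [e l hl, e j (by omega)]
      have e2 : ∀ x, ∑ j ∈ range k, c (Equiv.swap k (k + 1) j) * (1 - x) =
          ∑ j ∈ range k, c j * (1 - x) := fun x =>
        sum_congr rfl fun j hj => by rw [e j (mem_range.1 hj)]
      rw [e1, e2, e2]
      simp only [Equiv.swap_apply_left, Equiv.swap_apply_right]
      ring

theorem extensionSign_swap (n w : ℕ) (c : ℕ → ℤ) (k : ℕ) (h : k + 1 ≤ n) :
    extensionSign n w (fun l => c (Equiv.swap k (k + 1) l)) =
      paritySign (c k + c (k + 1)) * extensionSign n w c := by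
  unfold extensionSign
  rw [sum_pairs_swap c k (n + 1) (by omega), sum_range_swap (fun j => 1 - c j) k (n + 1) (by omega),
    ← paritySign_add]
  apply paritySign_congr
  ring_nf
  simp

/-- Compares the sign of a nested expression, with an inner operation in the first slot, with that
of the unnested word. Apart from the total degree, the discrepancy depends on `q` alone, which is
the source of the factor `(-1)^k` in the homotopy Jacobi identity. -/
theorem extensionSign_cons (q m : ℕ) (c : ℕ → ℤ) (D : ℤ)
    (hD : D = ∑ j ∈ range (m + 1), c j + 1 - m) :
    extensionSign q 0 (fun l => if l = 0 then D else c (l + m)) * extensionSign m 0 c =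
      paritySign (q + 1 + ∑ j ∈ range (q + m + 1), (1 - c j)) * extensionSign (q + m) 0 c := by
  unfold extensionSign
  rw [← paritySign_add, ← paritySign_add]
  apply paritySign_congr
  have split : ∀ f : ℕ → ℤ, ∑ j ∈ range (q + m + 1), f j =
      ∑ j ∈ range (m + 1), f j + ∑ j ∈ range q, f (j + 1 + m) := by
    intro f
    rw [show q + m + 1 = (m + 1) + q by ring, sum_range_add]
    congr 1
    refine sum_congr rfl fun j _ => ?_
    congr 1; omega
  have split' : ∀ l, ∀ f : ℕ → ℤ, ∑ j ∈ range (l + 1 + m), f j =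
      ∑ j ∈ range (m + 1), f j + ∑ j ∈ range l, f (j + 1 + m) := by
    intro l f
    rw [show l + 1 + m = (m + 1) + l by ring, sum_range_add]
    congr 1
    refine sum_congr rfl fun j _ => ?_
    congr 1; omega
  rw [split, split, sum_range_succ', sum_range_succ' _ q]
  simp_rw [split', sum_range_succ' _ (_ : ℕ)]
  simp only [Nat.add_eq_zero_iff, one_ne_zero, and_false, if_false, if_true, range_zero, sum_empty,
    add_zero, ← sum_mul, ← mul_sum, sum_add_distrib, sum_sub_distrib, sum_const, card_range,
    nsmul_eq_mul, mul_one, add_mul]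
  push_cast
  rw [sum_range_succ'] at hD
  subst hD
  -- All sums are now split at the end of the inner block. Both exponents are polynomials in the
  -- sums `X`, `Y`, `Z`, `W`, in `c 0`, `m` and `q`, so only the parities of these matter.
  generalize ∑ x ∈ range m, c (x + 1) = X
  generalize ∑ x ∈ range q, c (x + 1 + m) = Y
  generalize ∑ x ∈ range q, (∑ x ∈ range x, c (x + 1 + m)) * (1 - c (x + 1 + m)) = Z
  generalize ∑ x ∈ range m, (∑ x ∈ range x, c (x + 1)) * (1 - c (x + 1)) = W
  simp only [Int.even_add, Int.even_sub, Int.even_mul, Int.not_even_one, Even.zero]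
  by_cases h1 : Even (m : ℤ) <;> by_cases h2 : Even (q : ℤ) <;> by_cases h3 : Even X <;>
    by_cases h4 : Even Y <;> by_cases h5 : Even (c 0) <;> by_cases h6 : Even Z <;>
    by_cases h7 : Even W <;> simp [h1, h2, h3, h4, h5, h6, h7]

theorem Finset.sum_range_permSeq {n : ℕ} (g : Fin (n + 1) → ℤ) (σ : Equiv.Perm (Fin (n + 1))) :
    ∑ j ∈ range (n + 1), permSeq g σ j = ∑ i, g i := by
  rw [← Equiv.sum_comp σ, ← Fin.sum_univ_eq_sum_range]
  simp [permSeq]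

theorem permSeq_mul_swap {α : Type*} {n : ℕ} (f : Fin (n + 1) → α) (σ : Equiv.Perm (Fin (n + 1)))
    (k : Fin n) (l : ℕ) (hl : l ≤ n) :
    permSeq f (σ * Equiv.swap k.castSucc k.succ) l =
      permSeq f σ (Equiv.swap (k : ℕ) (k + 1) l) := by
  have hk : (k : ℕ) + 1 < n + 1 := by omega
  have h1 : ∀ j (hj : j < n + 1), Fin.ofNat (n + 1) j = ⟨j, hj⟩ := fun j hj => by
    simp [Fin.ext_iff, Nat.mod_eq_of_lt hj]
  unfold permSeq
  rw [Equiv.Perm.mul_apply, h1 l (by omega)]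
  congr 2
  simp only [Equiv.swap_apply_def, Fin.ext_iff, Fin.val_castSucc, Fin.val_succ]
  split_ifs
  · rw [h1 _ hk]; rfl
  · rw [h1 _ (by omega)]; rfl
  · rw [h1 _ (by omega)]

theorem permSeq_apply {α : Type*} {n : ℕ} (f : Fin (n + 1) → α) (σ : Equiv.Perm (Fin (n + 1)))
    (i : Fin (n + 1)) : permSeq f σ i = f (σ i) := by
  simp [permSeq]

/-- For an adjacent transposition of entries of degrees `a`, `b` this is the congruence `a + b ≡ 1 +
a b + (1 - a)(1 - b)` modulo 2: the extension sign converts the antisymmetric sign of the elements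
into the symmetric sign of their letters. -/
theorem extensionSign_perm {n : ℕ} (d : Fin (n + 1) → ℤ) (σ : Equiv.Perm (Fin (n + 1))) :
    extensionSign n 0 (permSeq d σ) =
      koszulAltSign σ d * koszulSign σ (fun i => 1 - d i) * extensionSign n 0 (permSeq d 1) := by
  induction σ using Equiv.Perm.adjacent_induction with
  | one => simp [koszulAltSign_one, koszulSign_one]
  | mul_swap σ k ih =>
    rw [extensionSign_congr n 0 (permSeq_mul_swap d σ k),
      extensionSign_swap n 0 _ k (by omega), ih, koszulAltSign_mul_swap, koszulSign_mul_swap]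
    have e1 := permSeq_apply d σ k.castSucc
    have e2 := permSeq_apply d σ k.succ
    rw [Fin.val_castSucc] at e1
    rw [Fin.val_succ] at e2
    rw [e1, e2]
    generalize d (σ k.castSucc) = a
    generalize d (σ k.succ) = b
    have : paritySign (a + b) = -(paritySign (a * b) * paritySign ((1 - a) * (1 - b))) := by
      rw [← paritySign_add, neg_eq_neg_one_mul, ← Int.negOnePow_one]
      change _ = paritySign 1 * _
      rw [← paritySign_add]
      apply paritySign_congr
      ring_nf
      simp [Int.even_mul, Int.even_add, Int.even_sub]
    rw [this]
    simp only [neg_mul, mul_neg]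
    congr 1
    ac_rfl

/-! ## Linear maps out of the free `Eilh`-algebra -/

section Lift

variable {K V W : Type*} [Field K] [AddCommGroup V] [Module K V] [AddCommGroup W] [Module K W]
variable {𝒱 : ℤ → Submodule K V}

namespace EilhTree

/-- The number of leaves of a monomial. -/
def len : EilhTree 𝒱 → ℕ
  | leaf _ _ => 1
  | op _ a b => a.len + b.len

/-- The sum of the indices of the products in a monomial. -/
def wt : EilhTree 𝒱 → ℕ
  | leaf _ _ => 0
  | op i a b => a.wt + b.wt + i

/-- Degree, length and weight of a monomial; the relations are homogeneous for all three. -/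
def type (a : EilhTree 𝒱) : ℤ × ℕ × ℕ := (a.deg, a.len, a.wt)

theorem deg_op (i : ℕ) (a b : EilhTree 𝒱) : (op i a b).deg = a.deg + b.deg + i := rfl
theorem len_op (i : ℕ) (a b : EilhTree 𝒱) : (op i a b).len = a.len + b.len := rfl
theorem wt_op (i : ℕ) (a b : EilhTree 𝒱) : (op i a b).wt = a.wt + b.wt + i := rfl
theorem deg_leaf (d : ℤ) (v : 𝒱 d) : (leaf d v).deg = d := rfl
theorem len_leaf (d : ℤ) (v : 𝒱 d) : (leaf d v).len = 1 := rfl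
theorem wt_leaf (d : ℤ) (v : 𝒱 d) : (leaf d v).wt = 0 := rfl

theorem len_pos (a : EilhTree 𝒱) : 0 < a.len := by
  induction a with
  | leaf => simp [len]
  | op i a b ha hb => simp [len, ha]

theorem type_eq_iff {a b : EilhTree 𝒱} :
    a.type = b.type ↔ a.deg = b.deg ∧ a.len = b.len ∧ a.wt = b.wt := by
  simp [type, Prod.ext_iff]

theorem opFree_mon_mon (i : ℕ) (a b : EilhTree 𝒱) :
    opFree i (mon a : EilhTree 𝒱 →₀ K) (mon b) = mon (op i a b) := by
  simp [opFree, mon]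

/-- Functions on monomials that respect the relations of the free `Eilh`-algebra and hence extend
to linear maps on `ℰ(V)`. -/
structure IsEilhMap (φ : EilhTree 𝒱 → W) : Prop where
  leaf_add : ∀ (d : ℤ) (v w : 𝒱 d), φ (leaf d (v + w)) = φ (leaf d v) + φ (leaf d w)
  leaf_smul : ∀ (d : ℤ) (c : K) (v : 𝒱 d), φ (leaf d (c • v)) = c • φ (leaf d v)
  eq : ∀ (i : ℕ) (a b c : EilhTree 𝒱), φ (op i a (op i b c)) =
    paritySign (i * (a.deg + 1)) •
      (φ (op i (op i a b) c) + paritySign (i + a.deg * b.deg) • φ (op i (op i b a) c))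
  lt : ∀ (i j : ℕ) (_ : i < j) (a b c : EilhTree 𝒱), φ (op i a (op j b c)) =
    paritySign (i * j + j * a.deg) • φ (op j (op i a b) c)
  gt_one : ∀ (i : ℕ) (a b c : EilhTree 𝒱), φ (op (i + 1) a (op i b c)) =
    paritySign (i * a.deg + a.deg * b.deg) • φ (op (i + 1) (op i b a) c)
  gt_two : ∀ (i : ℕ) (a b c : EilhTree 𝒱), φ (op (i + 2) a (op i b c)) =
    paritySign (i * a.deg + a.deg * b.deg) • φ (op (i + 2) (op i b a) c) +
      paritySign (i * (a.deg + (i + 2 : ℕ) + 1) + (a.deg + b.deg) * c.deg) •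
        φ (op (i + 1) (op (i + 1) c a) b)
  gt_many : ∀ (i k : ℕ) (a b c : EilhTree 𝒱), φ (op (i + k + 3) a (op i b c)) =
    paritySign (i * a.deg + a.deg * b.deg) • φ (op (i + k + 3) (op i b a) c) +
      paritySign (i * (a.deg + (i + k + 3 : ℕ) + 1) + (a.deg + b.deg) * c.deg) •
        φ (op (i + 1) (op (i + k + 2) c a) b) +
      paritySign ((i + k + 3 : ℕ) + a.deg * (b.deg + i) + (a.deg + b.deg) * c.deg) •
        φ (op (i + k + 2) (op (i + 1) c b) a)
  left : ∀ (i : ℕ) (a : EilhTree 𝒱) (u : ℤ × ℕ × ℕ), ∃ (M : W →ₗ[K] W) (M' : Eilh 𝒱 →ₗ[K] W),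
    ∀ b : EilhTree 𝒱, b.type = u → φ (op i a b) = M (φ b) + M' (Eilh.ofTree b)
  right : ∀ (i : ℕ) (b : EilhTree 𝒱) (u : ℤ × ℕ × ℕ), ∃ (M : W →ₗ[K] W) (M' : Eilh 𝒱 →ₗ[K] W),
    ∀ a : EilhTree 𝒱, a.type = u → φ (op i a b) = M (φ a) + M' (Eilh.ofTree a)

/-- The span of the monomials of a given type. -/
noncomputable def typeSpan (𝒱 : ℤ → Submodule K V) (u : ℤ × ℕ × ℕ) :
    Submodule K (EilhTree 𝒱 →₀ K) :=
  Submodule.span K {x | ∃ a : EilhTree 𝒱, a.type = u ∧ x = mon a}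

theorem mon_mem_typeSpan {a : EilhTree 𝒱} {u : ℤ × ℕ × ℕ} (h : a.type = u) :
    (mon a : EilhTree 𝒱 →₀ K) ∈ typeSpan 𝒱 u :=
  Submodule.subset_span ⟨a, h, rfl⟩

theorem linearCombination_mon (φ : EilhTree 𝒱 → W) (a : EilhTree 𝒱) :
    Finsupp.linearCombination K φ (mon a) = φ a := by
  simp [mon]

/-- The signs in a Leibniz rule depend on degrees. On a fixed type they are constant, which is why
the closure conditions of `IsEilhMap` are only asked for type by type. -/
theorem Relator.mem_typeSpan {r : EilhTree 𝒱 →₀ K} (h : Relator r) :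
    ∃ u, r ∈ typeSpan 𝒱 u := by
  induction h with
  | leaf_add d v w =>
    exact ⟨(leaf d v).type, sub_mem (sub_mem (mon_mem_typeSpan rfl) (mon_mem_typeSpan rfl))
      (mon_mem_typeSpan rfl)⟩
  | leaf_smul d c v =>
    exact ⟨(leaf d v).type, sub_mem (mon_mem_typeSpan rfl)
      (Submodule.smul_mem _ _ (mon_mem_typeSpan rfl))⟩
  | eq i a b c =>
    refine ⟨_, sub_mem (mon_mem_typeSpan rfl) (Submodule.units_int_smul_mem _ _ (add_mem ?_
      (Submodule.units_int_smul_mem _ _ ?_)))⟩ <;> apply mon_mem_typeSpan <;> rw [type_eq_iff] <;>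
      simp only [deg_op, len_op, wt_op] <;> refine ⟨?_, ?_, ?_⟩ <;> ring
  | lt i j h a b c =>
    refine ⟨_, sub_mem (mon_mem_typeSpan rfl) (Submodule.units_int_smul_mem _ _ ?_)⟩ <;>
      apply mon_mem_typeSpan <;> rw [type_eq_iff] <;>
      simp only [deg_op, len_op, wt_op] <;> refine ⟨?_, ?_, ?_⟩ <;> ring
  | gt_one i j h a b c =>
    refine ⟨_, sub_mem (mon_mem_typeSpan rfl) (Submodule.units_int_smul_mem _ _ ?_)⟩ <;>
      apply mon_mem_typeSpan <;> rw [type_eq_iff] <;>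
      simp only [deg_op, len_op, wt_op] <;> refine ⟨?_, ?_, ?_⟩ <;> ring
  | gt_two i j h a b c =>
    subst h
    refine ⟨_, sub_mem (mon_mem_typeSpan rfl) (add_mem (Submodule.units_int_smul_mem _ _ ?_)
      (Submodule.units_int_smul_mem _ _ ?_))⟩ <;>
      apply mon_mem_typeSpan <;> rw [type_eq_iff] <;>
      simp only [deg_op, len_op, wt_op, Nat.add_succ_sub_one] <;> refine ⟨?_, ?_, ?_⟩ <;>
      push_cast <;> ring
  | gt_many i j h a b c =>
    obtain ⟨k, rfl⟩ : ∃ k, j = i + k + 3 := ⟨j - i - 3, by omega⟩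
    refine ⟨_, sub_mem (mon_mem_typeSpan rfl) (add_mem (add_mem
      (Submodule.units_int_smul_mem _ _ ?_)
      (Submodule.units_int_smul_mem _ _ ?_)) (Submodule.units_int_smul_mem _ _ ?_))⟩ <;>
      apply mon_mem_typeSpan <;> rw [type_eq_iff] <;>
      simp only [deg_op, len_op, wt_op, Nat.add_succ_sub_one] <;> refine ⟨?_, ?_, ?_⟩ <;>
      push_cast <;> ring
  | mul_left i a r h ih =>
    obtain ⟨u, hu⟩ := ih
    refine ⟨(a.deg + u.1 + i, a.len + u.2.1, a.wt + u.2.2 + i), ?_⟩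
    have : typeSpan 𝒱 u ≤ (typeSpan 𝒱 (a.deg + u.1 + i, a.len + u.2.1, a.wt + u.2.2 + i)).comap
        (opFree i (mon a)) := by
      refine Submodule.span_le.2 ?_
      rintro _ ⟨b, rfl, rfl⟩
      simp only [Submodule.comap_coe, Set.mem_preimage, SetLike.mem_coe, opFree_mon_mon]
      exact mon_mem_typeSpan rfl
    exact this hu
  | mul_right i a r h ih =>
    obtain ⟨u, hu⟩ := ih
    refine ⟨(u.1 + a.deg + i, u.2.1 + a.len, u.2.2 + a.wt + i), ?_⟩
    have : typeSpan 𝒱 u ≤ (typeSpan 𝒱 (u.1 + a.deg + i, u.2.1 + a.len, u.2.2 + a.wt + i)).comap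
        ((opFree i).flip (mon a)) := by
      refine Submodule.span_le.2 ?_
      rintro _ ⟨b, rfl, rfl⟩
      simp only [Submodule.comap_coe, Set.mem_preimage, SetLike.mem_coe, LinearMap.flip_apply,
        opFree_mon_mon]
      exact mon_mem_typeSpan rfl
    exact this hu

theorem Relator.mkQ_eq_zero {r : EilhTree 𝒱 →₀ K} (h : Relator r) : (eilhIdeal 𝒱).mkQ r = 0 := by
  rw [Submodule.mkQ_apply, Submodule.Quotient.mk_eq_zero]
  exact Submodule.subset_span h

/-- Induction over the construction of the relations. The clauses `left` and `right` handle
multiplication of a relation by a monomial: `φ` of a product is linear in `φ` of the varying factor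
and in its class in `ℰ(V)`. On a relation the first vanishes by induction and the second by
definition of the quotient. Allowing both terms makes the criterion wide enough for derivations. -/
theorem IsEilhMap.relator {φ : EilhTree 𝒱 → W} (hφ : IsEilhMap φ) {r : EilhTree 𝒱 →₀ K}
    (h : Relator r) : Finsupp.linearCombination K φ r = 0 := by
  induction h with
  | leaf_add d v w =>
    simp only [map_sub, linearCombination_mon, hφ.leaf_add]
    abel
  | leaf_smul d c v =>
    simp only [map_sub, map_smul, linearCombination_mon, hφ.leaf_smul, sub_self]
  | eq i a b c =>
    simp only [map_sub, map_add, LinearMap.map_units_int_smul, linearCombination_mon, hφ.eq,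
      sub_self]
  | lt i j h a b c =>
    simp only [map_sub, map_add, LinearMap.map_units_int_smul, linearCombination_mon, hφ.lt i j h,
      sub_self]
  | gt_one i j h a b c =>
    subst h
    simp only [map_sub, map_add, LinearMap.map_units_int_smul, linearCombination_mon, hφ.gt_one,
      sub_self]
  | gt_two i j h a b c =>
    subst h
    simp only [map_sub, map_add, LinearMap.map_units_int_smul, linearCombination_mon, hφ.gt_two,
      Nat.add_succ_sub_one, sub_self]
  | gt_many i j h a b c =>
    obtain ⟨k, rfl⟩ : ∃ k, j = i + k + 3 := ⟨j - i - 3, by omega⟩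
    simp only [map_sub, map_add, LinearMap.map_units_int_smul, linearCombination_mon, hφ.gt_many,
      Nat.add_succ_sub_one, sub_self]
  | mul_left i a r h ih =>
    obtain ⟨u, hu⟩ := h.mem_typeSpan
    obtain ⟨M, M', hM⟩ := hφ.left i a u
    have key : ∀ x ∈ typeSpan 𝒱 u, (Finsupp.linearCombination K φ ∘ₗ opFree i (mon a)) x =
        (M ∘ₗ Finsupp.linearCombination K φ + M' ∘ₗ (eilhIdeal 𝒱).mkQ) x := by
      apply LinearMap.eqOn_span
      rintro _ ⟨b, hb, rfl⟩
      simp only [LinearMap.comp_apply, LinearMap.add_apply, opFree_mon_mon, linearCombination_mon,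
        hM b hb]
      rfl
    have := key _ hu
    simp only [LinearMap.comp_apply, LinearMap.add_apply, ih, h.mkQ_eq_zero, map_zero,
      add_zero] at this
    exact this
  | mul_right i a r h ih =>
    obtain ⟨u, hu⟩ := h.mem_typeSpan
    obtain ⟨M, M', hM⟩ := hφ.right i a u
    have key : ∀ x ∈ typeSpan 𝒱 u, (Finsupp.linearCombination K φ ∘ₗ (opFree i).flip (mon a)) x =
        (M ∘ₗ Finsupp.linearCombination K φ + M' ∘ₗ (eilhIdeal 𝒱).mkQ) x := by
      apply LinearMap.eqOn_span
      rintro _ ⟨b, hb, rfl⟩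
      simp only [LinearMap.comp_apply, LinearMap.add_apply, LinearMap.flip_apply, opFree_mon_mon,
        linearCombination_mon, hM b hb]
      rfl
    have := key _ hu
    simp only [LinearMap.comp_apply, LinearMap.add_apply, ih, h.mkQ_eq_zero, map_zero,
      add_zero] at this
    exact this

end EilhTree

namespace Eilh

open EilhTree

/-- The linear extension of a function on monomials that respects the relations. -/
noncomputable def lift (φ : EilhTree 𝒱 → W) (hφ : IsEilhMap φ) : Eilh 𝒱 →ₗ[K] W :=
  (eilhIdeal 𝒱).liftQ (Finsupp.linearCombination K φ)
    (by
      unfold eilhIdeal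
      exact Submodule.span_le.2 fun _ hr => hφ.relator hr)

@[simp] theorem lift_ofTree (φ : EilhTree 𝒱 → W) (hφ : IsEilhMap φ) (a : EilhTree 𝒱) :
    lift φ hφ (ofTree a) = φ a := by
  rw [lift, ofTree, Submodule.mkQ_apply, Submodule.liftQ_apply, linearCombination_mon]

theorem span_ofTree : Submodule.span K (Set.range (ofTree : EilhTree 𝒱 → Eilh 𝒱)) = ⊤ := by
  have h : Set.range (ofTree : EilhTree 𝒱 → Eilh 𝒱) =
      (eilhIdeal 𝒱).mkQ '' Set.range (mon : EilhTree 𝒱 → _) := by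
    rw [← Set.range_comp]; rfl
  rw [h, ← Submodule.map_span]
  have h2 : Submodule.span K (Set.range (mon : EilhTree 𝒱 → (EilhTree 𝒱 →₀ K))) = ⊤ := by
    rw [eq_top_iff]
    intro x _
    induction x using Finsupp.induction_linear with
    | zero => simp
    | add f g hf hg => exact add_mem (hf trivial) (hg trivial)
    | single a c =>
      have h1 : (Finsupp.single a c : EilhTree 𝒱 →₀ K) = c • mon a := by simp [mon]
      rw [h1]
      exact Submodule.smul_mem _ _ (Submodule.subset_span ⟨a, rfl⟩)
  rw [h2, Submodule.map_top, Submodule.range_mkQ]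

theorem ext_ofTree {f g : Eilh 𝒱 →ₗ[K] W} (h : ∀ a, f (ofTree a) = g (ofTree a)) : f = g := by
  refine LinearMap.ext_on span_ofTree ?_
  rintro _ ⟨a, rfl⟩
  exact h a

theorem ofTree_mem_homogeneous {a : EilhTree 𝒱} {m : ℤ} (h : a.deg = m) :
    ofTree a ∈ homogeneous 𝒱 m := Submodule.subset_span ⟨a, h, rfl⟩

theorem homogeneous_induction {m : ℤ} {p : Eilh 𝒱 → Prop} {x : Eilh 𝒱} (hx : x ∈ homogeneous 𝒱 m)
    (tree : ∀ a : EilhTree 𝒱, a.deg = m → p (ofTree a))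
    (zero : p 0) (add : ∀ x y, p x → p y → p (x + y)) (smul : ∀ (c : K) x, p x → p (c • x)) :
    p x := by
  unfold homogeneous at hx
  induction hx using Submodule.span_induction with
  | mem x h => obtain ⟨a, ha, rfl⟩ := h; exact tree a ha
  | zero => exact zero
  | add x y _ _ hx hy => exact add x y hx hy
  | smul c x _ hx => exact smul c x hx

theorem eq_of_homogeneous {m : ℤ} {f g : Eilh 𝒱 →ₗ[K] W}
    (h : ∀ a : EilhTree 𝒱, a.deg = m → f (ofTree a) = g (ofTree a)) {x : Eilh 𝒱}
    (hx : x ∈ homogeneous 𝒱 m) : f x = g x := by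
  have : Set.EqOn f g (homogeneous 𝒱 m) := by
    apply LinearMap.eqOn_span
    rintro _ ⟨b, hb, rfl⟩
    exact h b hb
  exact this hx

/-- The space of trilinear operations on `ℰ(V)`. -/
abbrev Trilinear (𝒱 : ℤ → Submodule K V) := Eilh 𝒱 →ₗ[K] Eilh 𝒱 →ₗ[K] Eilh 𝒱 →ₗ[K] Eilh 𝒱

/-- A trilinear operation multiplied by a sign. -/
noncomputable def signMul (u : ℤˣ) (f : Trilinear 𝒱) : Trilinear 𝒱 := ((u : ℤ) : K) • f

theorem signMul_apply (u : ℤˣ) (f : Trilinear 𝒱) (x y z : Eilh 𝒱) :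
    signMul u f x y z = u • f x y z := by
  rw [signMul, LinearMap.smul_apply, LinearMap.smul_apply, LinearMap.smul_apply,
    Int.cast_smul_eq_zsmul, Units.smul_def]

/-- Trilinear maps that agree on monomials of given degrees agree on homogeneous elements. -/
theorem eq_of_homogeneous₃ {p q r : ℤ} {f g : Eilh 𝒱 →ₗ[K] Eilh 𝒱 →ₗ[K] Eilh 𝒱 →ₗ[K] W}
    (h : ∀ a b c : EilhTree 𝒱, a.deg = p → b.deg = q → c.deg = r →
      f (ofTree a) (ofTree b) (ofTree c) = g (ofTree a) (ofTree b) (ofTree c))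
    {x y z : Eilh 𝒱} (hx : x ∈ homogeneous 𝒱 p) (hy : y ∈ homogeneous 𝒱 q)
    (hz : z ∈ homogeneous 𝒱 r) : f x y z = g x y z := by
  refine eq_of_homogeneous (f := (f.flip y).flip z) (g := (g.flip y).flip z) (fun a ha => ?_) hx
  simp only [LinearMap.flip_apply]
  refine eq_of_homogeneous (f := (f (ofTree a)).flip z) (g := (g (ofTree a)).flip z)
    (fun b hb => ?_) hy
  simp only [LinearMap.flip_apply]
  exact eq_of_homogeneous (fun c hc => h a b c ha hb hc) hz

theorem op_mem_homogeneous (i : ℕ) {p q r : ℤ} {x y : Eilh 𝒱} (hx : x ∈ homogeneous 𝒱 p)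
    (hy : y ∈ homogeneous 𝒱 q) (hr : p + q + i = r) : op i x y ∈ homogeneous 𝒱 r := by
  refine homogeneous_induction (p := fun x => op i x y ∈ homogeneous 𝒱 r) hx
    (fun a ha => ?_) (by simp)
    (fun x y hx hy => by simpa using add_mem hx hy)
    (fun c x hx => by simpa using Submodule.smul_mem _ c hx)
  refine homogeneous_induction (p := fun y => op i (ofTree a) y ∈ homogeneous 𝒱 r) hy (fun b hb => ?_) (by simp)
    (fun x y hx hy => by simpa using add_mem hx hy)
    (fun c x hx => by simpa using Submodule.smul_mem _ c hx)
  rw [op_ofTree]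
  exact ofTree_mem_homogeneous (by rw [deg_op, ha, hb, hr])

theorem ofTree_leaf_add (d : ℤ) (v w : 𝒱 d) :
    (ofTree (leaf d (v + w)) : Eilh 𝒱) = ofTree (leaf d v) + ofTree (leaf d w) := by
  have := (Relator.leaf_add d v w).mkQ_eq_zero
  rw [map_sub, map_sub, sub_sub, sub_eq_zero] at this
  exact this

theorem ofTree_leaf_smul (d : ℤ) (c : K) (v : 𝒱 d) :
    (ofTree (leaf d (c • v)) : Eilh 𝒱) = c • ofTree (leaf d v) := by
  have := (Relator.leaf_smul d c v).mkQ_eq_zero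
  rw [map_sub, map_smul, sub_eq_zero] at this
  exact this

/-- The trilinear map `x ⊘ᵢ (y ⊘ⱼ z)`. -/
noncomputable def opRight (i j : ℕ) : Trilinear 𝒱 :=
  ((LinearMap.llcomp K _ _ _).comp (op i)).compl₂ (op j)

/-- The trilinear map `(x ⊘ᵢ y) ⊘ⱼ z`. -/
noncomputable def opLeft (i j : ℕ) : Trilinear 𝒱 :=
  (op i).compr₂ (op j)

/-- The trilinear map `(z ⊘ᵢ x) ⊘ⱼ y`. -/
noncomputable def opLeft' (i j : ℕ) : Trilinear 𝒱 :=
  LinearMap.lflip.toLinearMap ∘ₗ (opLeft i j).flip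

theorem opRight_apply (i j : ℕ) (x y z : Eilh 𝒱) : opRight i j x y z = op i x (op j y z) := rfl
theorem opLeft_apply (i j : ℕ) (x y z : Eilh 𝒱) : opLeft i j x y z = op j (op i x y) z := rfl
theorem opLeft'_apply (i j : ℕ) (x y z : Eilh 𝒱) : opLeft' i j x y z = op j (op i z x) y := rfl

/-- Packages the defining relations as identities in `ℰ(V)`; the closure clauses hold with `M = 0`.
-/
theorem isEilhMap_ofTree : IsEilhMap (ofTree : EilhTree 𝒱 → Eilh 𝒱) where
  leaf_add := ofTree_leaf_add
  leaf_smul := ofTree_leaf_smul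
  eq i a b c := by
    have := (Relator.eq i a b c).mkQ_eq_zero
    simp only [map_sub, map_add, LinearMap.map_units_int_smul, sub_eq_zero] at this
    exact this
  lt i j h a b c := by
    have := (Relator.lt i j h a b c).mkQ_eq_zero
    simp only [map_sub, map_add, LinearMap.map_units_int_smul, sub_eq_zero] at this
    exact this
  gt_one i a b c := by
    have := (Relator.gt_one i _ rfl a b c).mkQ_eq_zero
    simp only [map_sub, map_add, LinearMap.map_units_int_smul, sub_eq_zero] at this
    exact this
  gt_two i a b c := by
    have := (Relator.gt_two i _ rfl a b c).mkQ_eq_zero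
    simp only [map_sub, map_add, LinearMap.map_units_int_smul, sub_eq_zero] at this
    exact this
  gt_many i k a b c := by
    have := (Relator.gt_many i (i + k + 3) (by omega) a b c).mkQ_eq_zero
    simp only [map_sub, map_add, LinearMap.map_units_int_smul, sub_eq_zero] at this
    exact this
  left i a u := ⟨0, op i (ofTree a), fun b _ => by simp [op_ofTree]⟩
  right i b u := ⟨0, (op i).flip (ofTree b), fun a _ => by simp [op_ofTree]⟩

variable {p q r : ℤ} {x y z : Eilh 𝒱}

/-- The values of a derivation are homogeneous but not monomials, so this relation and the following
ones are carried over from monomials to homogeneous elements by trilinearity. -/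
theorem op_eq (i : ℕ) (hx : x ∈ homogeneous 𝒱 p) (hy : y ∈ homogeneous 𝒱 q)
    (hz : z ∈ homogeneous 𝒱 r) : op i x (op i y z) =
      paritySign (i * (p + 1)) •
        (op i (op i x y) z + paritySign (i + p * q) • op i (op i y x) z) := by
  have := eq_of_homogeneous₃ (f := opRight i i)
    (g := signMul (paritySign (i * (p + 1))) (opLeft i i +
      signMul (paritySign (i + p * q)) (opLeft i i).flip))
    (fun a b c ha hb hc => ?_) hx hy hz
  · simpa only [signMul_apply, LinearMap.add_apply, LinearMap.flip_apply, opLeft_apply,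
      opRight_apply] using this
  · subst ha hb hc
    simp only [signMul_apply, LinearMap.add_apply, LinearMap.flip_apply, opLeft_apply,
      opRight_apply, op_ofTree]
    exact isEilhMap_ofTree.eq i a b c

theorem op_lt (i j : ℕ) (h : i < j) (hx : x ∈ homogeneous 𝒱 p) (hy : y ∈ homogeneous 𝒱 q)
    (hz : z ∈ homogeneous 𝒱 r) : op i x (op j y z) =
      paritySign (i * j + j * p) • op j (op i x y) z := by
  have := eq_of_homogeneous₃ (f := opRight i j)
    (g := signMul (paritySign (i * j + j * p)) (opLeft i j))
    (fun a b c ha hb hc => ?_) hx hy hz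
  · simpa only [signMul_apply, LinearMap.add_apply, LinearMap.flip_apply, opLeft_apply,
      opRight_apply] using this
  · subst ha hb hc
    simp only [signMul_apply, LinearMap.add_apply, LinearMap.flip_apply, opLeft_apply,
      opRight_apply, op_ofTree]
    exact isEilhMap_ofTree.lt i j h a b c

theorem op_gt_one (i : ℕ) (hx : x ∈ homogeneous 𝒱 p) (hy : y ∈ homogeneous 𝒱 q)
    (hz : z ∈ homogeneous 𝒱 r) : op (i + 1) x (op i y z) =
      paritySign (i * p + p * q) • op (i + 1) (op i y x) z := by
  have := eq_of_homogeneous₃ (f := opRight (i + 1) i)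
    (g := signMul (paritySign (i * p + p * q)) (opLeft i (i + 1)).flip)
    (fun a b c ha hb hc => ?_) hx hy hz
  · simpa only [signMul_apply, LinearMap.add_apply, LinearMap.flip_apply, opLeft_apply,
      opRight_apply] using this
  · subst ha hb hc
    simp only [signMul_apply, LinearMap.add_apply, LinearMap.flip_apply, opLeft_apply,
      opRight_apply, op_ofTree]
    exact isEilhMap_ofTree.gt_one i a b c

theorem op_gt_two (i : ℕ) (hx : x ∈ homogeneous 𝒱 p) (hy : y ∈ homogeneous 𝒱 q)
    (hz : z ∈ homogeneous 𝒱 r) : op (i + 2) x (op i y z) =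
      paritySign (i * p + p * q) • op (i + 2) (op i y x) z +
        paritySign (i * (p + (i + 2 : ℕ) + 1) + (p + q) * r) • op (i + 1) (op (i + 1) z x) y := by
  have := eq_of_homogeneous₃ (f := opRight (i + 2) i)
    (g := signMul (paritySign (i * p + p * q)) (opLeft i (i + 2)).flip +
      signMul (paritySign (i * (p + (i + 2 : ℕ) + 1) + (p + q) * r)) (opLeft' (i + 1) (i + 1)))
    (fun a b c ha hb hc => ?_) hx hy hz
  · simpa only [signMul_apply, LinearMap.add_apply, LinearMap.flip_apply, opLeft_apply,
      opRight_apply, opLeft'_apply] using this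
  · subst ha hb hc
    simp only [signMul_apply, LinearMap.add_apply, LinearMap.flip_apply, opLeft_apply,
      opRight_apply, opLeft'_apply, op_ofTree]
    exact isEilhMap_ofTree.gt_two i a b c

theorem op_gt_many (i k : ℕ) (hx : x ∈ homogeneous 𝒱 p) (hy : y ∈ homogeneous 𝒱 q)
    (hz : z ∈ homogeneous 𝒱 r) : op (i + k + 3) x (op i y z) =
      paritySign (i * p + p * q) • op (i + k + 3) (op i y x) z +
        paritySign (i * (p + (i + k + 3 : ℕ) + 1) + (p + q) * r) •
          op (i + 1) (op (i + k + 2) z x) y +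
        paritySign ((i + k + 3 : ℕ) + p * (q + i) + (p + q) * r) •
          op (i + k + 2) (op (i + 1) z y) x := by
  have := eq_of_homogeneous₃ (f := opRight (i + k + 3) i)
    (g := signMul (paritySign (i * p + p * q)) (opLeft i (i + k + 3)).flip +
      signMul (paritySign (i * (p + (i + k + 3 : ℕ) + 1) + (p + q) * r)) (opLeft' (i + k + 2) (i + 1)) +
      signMul (paritySign ((i + k + 3 : ℕ) + p * (q + i) + (p + q) * r)) (opLeft' (i + 1) (i + k + 2)).flip)
    (fun a b c ha hb hc => ?_) hx hy hz
  · simpa only [signMul_apply, LinearMap.add_apply, LinearMap.flip_apply, opLeft_apply,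
      opRight_apply, opLeft'_apply] using this
  · subst ha hb hc
    simp only [signMul_apply, LinearMap.add_apply, LinearMap.flip_apply, opLeft_apply,
      opRight_apply, opLeft'_apply, op_ofTree]
    exact isEilhMap_ofTree.gt_many i k a b c

/-- In this variant and the next two the index condition is a separate hypothesis, so that indices
such as `i + 1 + 1` can be matched without first being normalized. -/
theorem op_gt_one' (i j : ℕ) (h : j = i + 1) (hx : x ∈ homogeneous 𝒱 p)
    (hy : y ∈ homogeneous 𝒱 q) (hz : z ∈ homogeneous 𝒱 r) : op j x (op i y z) =
      paritySign (i * p + p * q) • op j (op i y x) z := by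
  subst h
  exact op_gt_one i hx hy hz

theorem op_gt_two' (i j : ℕ) (h : j = i + 2) (hx : x ∈ homogeneous 𝒱 p)
    (hy : y ∈ homogeneous 𝒱 q) (hz : z ∈ homogeneous 𝒱 r) : op j x (op i y z) =
      paritySign (i * p + p * q) • op j (op i y x) z +
        paritySign (i * (p + j + 1) + (p + q) * r) • op (i + 1) (op (i + 1) z x) y := by
  subst h
  exact op_gt_two i hx hy hz

theorem op_gt_many' (i j j' : ℕ) (h : j = j' + 1) (h' : i + 2 < j) (hx : x ∈ homogeneous 𝒱 p)
    (hy : y ∈ homogeneous 𝒱 q) (hz : z ∈ homogeneous 𝒱 r) : op j x (op i y z) =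
      paritySign (i * p + p * q) • op j (op i y x) z +
        paritySign (i * (p + j + 1) + (p + q) * r) • op (i + 1) (op j' z x) y +
        paritySign (j + p * (q + i) + (p + q) * r) • op j' (op (i + 1) z y) x := by
  obtain ⟨k, rfl⟩ : ∃ k, j' = i + k + 2 := ⟨j' - i - 2, by omega⟩
  subst h
  exact op_gt_many i k hx hy hz

end Eilh

end Lift

/-! ### Compatibility of the deformed Leibniz rule with the quadratic relations -/

section Derivation

variable {K V : Type*} [Field K] [AddCommGroup V] [Module K V]
variable {𝒱 : ℤ → Submodule K V}

namespace Eilh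

open EilhTree

theorem op_units_smul_left (i : ℕ) (u : ℤˣ) (x y : Eilh 𝒱) :
    op i (u • x) y = u • op i x y := by
  rw [LinearMap.map_units_int_smul, Units.smul_def, Units.smul_def, LinearMap.smul_apply]

theorem op_units_smul_right (i : ℕ) (u : ℤˣ) (x y : Eilh 𝒱) :
    op i x (u • y) = u • op i x y := LinearMap.map_units_int_smul _ _ _

theorem op_add_left (i : ℕ) (x y z : Eilh 𝒱) : op i (x + y) z = op i x z + op i y z := by
  rw [map_add, LinearMap.add_apply]

theorem op_sub_left (i : ℕ) (x y z : Eilh 𝒱) : op i (x - y) z = op i x z - op i y z := by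
  rw [map_sub, LinearMap.sub_apply]

theorem op_add_right (i : ℕ) (x y z : Eilh 𝒱) : op i x (y + z) = op i x y + op i x z :=
  map_add _ _ _

theorem op_sub_right (i : ℕ) (x y z : Eilh 𝒱) : op i x (y - z) = op i x y - op i x z :=
  map_sub _ _ _

theorem Int.not_even_three : ¬ Even (3 : ℤ) := by decide

theorem Int.not_even_five : ¬ Even (5 : ℤ) := by decide

theorem Int.even_four : Even (4 : ℤ) := by decide

/-- The deformed Leibniz rule: the value of a derivation on `x ⊘ᵢ y` in terms of the values `x'` on
`x` and `y'` on `y`, for `x` of degree `p` and `y` of degree `q`. -/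
noncomputable def leibnizOp (i : ℕ) (p q : ℤ) (x x' y y' : Eilh 𝒱) : Eilh 𝒱 :=
  paritySign i • (op i x' y + paritySign p • op i x y') + paritySign i • op (i + 1) x y -
    paritySign (p * q) • op (i + 1) y x

variable {p q r : ℤ} {x y z x' y' z' : Eilh 𝒱}

/-- The terms containing `x'`, `y'` or `z'` match by the same relation applied to these elements.
The remaining terms have one index raised and are brought to left-nested form by the neighbouring
relations, with index pairs `(i, i+1)` and `(i+1, i)`. What is left is an identity of signs for each
left-nested word, settled by the parities of the exponents. The lemmas for the other relations work
in the same way. -/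
theorem leibnizOp_eq (i : ℕ)
    (hx : x ∈ homogeneous 𝒱 p) (hx' : x' ∈ homogeneous 𝒱 (p + 1))
    (hy : y ∈ homogeneous 𝒱 q) (hy' : y' ∈ homogeneous 𝒱 (q + 1))
    (hz : z ∈ homogeneous 𝒱 r) (hz' : z' ∈ homogeneous 𝒱 (r + 1)) :
    leibnizOp (i) (p) (q + r + (i : ℕ)) x x' (op (i) y z) (leibnizOp (i) (q) (r) y y' z z') =
      paritySign (i * (p + 1)) •
        ((leibnizOp (i) (p + q + (i : ℕ)) (r) (op (i) x y) (leibnizOp (i) (p) (q) x x' y y') z z') +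
          paritySign (i + p * q) • (leibnizOp (i) (q + p + (i : ℕ)) (r) (op (i) y x) (leibnizOp (i) (q) (p) y y' x x') z z')) := by
  simp only [leibnizOp, op_add_right, op_sub_right, op_units_smul_left, op_units_smul_right,
    op_add_left, op_sub_left,
    op_eq i hx' hy hz,
    op_eq i hx hy' hz,
    op_eq i hx hy hz',
    op_lt i (i + 1) (by omega) hx hy hz,
    op_lt i (i + 1) (by omega) hx hz hy,
    op_gt_one i hx hy hz,
    op_gt_one i hz hx hy,
    op_gt_one i hz hy hx]
  simp only [Units.smul_def, Nat.add_assoc, Nat.reduceAdd]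
  match_scalars <;>
    simp only [paritySign_eq_ite, Int.even_add, Int.even_mul, Int.not_even_one] <;>
    by_cases h0 : Even (i : ℤ) <;>
    by_cases h1 : Even p <;>
    by_cases h2 : Even q <;>
    by_cases h3 : Even r <;>
    simp [h0, h1, h2, h3, even_two, Int.even_four, Int.not_even_three]

/-- Gap one is separate from larger gaps because raising the smaller index by one produces equal
indices. -/
theorem leibnizOp_lt_one (i : ℕ)
    (hx : x ∈ homogeneous 𝒱 p) (hx' : x' ∈ homogeneous 𝒱 (p + 1))
    (hy : y ∈ homogeneous 𝒱 q) (hy' : y' ∈ homogeneous 𝒱 (q + 1))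
    (hz : z ∈ homogeneous 𝒱 r) (hz' : z' ∈ homogeneous 𝒱 (r + 1)) :
    leibnizOp (i) (p) (q + r + (i + 1 : ℕ)) x x' (op (i + 1) y z) (leibnizOp (i + 1) (q) (r) y y' z z') =
      paritySign (i * (i + 1 : ℕ) + (i + 1 : ℕ) * p) • (leibnizOp (i + 1) (p + q + (i : ℕ)) (r) (op (i) x y) (leibnizOp (i) (p) (q) x x' y y') z z') := by
  simp only [leibnizOp, op_add_right, op_sub_right, op_units_smul_left, op_units_smul_right,
    op_add_left, op_sub_left,
    op_lt i (i + 1) (by omega) hx' hy hz,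
    op_lt i (i + 1) (by omega) hx hy' hz,
    op_lt i (i + 1) (by omega) hx hy hz',
    op_lt i (i + 1 + 1) (by omega) hx hy hz,
    op_lt i (i + 1 + 1) (by omega) hx hz hy,
    op_eq (i + 1) hx hy hz,
    op_gt_two' i (i + 1 + 1) rfl hz hx hy]
  simp only [Units.smul_def, Nat.add_assoc, Nat.reduceAdd]
  match_scalars <;>
    simp only [paritySign_eq_ite, Int.even_add, Int.even_mul, Int.not_even_one, Nat.cast_add, Nat.cast_ofNat, Nat.cast_one] <;>
    by_cases h0 : Even (i : ℤ) <;>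
    by_cases h1 : Even p <;>
    by_cases h2 : Even q <;>
    by_cases h3 : Even r <;>
    simp [h0, h1, h2, h3, even_two, Int.even_four, Int.not_even_three]

/-- With gap at least two the indices stay strictly ordered after raising either of them. The
flipped outer product has gap at least three, so both correction terms appear. -/
theorem leibnizOp_lt_many (i k : ℕ)
    (hx : x ∈ homogeneous 𝒱 p) (hx' : x' ∈ homogeneous 𝒱 (p + 1))
    (hy : y ∈ homogeneous 𝒱 q) (hy' : y' ∈ homogeneous 𝒱 (q + 1))
    (hz : z ∈ homogeneous 𝒱 r) (hz' : z' ∈ homogeneous 𝒱 (r + 1)) :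
    leibnizOp (i) (p) (q + r + (i + k + 2 : ℕ)) x x' (op (i + k + 2) y z) (leibnizOp (i + k + 2) (q) (r) y y' z z') =
      paritySign (i * (i + k + 2 : ℕ) + (i + k + 2 : ℕ) * p) • (leibnizOp (i + k + 2) (p + q + (i : ℕ)) (r) (op (i) x y) (leibnizOp (i) (p) (q) x x' y y') z z') := by
  simp only [leibnizOp, op_add_right, op_sub_right, op_units_smul_left, op_units_smul_right,
    op_add_left, op_sub_left,
    op_lt i (i + k + 2) (by omega) hx' hy hz,
    op_lt i (i + k + 2) (by omega) hx hy' hz,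
    op_lt i (i + k + 2) (by omega) hx hy hz',
    op_lt i (i + k + 2 + 1) (by omega) hx hy hz,
    op_lt i (i + k + 2 + 1) (by omega) hx hz hy,
    op_lt (i + 1) (i + k + 2) (by omega) hx hy hz,
    op_gt_many' i (i + k + 2 + 1) (i + k + 2) rfl (by omega) hz hx hy]
  simp only [Units.smul_def, Nat.add_assoc, Nat.reduceAdd]
  match_scalars <;>
    simp only [paritySign_eq_ite, Int.even_add, Int.even_mul, Int.not_even_one, Nat.cast_add, Nat.cast_ofNat, Nat.cast_one] <;>
    by_cases h0 : Even (i : ℤ) <;>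
    by_cases h1 : Even (k : ℤ) <;>
    by_cases h2 : Even p <;>
    by_cases h3 : Even q <;>
    by_cases h4 : Even r <;>
    simp [h0, h1, h2, h3, h4, even_two, Int.even_four, Int.not_even_three]

theorem leibnizOp_gt_one (i : ℕ)
    (hx : x ∈ homogeneous 𝒱 p) (hx' : x' ∈ homogeneous 𝒱 (p + 1))
    (hy : y ∈ homogeneous 𝒱 q) (hy' : y' ∈ homogeneous 𝒱 (q + 1))
    (hz : z ∈ homogeneous 𝒱 r) (hz' : z' ∈ homogeneous 𝒱 (r + 1)) :
    leibnizOp (i + 1) (p) (q + r + (i : ℕ)) x x' (op (i) y z) (leibnizOp (i) (q) (r) y y' z z') =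
      paritySign (i * p + p * q) • (leibnizOp (i + 1) (q + p + (i : ℕ)) (r) (op (i) y x) (leibnizOp (i) (q) (p) y y' x x') z z') := by
  simp only [leibnizOp, op_add_right, op_sub_right, op_units_smul_left, op_units_smul_right,
    op_add_left, op_sub_left,
    op_gt_one i hx' hy hz,
    op_gt_one i hx hy' hz,
    op_gt_one i hx hy hz',
    op_eq (i + 1) hx hy hz,
    op_eq (i + 1) hx hz hy,
    op_gt_two' i (i + 1 + 1) rfl hx hy hz,
    op_gt_two' i (i + 1 + 1) rfl hz hy hx]
  simp only [Units.smul_def, Nat.add_assoc, Nat.reduceAdd]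
  match_scalars <;>
    simp only [paritySign_eq_ite, Int.even_add, Int.even_mul, Int.not_even_one, Nat.cast_add, Nat.cast_ofNat, Nat.cast_one] <;>
    by_cases h0 : Even (i : ℤ) <;>
    by_cases h1 : Even p <;>
    by_cases h2 : Even q <;>
    by_cases h3 : Even r <;>
    simp [h0, h1, h2, h3, even_two, Int.even_four, Int.not_even_three]

/-- Raising the inner index leaves gap one, without corrections, and raising the outer index gives
gap three, with both corrections. -/
theorem leibnizOp_gt_two (i : ℕ)
    (hx : x ∈ homogeneous 𝒱 p) (hx' : x' ∈ homogeneous 𝒱 (p + 1))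
    (hy : y ∈ homogeneous 𝒱 q) (hy' : y' ∈ homogeneous 𝒱 (q + 1))
    (hz : z ∈ homogeneous 𝒱 r) (hz' : z' ∈ homogeneous 𝒱 (r + 1)) :
    leibnizOp (i + 2) (p) (q + r + (i : ℕ)) x x' (op (i) y z) (leibnizOp (i) (q) (r) y y' z z') =
      paritySign (i * p + p * q) • (leibnizOp (i + 2) (q + p + (i : ℕ)) (r) (op (i) y x) (leibnizOp (i) (q) (p) y y' x x') z z') +
        paritySign (i * (p + (i + 2 : ℕ) + 1) + (p + q) * r) •
          (leibnizOp (i + 1) (r + p + (i + 1 : ℕ)) (q) (op (i + 1) z x) (leibnizOp (i + 1) (r) (p) z z' x x') y y') := by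
  simp only [leibnizOp, op_add_right, op_sub_right, op_units_smul_left, op_units_smul_right,
    op_add_left, op_sub_left,
    op_gt_two i hx' hy hz,
    op_gt_two i hx hy' hz,
    op_gt_two i hx hy hz',
    op_gt_one' (i + 1) (i + 2) rfl hx hy hz,
    op_gt_one' (i + 1) (i + 2) rfl hx hz hy,
    op_gt_many' i (i + 2 + 1) (i + 2) rfl (by omega) hx hy hz,
    op_gt_many' i (i + 2 + 1) (i + 2) rfl (by omega) hz hy hx,
    op_gt_one (i + 1) hy hz hx]
  simp only [Units.smul_def, Nat.add_assoc, Nat.reduceAdd]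
  match_scalars <;>
    simp only [paritySign_eq_ite, Int.even_add, Int.even_mul, Int.not_even_one, Nat.cast_add, Nat.cast_ofNat, Nat.cast_one] <;>
    by_cases h0 : Even (i : ℤ) <;>
    by_cases h1 : Even p <;>
    by_cases h2 : Even q <;>
    by_cases h3 : Even r <;>
    simp [h0, h1, h2, h3, even_two, Int.even_four, Int.not_even_three]

/-- Gap three is special in two ways: raising the inner index leaves gap two, where the second
correction is absent, and the flipped outer product of the first correction has two equal indices.
-/
theorem leibnizOp_gt_three (i : ℕ)
    (hx : x ∈ homogeneous 𝒱 p) (hx' : x' ∈ homogeneous 𝒱 (p + 1))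
    (hy : y ∈ homogeneous 𝒱 q) (hy' : y' ∈ homogeneous 𝒱 (q + 1))
    (hz : z ∈ homogeneous 𝒱 r) (hz' : z' ∈ homogeneous 𝒱 (r + 1)) :
    leibnizOp (i + 3) (p) (q + r + (i : ℕ)) x x' (op (i) y z) (leibnizOp (i) (q) (r) y y' z z') =
      paritySign (i * p + p * q) • (leibnizOp (i + 3) (q + p + (i : ℕ)) (r) (op (i) y x) (leibnizOp (i) (q) (p) y y' x x') z z') +
        paritySign (i * (p + (i + 3 : ℕ) + 1) + (p + q) * r) •
          (leibnizOp (i + 1) (r + p + (i + 2 : ℕ)) (q) (op (i + 2) z x) (leibnizOp (i + 2) (r) (p) z z' x x') y y') +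
        paritySign ((i + 3 : ℕ) + p * (q + i) + (p + q) * r) •
          (leibnizOp (i + 2) (r + q + (i + 1 : ℕ)) (p) (op (i + 1) z y) (leibnizOp (i + 1) (r) (q) z z' y y') x x') := by
  simp only [leibnizOp, op_add_right, op_sub_right, op_units_smul_left, op_units_smul_right,
    op_add_left, op_sub_left,
    op_gt_many' i (i + 3) (i + 2) rfl (by omega) hx' hy hz,
    op_gt_many' i (i + 3) (i + 2) rfl (by omega) hx hy' hz,
    op_gt_many' i (i + 3) (i + 2) rfl (by omega) hx hy hz',
    op_gt_two' (i + 1) (i + 3) rfl hx hy hz,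
    op_gt_two' (i + 1) (i + 3) rfl hx hz hy,
    op_eq (i + 2) hy hz hx,
    op_gt_many' i (i + 3 + 1) (i + 3) rfl (by omega) hx hy hz,
    op_gt_many' i (i + 3 + 1) (i + 3) rfl (by omega) hz hy hx]
  simp only [Units.smul_def, Nat.add_assoc, Nat.reduceAdd]
  match_scalars <;>
    simp only [paritySign_eq_ite, Int.even_add, Int.even_mul, Int.not_even_one, Nat.cast_add, Nat.cast_ofNat, Nat.cast_one] <;>
    by_cases h0 : Even (i : ℤ) <;>
    by_cases h1 : Even p <;>
    by_cases h2 : Even q <;>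
    by_cases h3 : Even r <;>
    simp [h0, h1, h2, h3, even_two, Int.even_four, Int.not_even_three]

-- From gap four on the pattern is uniform: after any index is raised, both corrections are still
-- present and the flipped first correction falls under the relation for increasing indices.
set_option maxHeartbeats 1000000 in
theorem leibnizOp_gt_many (i k : ℕ)
    (hx : x ∈ homogeneous 𝒱 p) (hx' : x' ∈ homogeneous 𝒱 (p + 1))
    (hy : y ∈ homogeneous 𝒱 q) (hy' : y' ∈ homogeneous 𝒱 (q + 1))
    (hz : z ∈ homogeneous 𝒱 r) (hz' : z' ∈ homogeneous 𝒱 (r + 1)) :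
    leibnizOp (i + k + 4) (p) (q + r + (i : ℕ)) x x' (op (i) y z) (leibnizOp (i) (q) (r) y y' z z') =
      paritySign (i * p + p * q) • (leibnizOp (i + k + 4) (q + p + (i : ℕ)) (r) (op (i) y x) (leibnizOp (i) (q) (p) y y' x x') z z') +
        paritySign (i * (p + (i + k + 4 : ℕ) + 1) + (p + q) * r) •
          (leibnizOp (i + 1) (r + p + (i + k + 3 : ℕ)) (q) (op (i + k + 3) z x) (leibnizOp (i + k + 3) (r) (p) z z' x x') y y') +
        paritySign ((i + k + 4 : ℕ) + p * (q + i) + (p + q) * r) •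
          (leibnizOp (i + k + 3) (r + q + (i + 1 : ℕ)) (p) (op (i + 1) z y) (leibnizOp (i + 1) (r) (q) z z' y y') x x') := by
  simp only [leibnizOp, op_add_right, op_sub_right, op_units_smul_left, op_units_smul_right,
    op_add_left, op_sub_left,
    op_gt_many' i (i + k + 4) (i + k + 3) rfl (by omega) hx' hy hz,
    op_gt_many' i (i + k + 4) (i + k + 3) rfl (by omega) hx hy' hz,
    op_gt_many' i (i + k + 4) (i + k + 3) rfl (by omega) hx hy hz',
    op_lt (i + 1 + 1) (i + k + 3) (by omega) hy hz hx,
    op_gt_many' (i + 1) (i + k + 4) (i + k + 3) rfl (by omega) hx hy hz,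
    op_gt_many' (i + 1) (i + k + 4) (i + k + 3) rfl (by omega) hx hz hy,
    op_gt_many' i (i + k + 4 + 1) (i + k + 4) rfl (by omega) hx hy hz,
    op_gt_many' i (i + k + 4 + 1) (i + k + 4) rfl (by omega) hz hy hx]
  simp only [Units.smul_def, Nat.add_assoc, Nat.reduceAdd]
  match_scalars <;>
    simp only [paritySign_eq_ite, Int.even_add, Int.even_mul, Int.not_even_one, Nat.cast_add, Nat.cast_ofNat, Nat.cast_one] <;>
    by_cases h0 : Even (i : ℤ) <;>
    by_cases h1 : Even (k : ℤ) <;>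
    by_cases h2 : Even p <;>
    by_cases h3 : Even q <;>
    by_cases h4 : Even r <;>
    simp [h0, h1, h2, h3, h4, even_two, Int.even_four, Int.not_even_three, Int.not_even_five]

end Eilh
end Derivation

/-! ### Derivations with prescribed values on `V`, and their squares -/

section Derivation

variable {K V : Type*} [Field K] [AddCommGroup V] [Module K V]
variable {𝒱 : ℤ → Submodule K V}

/-- A linear map multiplied by a sign. -/
def LinearMap.signSmul {M N : Type*} [AddCommGroup M] [AddCommGroup N] [Module K M] [Module K N]
    (u : ℤˣ) (f : M →ₗ[K] N) : M →ₗ[K] N := ((u : ℤ) : K) • f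

@[simp] theorem LinearMap.signSmul_apply {M N : Type*} [AddCommGroup M] [AddCommGroup N]
    [Module K M] [Module K N] (u : ℤˣ) (f : M →ₗ[K] N) (x : M) :
    LinearMap.signSmul u f x = u • f x := by
  rw [signSmul, LinearMap.smul_apply, Int.cast_smul_eq_zsmul, Units.smul_def]

namespace Eilh

open EilhTree

/-- The derivation, for the deformed Leibniz rule, with given values on the leaves. -/
noncomputable def derTree (f : ∀ d, 𝒱 d →ₗ[K] Eilh 𝒱) : EilhTree 𝒱 → Eilh 𝒱
  | leaf d v => f d v
  | EilhTree.op i a b => leibnizOp i a.deg b.deg (ofTree a) (derTree f a) (ofTree b) (derTree f b)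

variable {f : ∀ d, 𝒱 d →ₗ[K] Eilh 𝒱}

theorem leibnizOp_mem_homogeneous (i : ℕ) {p q r : ℤ} {x x' y y' : Eilh 𝒱}
    (hx : x ∈ homogeneous 𝒱 p) (hx' : x' ∈ homogeneous 𝒱 (p + 1))
    (hy : y ∈ homogeneous 𝒱 q) (hy' : y' ∈ homogeneous 𝒱 (q + 1)) (hr : p + q + i + 1 = r) :
    leibnizOp i p q x x' y y' ∈ homogeneous 𝒱 r := by
  unfold leibnizOp
  refine sub_mem (add_mem (Submodule.units_int_smul_mem _ _ (add_mem ?_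
    (Submodule.units_int_smul_mem _ _ ?_))) (Submodule.units_int_smul_mem _ _ ?_))
    (Submodule.units_int_smul_mem _ _ ?_)
  · exact op_mem_homogeneous i hx' hy (by rw [← hr]; ring)
  · exact op_mem_homogeneous i hx hy' (by rw [← hr]; ring)
  · exact op_mem_homogeneous _ hx hy (by rw [← hr]; push_cast; ring)
  · exact op_mem_homogeneous _ hy hx (by rw [← hr]; push_cast; ring)

theorem derTree_mem_homogeneous (hf : ∀ d v, f d v ∈ homogeneous 𝒱 (d + 1)) (a : EilhTree 𝒱) :
    derTree f a ∈ homogeneous 𝒱 (a.deg + 1) := by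
  induction a with
  | leaf d v => exact hf d v
  | op i a b ha hb =>
    exact leibnizOp_mem_homogeneous i (ofTree_mem_homogeneous rfl) ha (ofTree_mem_homogeneous rfl)
      hb rfl

/-- Freeness of `ℰ(V)` with respect to derivations: there is no constraint on the values on `V`
beyond their degree. The split of the index gaps follows the lemmas on `leibnizOp`. -/
theorem isEilhMap_derTree (hf : ∀ d v, f d v ∈ homogeneous 𝒱 (d + 1)) :
    IsEilhMap (derTree f) where
  leaf_add d v w := map_add _ _ _
  leaf_smul d c v := map_smul _ _ _
  eq i a b c := by
    have h := fun t : EilhTree 𝒱 => ofTree_mem_homogeneous (a := t) rfl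
    have h' := derTree_mem_homogeneous hf
    simp only [derTree, ← op_ofTree, deg_op]
    exact leibnizOp_eq i (h a) (h' a) (h b) (h' b) (h c) (h' c)
  lt i j hij a b c := by
    have h := fun t : EilhTree 𝒱 => ofTree_mem_homogeneous (a := t) rfl
    have h' := derTree_mem_homogeneous hf
    simp only [derTree, ← op_ofTree, deg_op]
    obtain rfl | ⟨k, rfl⟩ : j = i + 1 ∨ ∃ k, j = i + k + 2 := by
      rcases Nat.lt_or_ge (i + 1) j with h | h
      · exact Or.inr ⟨j - i - 2, by omega⟩
      · exact Or.inl (by omega)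
    · exact leibnizOp_lt_one i (h a) (h' a) (h b) (h' b) (h c) (h' c)
    · exact leibnizOp_lt_many i k (h a) (h' a) (h b) (h' b) (h c) (h' c)
  gt_one i a b c := by
    have h := fun t : EilhTree 𝒱 => ofTree_mem_homogeneous (a := t) rfl
    have h' := derTree_mem_homogeneous hf
    simp only [derTree, ← op_ofTree, deg_op]
    exact leibnizOp_gt_one i (h a) (h' a) (h b) (h' b) (h c) (h' c)
  gt_two i a b c := by
    have h := fun t : EilhTree 𝒱 => ofTree_mem_homogeneous (a := t) rfl
    have h' := derTree_mem_homogeneous hf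
    simp only [derTree, ← op_ofTree, deg_op]
    exact leibnizOp_gt_two i (h a) (h' a) (h b) (h' b) (h c) (h' c)
  gt_many i k a b c := by
    have h := fun t : EilhTree 𝒱 => ofTree_mem_homogeneous (a := t) rfl
    have h' := derTree_mem_homogeneous hf
    simp only [derTree, ← op_ofTree, deg_op]
    rcases k with _ | k
    · exact leibnizOp_gt_three i (h a) (h' a) (h b) (h' b) (h c) (h' c)
    · exact leibnizOp_gt_many i k (h a) (h' a) (h b) (h' b) (h c) (h' c)
  -- The value of the derivation at `b` enters in one Leibniz term only. The other terms depend on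
  -- the class of `b`, with a sign that is constant because `u` fixes its degree.
  left i a u := by
    refine ⟨.signSmul (paritySign i) (.signSmul (paritySign a.deg) (op i (ofTree a))),
      .signSmul (paritySign i) (op i (derTree f a)) +
        .signSmul (paritySign i) (op (i + 1) (ofTree a)) -
        .signSmul (paritySign (a.deg * u.1)) ((op (i + 1)).flip (ofTree a)), ?_⟩
    rintro b rfl
    simp only [derTree, leibnizOp, LinearMap.signSmul_apply, LinearMap.add_apply,
      LinearMap.sub_apply, LinearMap.flip_apply, smul_add, type]
    abel
  right i b u := by
    refine ⟨.signSmul (paritySign i) ((op i).flip (ofTree b)),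
      .signSmul (paritySign i) (.signSmul (paritySign u.1) ((op i).flip (derTree f b))) +
        .signSmul (paritySign i) ((op (i + 1)).flip (ofTree b)) -
        .signSmul (paritySign (u.1 * b.deg)) (op (i + 1) (ofTree b)), ?_⟩
    rintro a rfl
    simp only [derTree, leibnizOp, LinearMap.signSmul_apply, LinearMap.add_apply,
      LinearMap.sub_apply, LinearMap.flip_apply, smul_add, type]
    abel

/-- The derivation of `ℰ(V)` with given values on `V`. -/
noncomputable def der (f : ∀ d, 𝒱 d →ₗ[K] Eilh 𝒱) (hf : ∀ d v, f d v ∈ homogeneous 𝒱 (d + 1)) :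
    Eilh 𝒱 →ₗ[K] Eilh 𝒱 :=
  lift (derTree f) (isEilhMap_derTree hf)

/-- Maps of degree one that satisfy the deformed Leibniz rule. -/
structure IsDerivation (D : Eilh 𝒱 →ₗ[K] Eilh 𝒱) : Prop where
  degree_one : ∀ (m : ℤ), ∀ a ∈ homogeneous 𝒱 m, D a ∈ homogeneous 𝒱 (m + 1)
  leibniz : ∀ (i : ℕ) (m k : ℤ), ∀ a ∈ homogeneous 𝒱 m, ∀ b ∈ homogeneous 𝒱 k,
    D (op i a b) = leibnizOp i m k a (D a) b (D b)

theorem isDerivation_der (hf : ∀ d v, f d v ∈ homogeneous 𝒱 (d + 1)) :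
    IsDerivation (der f hf) where
  degree_one m a ha := by
    refine homogeneous_induction (p := fun a => der f hf a ∈ homogeneous 𝒱 (m + 1)) ha
      (fun a ha => ?_) (by simp)
      (fun x y hx hy => by simpa using add_mem hx hy)
      (fun c x hx => by simpa using Submodule.smul_mem _ c hx)
    subst ha
    simpa [der] using derTree_mem_homogeneous hf a
  leibniz i m k a ha b hb := by
    refine homogeneous_induction
      (p := fun a => der f hf (op i a b) = leibnizOp i m k a (der f hf a) b (der f hf b)) ha
      (fun a ha => ?_) (by simp [leibnizOp]) (fun x y hx hy => ?_) (fun c x hx => ?_)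
    · refine homogeneous_induction
        (p := fun b => der f hf (op i (ofTree a) b) =
          leibnizOp i m k (ofTree a) (der f hf (ofTree a)) b (der f hf b)) hb
        (fun b hb => ?_) (by simp [leibnizOp]) (fun x y hx hy => ?_) (fun c x hx => ?_)
      · subst ha hb
        simp [op_ofTree, der, derTree]
      · simp only [map_add, hx, hy, leibnizOp, LinearMap.add_apply, smul_add]
        abel
      · simp only [map_smul, hx, leibnizOp, LinearMap.smul_apply, smul_add, smul_sub,
          smul_comm c (_ : ℤˣ)]
    · simp only [map_add, hx, hy, leibnizOp, LinearMap.add_apply, smul_add]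
      abel
    · simp only [map_smul, hx, leibnizOp, LinearMap.smul_apply, smul_add, smul_sub,
        smul_comm c (_ : ℤˣ)]

theorem der_gen (hf : ∀ d v, f d v ∈ homogeneous 𝒱 (d + 1)) {d : ℤ} (v : 𝒱 d) :
    der f hf (gen v) = f d v := by
  simp [gen, der, derTree]

theorem IsDerivation.ext {D D' : Eilh 𝒱 →ₗ[K] Eilh 𝒱} (hD : IsDerivation D)
    (hD' : IsDerivation D') (h : ∀ d (v : 𝒱 d), D (gen v) = D' (gen v)) : D = D' := by
  refine ext_ofTree fun a => ?_
  induction a with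
  | leaf d v => exact h d v
  | op i a b ha hb =>
    rw [← op_ofTree, hD.leibniz i _ _ _ (ofTree_mem_homogeneous rfl) _ (ofTree_mem_homogeneous rfl),
      hD'.leibniz i _ _ _ (ofTree_mem_homogeneous rfl) _ (ofTree_mem_homogeneous rfl), ha, hb]

/-- This is the second iterate of the Leibniz rule on a product whose factors have vanishing second
derivatives, hence the zeros. All remaining terms cancel in pairs. -/
theorem leibnizOp_leibnizOp (i : ℕ) (p q : ℤ) (x x' y y' : Eilh 𝒱) :
    paritySign i • (leibnizOp i (p + 1) q x' 0 y y' + paritySign p • leibnizOp i p (q + 1) x x' y' 0)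
      + paritySign i • leibnizOp (i + 1) p q x x' y y' -
      paritySign (p * q) • leibnizOp (i + 1) q p y y' x x' = 0 := by
  simp only [leibnizOp, map_zero, LinearMap.zero_apply]
  simp only [Units.smul_def]
  match_scalars <;>
    simp only [paritySign_eq_ite, Int.even_add, Int.even_mul, Int.not_even_one, Nat.cast_add,
      Nat.cast_one] <;>
    by_cases h0 : Even (i : ℤ) <;>
    by_cases h1 : Even p <;>
    by_cases h2 : Even q <;>
    simp [h0, h1, h2]

theorem IsDerivation.square_zero {D : Eilh 𝒱 →ₗ[K] Eilh 𝒱} (hD : IsDerivation D)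
    (h : ∀ d (v : 𝒱 d), D (D (gen v)) = 0) (x : Eilh 𝒱) : D (D x) = 0 := by
  have key : D ∘ₗ D = 0 := by
    refine ext_ofTree fun a => ?_
    induction a with
    | leaf d v => exact h d v
    | op i a b ha hb =>
      rw [LinearMap.comp_apply, LinearMap.zero_apply] at *
      have h1 : ofTree a ∈ homogeneous 𝒱 a.deg := ofTree_mem_homogeneous rfl
      have h2 : ofTree b ∈ homogeneous 𝒱 b.deg := ofTree_mem_homogeneous rfl
      have h1' := hD.degree_one _ _ h1
      have h2' := hD.degree_one _ _ h2
      rw [← op_ofTree, hD.leibniz i _ _ _ h1 _ h2, leibnizOp]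
      simp only [map_sub, map_add, LinearMap.map_units_int_smul, smul_add]
      rw [hD.leibniz i _ _ _ h1' _ h2, hD.leibniz i _ _ _ h1 _ h2', hD.leibniz _ _ _ _ h1 _ h2,
        hD.leibniz _ _ _ _ h2 _ h1, ha, hb, ← smul_add]
      exact leibnizOp_leibnizOp i _ _ _ _ _ _
  exact LinearMap.congr_fun key x

end Eilh

end Derivation

/-! ### The graded commutative product built from `⊘₀` -/

section Shuffle

variable {K V : Type*} [Field K] [AddCommGroup V] [Module K V]
variable {𝒱 : ℤ → Submodule K V}

namespace Eilh

open EilhTree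

/-- Every relation is homogeneous for degree, length and weight, so a scalar depending on these can
be factored out. -/
theorem isEilhMap_scale (l : ℤ × ℕ × ℕ → K) :
    IsEilhMap fun a : EilhTree 𝒱 => l a.type • ofTree a where
  leaf_add d v w := by
    rw [ofTree_leaf_add, smul_add]; rfl
  leaf_smul d c v := by
    rw [ofTree_leaf_smul, smul_comm]; rfl
  eq i a b c := by
    have h1 : (EilhTree.op i (EilhTree.op i a b) c).type =
        (EilhTree.op i a (EilhTree.op i b c)).type := by
      simp only [type_eq_iff, deg_op, len_op, wt_op]; refine ⟨?_, ?_, ?_⟩ <;> ring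
    have h2 : (EilhTree.op i (EilhTree.op i b a) c).type =
        (EilhTree.op i a (EilhTree.op i b c)).type := by
      simp only [type_eq_iff, deg_op, len_op, wt_op]; refine ⟨?_, ?_, ?_⟩ <;> ring
    rw [h1, h2, isEilhMap_ofTree.eq]
    simp only [smul_add, smul_comm (l _)]
  lt i j h a b c := by
    have h1 : (EilhTree.op j (EilhTree.op i a b) c).type =
        (EilhTree.op i a (EilhTree.op j b c)).type := by
      simp only [type_eq_iff, deg_op, len_op, wt_op]; refine ⟨?_, ?_, ?_⟩ <;> ring
    rw [h1, isEilhMap_ofTree.lt i j h, smul_comm (l _)]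
  gt_one i a b c := by
    have h1 : (EilhTree.op (i + 1) (EilhTree.op i b a) c).type =
        (EilhTree.op (i + 1) a (EilhTree.op i b c)).type := by
      simp only [type_eq_iff, deg_op, len_op, wt_op]; refine ⟨?_, ?_, ?_⟩ <;> ring
    rw [h1, isEilhMap_ofTree.gt_one, smul_comm (l _)]
  gt_two i a b c := by
    have h1 : (EilhTree.op (i + 2) (EilhTree.op i b a) c).type =
        (EilhTree.op (i + 2) a (EilhTree.op i b c)).type := by
      simp only [type_eq_iff, deg_op, len_op, wt_op]; refine ⟨?_, ?_, ?_⟩ <;> ring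
    have h2 : (EilhTree.op (i + 1) (EilhTree.op (i + 1) c a) b).type =
        (EilhTree.op (i + 2) a (EilhTree.op i b c)).type := by
      simp only [type_eq_iff, deg_op, len_op, wt_op]
      refine ⟨?_, ?_, ?_⟩ <;> push_cast <;> ring
    rw [h1, h2, isEilhMap_ofTree.gt_two]
    simp only [smul_add, smul_comm (l _)]
  gt_many i k a b c := by
    have h1 : (EilhTree.op (i + k + 3) (EilhTree.op i b a) c).type =
        (EilhTree.op (i + k + 3) a (EilhTree.op i b c)).type := by
      simp only [type_eq_iff, deg_op, len_op, wt_op]; refine ⟨?_, ?_, ?_⟩ <;> ring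
    have h2 : (EilhTree.op (i + 1) (EilhTree.op (i + k + 2) c a) b).type =
        (EilhTree.op (i + k + 3) a (EilhTree.op i b c)).type := by
      simp only [type_eq_iff, deg_op, len_op, wt_op]
      refine ⟨?_, ?_, ?_⟩ <;> push_cast <;> ring
    have h3 : (EilhTree.op (i + k + 2) (EilhTree.op (i + 1) c b) a).type =
        (EilhTree.op (i + k + 3) a (EilhTree.op i b c)).type := by
      simp only [type_eq_iff, deg_op, len_op, wt_op]
      refine ⟨?_, ?_, ?_⟩ <;> push_cast <;> ring
    rw [h1, h2, h3, isEilhMap_ofTree.gt_many]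
    simp only [smul_add, smul_comm (l _)]
  left i a u := ⟨0, l (a.deg + u.1 + i, a.len + u.2.1, a.wt + u.2.2 + i) • op i (ofTree a), by
    rintro b rfl
    simp [op_ofTree, type, deg_op, len_op, wt_op]⟩
  right i b u :=
    ⟨0, l (u.1 + b.deg + i, u.2.1 + b.len, u.2.2 + b.wt + i) • (op i).flip (ofTree b), by
      rintro a rfl
      simp [op_ofTree, type, deg_op, len_op, wt_op]⟩

/-- The linear map that multiplies every monomial by a scalar depending on its type only. -/
noncomputable def scale (l : ℤ × ℕ × ℕ → K) : Eilh 𝒱 →ₗ[K] Eilh 𝒱 := lift _ (isEilhMap_scale l)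

theorem scale_ofTree (l : ℤ × ℕ × ℕ → K) (a : EilhTree 𝒱) :
    scale l (ofTree a) = l a.type • ofTree a := lift_ofTree _ _ _

/-- The part of even degree. -/
noncomputable def evenPart : Eilh 𝒱 →ₗ[K] Eilh 𝒱 := scale fun u => if Even u.1 then 1 else 0

/-- The part of odd degree. -/
noncomputable def oddPart : Eilh 𝒱 →ₗ[K] Eilh 𝒱 := scale fun u => if Even u.1 then 0 else 1

/-- The bilinear extension of `(-1)^(|x||y|) y ⊘₀ x`. -/
noncomputable def flipOp : Eilh 𝒱 →ₗ[K] Eilh 𝒱 →ₗ[K] Eilh 𝒱 :=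
  (op 0).flip ∘ₗ evenPart + (op 0 ∘ₗ (evenPart - oddPart)).flip ∘ₗ oddPart

/-- The sign is `1` for even `a` and `(-1)^|b|` for odd `a`; splitting into even and odd parts thus
makes the signed flip bilinear. -/
theorem flipOp_ofTree (a b : EilhTree 𝒱) : flipOp (ofTree a) (ofTree b) =
    paritySign (a.deg * b.deg) • op 0 (ofTree b) (ofTree a) := by
  simp only [flipOp, evenPart, oddPart, LinearMap.add_apply, LinearMap.comp_apply, scale_ofTree,
    LinearMap.flip_apply, LinearMap.sub_apply, paritySign_eq_ite, Int.even_mul, type]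
  by_cases ha : Even a.deg <;> by_cases hb : Even b.deg <;> simp [ha, hb]

variable {p q : ℤ}

theorem flipOp_eq {x y : Eilh 𝒱} (hx : x ∈ homogeneous 𝒱 p) (hy : y ∈ homogeneous 𝒱 q) :
    flipOp x y = paritySign (p * q) • op 0 y x := by
  have := eq_of_homogeneous (f := flipOp.flip y)
    (g := LinearMap.signSmul (paritySign (p * q)) (op 0 y)) (fun a ha => ?_) hx
  · simpa using this
  have := eq_of_homogeneous (f := flipOp (ofTree a))
    (g := LinearMap.signSmul (paritySign (p * q)) ((op 0).flip (ofTree a))) (fun b hb => ?_) hy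
  · simpa using this
  simp [flipOp_ofTree, ha, hb]

/-- The graded commutative product `x ⊘₀ y + (-1)^(|x||y|) y ⊘₀ x`. -/
noncomputable def shuffleMul : Eilh 𝒱 →ₗ[K] Eilh 𝒱 →ₗ[K] Eilh 𝒱 := op 0 + flipOp

theorem shuffleMul_apply (x y : Eilh 𝒱) : shuffleMul x y = op 0 x y + flipOp x y := rfl

theorem shuffleMul_ofTree (a b : EilhTree 𝒱) : shuffleMul (ofTree a) (ofTree b) =
    op 0 (ofTree a) (ofTree b) + paritySign (a.deg * b.deg) • op 0 (ofTree b) (ofTree a) := by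
  rw [shuffleMul_apply, flipOp_ofTree]

theorem shuffleMul_eq {x y : Eilh 𝒱} (hx : x ∈ homogeneous 𝒱 p) (hy : y ∈ homogeneous 𝒱 q) :
    shuffleMul x y = op 0 x y + paritySign (p * q) • op 0 y x := by
  rw [shuffleMul_apply, flipOp_eq hx hy]

theorem trilinear_ext {f g : Trilinear 𝒱} (h : ∀ a b c : EilhTree 𝒱,
    f (ofTree a) (ofTree b) (ofTree c) = g (ofTree a) (ofTree b) (ofTree c)) (x y z : Eilh 𝒱) :
    f x y z = g x y z := by
  have : f = g := ext_ofTree fun a => ext_ofTree fun b => ext_ofTree fun c => h a b c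
  rw [this]

theorem op_zero_op_zero_ofTree (a b c : EilhTree 𝒱) :
    op 0 (ofTree a) (op 0 (ofTree b) (ofTree c)) =
      op 0 (op 0 (ofTree a) (ofTree b)) (ofTree c) +
        paritySign (a.deg * b.deg) • op 0 (op 0 (ofTree b) (ofTree a)) (ofTree c) := by
  have h := op_eq 0 (ofTree_mem_homogeneous (a := a) rfl) (ofTree_mem_homogeneous (a := b) rfl)
    (ofTree_mem_homogeneous (a := c) rfl)
  simpa [paritySign] using h

/-- The Zinbiel identity: left multiplication by `⊘₀` is an action of the shuffle product. -/
theorem op_zero_op_zero (x y z : Eilh 𝒱) : op 0 x (op 0 y z) = op 0 (shuffleMul x y) z := by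
  refine trilinear_ext (f := opRight 0 0) (g := shuffleMul.compr₂ (op 0)) (fun a b c => ?_) x y z
  change op 0 (ofTree a) (op 0 (ofTree b) (ofTree c)) =
    op 0 (shuffleMul (ofTree a) (ofTree b)) (ofTree c)
  rw [op_zero_op_zero_ofTree, shuffleMul_ofTree, op_add_left, op_units_smul_left]

/-- Left multiplications by `x` and by `z` commute up to sign, since both composites are the action
of a shuffle product that is graded symmetric in `x` and `z`. -/
theorem op_zero_flipOp (x y z : Eilh 𝒱) : op 0 x (flipOp y z) = flipOp (op 0 x y) z := by
  refine trilinear_ext (f := ((LinearMap.llcomp K _ _ _).comp (op 0)).compl₂ flipOp)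
    (g := (op 0).compr₂ flipOp) (fun a b c => ?_) x y z
  change op 0 (ofTree a) (flipOp (ofTree b) (ofTree c)) =
    flipOp (op 0 (ofTree a) (ofTree b)) (ofTree c)
  rw [op_ofTree, flipOp_ofTree, flipOp_ofTree, ← op_ofTree, op_units_smul_right,
    op_zero_op_zero_ofTree, op_zero_op_zero_ofTree, deg_op]
  simp only [Units.smul_def]
  match_scalars <;>
    simp only [paritySign_eq_ite, Int.even_add, Int.even_mul, Nat.cast_zero, add_zero] <;>
    by_cases h0 : Even a.deg <;>
    by_cases h1 : Even b.deg <;>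
    by_cases h2 : Even c.deg <;>
    simp [h0, h1, h2]

theorem flipOp_shuffleMul (a b : EilhTree 𝒱) (z : Eilh 𝒱) :
    flipOp (ofTree a) (shuffleMul (ofTree b) z) =
      paritySign (a.deg * b.deg) • flipOp (op 0 (ofTree b) (ofTree a)) z := by
  have : flipOp (ofTree a) ∘ₗ shuffleMul (ofTree b) = LinearMap.signSmul
      (paritySign (a.deg * b.deg)) (flipOp (op 0 (ofTree b) (ofTree a))) := by
    refine ext_ofTree fun c => ?_
    simp only [LinearMap.comp_apply, LinearMap.signSmul_apply]
    rw [shuffleMul_ofTree, op_ofTree, op_ofTree, op_ofTree, map_add,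
      LinearMap.map_units_int_smul, flipOp_ofTree, flipOp_ofTree, flipOp_ofTree]
    simp only [← op_ofTree, op_zero_op_zero_ofTree, deg_op]
    simp only [Units.smul_def]
    match_scalars <;>
      simp only [paritySign_eq_ite, Int.even_add, Int.even_mul, Nat.cast_zero, add_zero] <;>
      by_cases h0 : Even a.deg <;>
      by_cases h1 : Even b.deg <;>
      by_cases h2 : Even c.deg <;>
      simp [h0, h1, h2]
  simpa using LinearMap.congr_fun this z

/-- Both sides split into three parts according to which of `x`, `y`, `z` stands at the right end;
the Zinbiel identity matches the parts one by one. -/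
theorem shuffleMul_assoc (x y z : Eilh 𝒱) :
    shuffleMul (shuffleMul x y) z = shuffleMul x (shuffleMul y z) := by
  refine trilinear_ext (f := shuffleMul.compr₂ shuffleMul)
    (g := ((LinearMap.llcomp K _ _ _).comp shuffleMul).compl₂ shuffleMul) (fun a b c => ?_) x y z
  change shuffleMul (shuffleMul (ofTree a) (ofTree b)) (ofTree c) =
    shuffleMul (ofTree a) (shuffleMul (ofTree b) (ofTree c))
  rw [shuffleMul_apply (ofTree a) (shuffleMul (ofTree b) (ofTree c)), flipOp_shuffleMul,
    shuffleMul_apply (ofTree b), map_add, op_zero_op_zero, op_zero_flipOp,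
    shuffleMul_apply (shuffleMul (ofTree a) (ofTree b)), shuffleMul_ofTree, map_add flipOp,
    LinearMap.map_units_int_smul, LinearMap.add_apply, Units.smul_def, LinearMap.smul_apply,
    ← Units.smul_def, add_assoc]

end Eilh

/-- `ℰ(V)` with the graded commutative product `x ⊘₀ y + (-1)^(|x||y|) y ⊘₀ x`. -/
def Shuffle (𝒱 : ℤ → Submodule K V) : Type _ := Eilh 𝒱

namespace Shuffle

noncomputable instance : AddCommGroup (Shuffle 𝒱) := inferInstanceAs (AddCommGroup (Eilh 𝒱))

noncomputable instance : Module K (Shuffle 𝒱) := inferInstanceAs (Module K (Eilh 𝒱))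

noncomputable instance : NonUnitalRing (Shuffle 𝒱) where
  __ := (inferInstance : AddCommGroup (Shuffle 𝒱))
  mul x y := (Eilh.shuffleMul : Eilh 𝒱 →ₗ[K] Eilh 𝒱 →ₗ[K] Eilh 𝒱) x y
  left_distrib x y z := map_add _ _ _
  right_distrib x y z := LinearMap.map_add₂ (Eilh.shuffleMul (𝒱 := 𝒱)) x y z
  zero_mul x := LinearMap.map_zero₂ (Eilh.shuffleMul (𝒱 := 𝒱)) x
  mul_zero x := map_zero _
  mul_assoc x y z := Eilh.shuffleMul_assoc x y z

instance : IsScalarTower K (Shuffle 𝒱) (Shuffle 𝒱) where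
  smul_assoc c x y := LinearMap.map_smul₂ (Eilh.shuffleMul (𝒱 := 𝒱)) c x y

instance : SMulCommClass K (Shuffle 𝒱) (Shuffle 𝒱) where
  smul_comm c x y := (map_smul (Eilh.shuffleMul (𝒱 := 𝒱) x) c y).symm

end Shuffle

/-- The unital graded commutative algebra `K ⊕ ℰ(V)`. -/
abbrev ShuffleOne (𝒱 : ℤ → Submodule K V) : Type _ := Unitization K (Shuffle 𝒱)

namespace ShuffleOne

open EilhTree

/-- The inclusion of the augmentation ideal. -/
noncomputable def incl : Eilh 𝒱 →ₗ[K] ShuffleOne 𝒱 := Unitization.inrHom K K (Shuffle 𝒱)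

/-- The projection to the augmentation ideal. -/
noncomputable def proj : ShuffleOne 𝒱 →ₗ[K] Eilh 𝒱 := Unitization.sndHom K K (Shuffle 𝒱)

/-- The augmentation. -/
noncomputable def aug : ShuffleOne 𝒱 →ₗ[K] K := (Unitization.fstHom K (Shuffle 𝒱)).toLinearMap

@[simp] theorem proj_incl (x : Eilh 𝒱) : proj (incl x) = x := rfl
@[simp] theorem aug_incl (x : Eilh 𝒱) : aug (incl x) = 0 := rfl
@[simp] theorem proj_one : proj (1 : ShuffleOne 𝒱) = 0 := rfl
@[simp] theorem aug_one : aug (1 : ShuffleOne 𝒱) = 1 := rfl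

theorem incl_injective : Function.Injective (incl : Eilh 𝒱 → ShuffleOne 𝒱) :=
  fun x y h => by simpa using congrArg proj h

theorem ext' {X Y : ShuffleOne 𝒱} (h : aug X = aug Y) (h' : proj X = proj Y) : X = Y :=
  Unitization.ext h h'

theorem aug_smul_one_add_incl (X : ShuffleOne 𝒱) : aug X • 1 + incl (proj X) = X := by
  refine ext' ?_ ?_ <;> simp

theorem induction_on {C : ShuffleOne 𝒱 → Prop} (X : ShuffleOne 𝒱) (one : ∀ c : K, C (c • 1))
    (incl : ∀ x, C (incl x)) (add : ∀ X Y, C X → C Y → C (X + Y)) : C X := by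
  rw [← aug_smul_one_add_incl X]
  exact add _ _ (one _) (incl _)

theorem incl_mul_incl (x y : Eilh 𝒱) : incl x * incl y = incl (Eilh.shuffleMul x y) :=
  (Unitization.inr_mul K (A := Shuffle 𝒱) x y).symm

@[simp] theorem aug_mul (X Y : ShuffleOne 𝒱) : aug (X * Y) = aug X * aug Y := rfl

/-- The right action `X ⊘₀ a`, where `1 ⊘₀ a = a`. -/
noncomputable def half (X : ShuffleOne 𝒱) (a : Eilh 𝒱) : Eilh 𝒱 := aug X • a + Eilh.op 0 (proj X) a

/-- The bilinear extension of `(-1)^(|a||X|) X ⊘₀ a`. -/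
noncomputable def flipHalf (a : Eilh 𝒱) : ShuffleOne 𝒱 →ₗ[K] Eilh 𝒱 :=
  aug.smulRight a + Eilh.flipOp a ∘ₗ proj

theorem flipHalf_apply (a : Eilh 𝒱) (X : ShuffleOne 𝒱) :
    flipHalf a X = aug X • a + Eilh.flipOp a (proj X) := rfl

@[simp] theorem half_one (a : Eilh 𝒱) : half 1 a = a := by simp [half]

@[simp] theorem half_incl (x a : Eilh 𝒱) : half (incl x) a = Eilh.op 0 x a := by simp [half]

theorem half_add (X Y : ShuffleOne 𝒱) (a : Eilh 𝒱) : half (X + Y) a = half X a + half Y a := by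
  simp only [half, map_add, LinearMap.add_apply, add_smul]; abel

theorem half_smul (c : K) (X : ShuffleOne 𝒱) (a : Eilh 𝒱) : half (c • X) a = c • half X a := by
  simp [half, mul_smul]

/-- The Zinbiel identity in unital form. With the convention `1 ⊘₀ a = a` it covers words of length
zero, which makes the later recursions uniform. -/
theorem op_zero_half (x a : Eilh 𝒱) (X : ShuffleOne 𝒱) :
    Eilh.op 0 x (half X a) = half (incl x * X) a := by
  induction X using ShuffleOne.induction_on with
  | one c =>
    rw [mul_smul_comm, mul_one, half_smul, half_smul, half_one, half_incl, map_smul]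
  | incl y => rw [incl_mul_incl, half_incl, half_incl, Eilh.op_zero_op_zero]
  | add X Y hX hY => rw [mul_add, half_add, half_add, map_add, hX, hY]

theorem op_zero_flipHalf (x a : Eilh 𝒱) (X : ShuffleOne 𝒱) :
    Eilh.op 0 x (flipHalf a X) = flipHalf (Eilh.op 0 x a) X := by
  simp [flipHalf_apply, Eilh.op_zero_flipOp]

theorem flipHalf_incl_mul (a b : EilhTree 𝒱) (X : ShuffleOne 𝒱) :
    flipHalf (Eilh.ofTree a) (incl (Eilh.ofTree b) * X) = paritySign (a.deg * b.deg) •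
      flipHalf (Eilh.op 0 (Eilh.ofTree b) (Eilh.ofTree a)) X := by
  induction X using ShuffleOne.induction_on with
  | one c =>
    rw [mul_smul_comm, mul_one, map_smul, map_smul, smul_comm]
    simp [flipHalf_apply, Eilh.flipOp_ofTree]
  | incl y =>
    rw [incl_mul_incl]
    simp [flipHalf_apply, Eilh.flipOp_shuffleMul]
  | add X Y hX hY => rw [mul_add, map_add, map_add, hX, hY, smul_add]

/-- Homogeneous elements of `K ⊕ ℰ(V)`. -/
def IsHomog (X : ShuffleOne 𝒱) (m : ℤ) : Prop :=
  proj X ∈ Eilh.homogeneous 𝒱 m ∧ (aug X = 0 ∨ m = 0)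

theorem isHomog_incl {x : Eilh 𝒱} {m : ℤ} (h : x ∈ Eilh.homogeneous 𝒱 m) : IsHomog (incl x) m :=
  ⟨h, Or.inl rfl⟩

theorem isHomog_one : IsHomog (1 : ShuffleOne 𝒱) 0 := ⟨by simp, Or.inr rfl⟩

theorem shuffleMul_mem_homogeneous {x y : Eilh 𝒱} {p q : ℤ} (hx : x ∈ Eilh.homogeneous 𝒱 p)
    (hy : y ∈ Eilh.homogeneous 𝒱 q) : Eilh.shuffleMul x y ∈ Eilh.homogeneous 𝒱 (p + q) := by
  rw [Eilh.shuffleMul_eq hx hy]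
  refine add_mem ?_ (Submodule.units_int_smul_mem _ _ ?_)
  · exact Eilh.op_mem_homogeneous 0 hx hy (by simp)
  · exact Eilh.op_mem_homogeneous 0 hy hx (by simp [add_comm])

theorem half_mem_homogeneous {X : ShuffleOne 𝒱} {a : Eilh 𝒱} {p q : ℤ} (hX : IsHomog X p)
    (ha : a ∈ Eilh.homogeneous 𝒱 q) : half X a ∈ Eilh.homogeneous 𝒱 (p + q) := by
  refine add_mem ?_ (Eilh.op_mem_homogeneous 0 hX.1 ha (by simp))
  rcases hX.2 with h | h
  · simp [h]
  · subst h
    simpa using Submodule.smul_mem _ _ ha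

theorem proj_incl_mul (x : Eilh 𝒱) (X : ShuffleOne 𝒱) :
    incl x * X = incl (aug X • x + Eilh.shuffleMul x (proj X)) := by
  conv_lhs => rw [← aug_smul_one_add_incl X]
  rw [mul_add, mul_smul_comm, mul_one, incl_mul_incl, ← map_smul, ← map_add]

theorem IsHomog.incl_mul {x : Eilh 𝒱} {X : ShuffleOne 𝒱} {p q : ℤ}
    (hx : x ∈ Eilh.homogeneous 𝒱 p) (hX : IsHomog X q) : IsHomog (incl x * X) (p + q) := by
  rw [proj_incl_mul]
  refine isHomog_incl (add_mem ?_ (shuffleMul_mem_homogeneous hx hX.1))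
  rcases hX.2 with h | h
  · simp [h]
  · subst h
    simpa using Submodule.smul_mem _ _ hx

/-- Multiplication by `x` and the right action by a further element. -/
theorem incl_mul_incl_half {x v : Eilh 𝒱} {X : ShuffleOne 𝒱} {p q m : ℤ}
    (hx : x ∈ Eilh.homogeneous 𝒱 p) (hv : v ∈ Eilh.homogeneous 𝒱 q) (hX : IsHomog X m) :
    incl x * incl (half X v) = incl (half (incl x * X) v) +
      paritySign (p * (m + q)) • incl (half (incl (half X v)) x) := by
  rw [incl_mul_incl, Eilh.shuffleMul_eq hx (half_mem_homogeneous hX hv), op_zero_half, half_incl,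
    map_add, LinearMap.map_units_int_smul]

theorem incl_mul_comm {x y : Eilh 𝒱} {p q : ℤ} (hx : x ∈ Eilh.homogeneous 𝒱 p)
    (hy : y ∈ Eilh.homogeneous 𝒱 q) :
    incl x * incl y = paritySign (p * q) • (incl y * incl x) := by
  rw [incl_mul_incl, incl_mul_incl, ← LinearMap.map_units_int_smul, Eilh.shuffleMul_eq hx hy,
    Eilh.shuffleMul_eq hy hx, smul_add, mul_comm q p, units_smul_smul_self, add_comm]

end ShuffleOne

end Shuffle

/-! ### Contraction with linear forms and the detection of symmetry by `der₀` -/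

section Coefficients

variable {K V : Type*} [Field K] [AddCommGroup V] [Module K V]
variable {𝒱 : ℤ → Submodule K V}

namespace Eilh

open EilhTree ShuffleOne

/-! ### Removing the last letter -/

/-- The operation that contracts the last letter of a word with a linear form. -/
noncomputable def lastDerTree (f : ∀ d, 𝒱 d →ₗ[K] K) : EilhTree 𝒱 → ShuffleOne 𝒱
  | leaf d v => f d v • 1
  | EilhTree.op 0 a b => incl (ofTree a) * lastDerTree f b
  | EilhTree.op (_ + 1) _ _ => 0

variable (f : ∀ d, 𝒱 d →ₗ[K] K)

/-- The only relation on which the contraction is not zero on both sides is the one with all indices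
`0`. There it amounts to associativity of the shuffle product. -/
theorem isEilhMap_lastDerTree : IsEilhMap (lastDerTree f) where
  leaf_add d v w := by simp [lastDerTree, add_smul]
  leaf_smul d c v := by simp [lastDerTree, mul_smul]
  eq i a b c := by
    rcases i with _ | i
    · simp only [lastDerTree, ← mul_assoc, incl_mul_incl, shuffleMul_ofTree, op_ofTree, map_add,
        LinearMap.map_units_int_smul, add_mul, smul_mul_assoc, Nat.cast_zero, zero_mul, zero_add]
      simp [paritySign]
    · simp [lastDerTree]
  lt i j h a b c := by
    obtain ⟨j, rfl⟩ : ∃ k, j = k + 1 := ⟨j - 1, by omega⟩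
    rcases i with _ | i <;> simp [lastDerTree]
  gt_one i a b c := by simp [lastDerTree]
  gt_two i a b c := by simp [lastDerTree]
  gt_many i k a b c := by simp [lastDerTree]
  left i a u := by
    rcases i with _ | i
    · exact ⟨LinearMap.mulLeft K (incl (ofTree a)), 0, fun b _ => by simp [lastDerTree]⟩
    · exact ⟨0, 0, fun b _ => by simp [lastDerTree]⟩
  right i b u := by
    rcases i with _ | i
    · exact ⟨0, LinearMap.mulRight K (lastDerTree f b) ∘ₗ incl, fun a _ => by simp [lastDerTree]⟩
    · exact ⟨0, 0, fun a _ => by simp [lastDerTree]⟩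

/-- The linear extension of `lastDerTree` to `ℰ(V)`. -/
noncomputable def lastDer : Eilh 𝒱 →ₗ[K] ShuffleOne 𝒱 := lift _ (isEilhMap_lastDerTree f)

theorem lastDer_ofTree (a : EilhTree 𝒱) : lastDer f (ofTree a) = lastDerTree f a :=
  lift_ofTree _ _ _

theorem lastDer_gen {d : ℤ} (v : 𝒱 d) : lastDer f (gen v) = f d v • 1 := lastDer_ofTree f _

theorem lastDer_op_zero (x y : Eilh 𝒱) : lastDer f (op 0 x y) = incl x * lastDer f y := by
  have : (op 0).compr₂ (lastDer f) =
      ((LinearMap.mul K (ShuffleOne 𝒱)).comp incl).compl₂ (lastDer f) := by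
    refine ext_ofTree fun a => ext_ofTree fun b => ?_
    simp [op_ofTree, lastDer_ofTree, lastDerTree]
  exact LinearMap.congr_fun (LinearMap.congr_fun this x) y

theorem lastDer_op_succ (i : ℕ) (x y : Eilh 𝒱) : lastDer f (op (i + 1) x y) = 0 := by
  have : (op (i + 1)).compr₂ (lastDer f) = 0 := by
    refine ext_ofTree fun a => ext_ofTree fun b => ?_
    simp [op_ofTree, lastDer_ofTree, lastDerTree]
  exact LinearMap.congr_fun (LinearMap.congr_fun this x) y

theorem lastDer_half (X : ShuffleOne 𝒱) (x : Eilh 𝒱) :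
    lastDer f (half X x) = X * lastDer f x := by
  conv_rhs => rw [← aug_smul_one_add_incl X]
  rw [half, map_add, map_smul, lastDer_op_zero, add_mul, smul_mul_assoc, one_mul]

theorem lastDer_half_gen (X : ShuffleOne 𝒱) {d : ℤ} (v : 𝒱 d) :
    lastDer f (half X (gen v)) = f d v • X := by
  rw [lastDer_half, lastDer_gen, mul_smul_comm, mul_one]

theorem lastDer_shuffleMul {x y : Eilh 𝒱} {p q : ℤ} (hx : x ∈ homogeneous 𝒱 p)
    (hy : y ∈ homogeneous 𝒱 q) : lastDer f (shuffleMul x y) =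
      incl x * lastDer f y + paritySign (p * q) • (incl y * lastDer f x) := by
  rw [shuffleMul_eq hx hy, map_add, LinearMap.map_units_int_smul, lastDer_op_zero, lastDer_op_zero]

theorem isHomog_zero (m : ℤ) : IsHomog (0 : ShuffleOne 𝒱) m := ⟨by simp, Or.inl (by simp)⟩

variable {f}

theorem isHomog_lastDerTree {e : ℤ} (hf : ∀ d, d ≠ e → f d = 0) (a : EilhTree 𝒱) :
    IsHomog (lastDerTree f a) (a.deg - e) := by
  induction a with
  | leaf d v =>
    by_cases h : d = e
    · exact ⟨by simp [lastDerTree], Or.inr (by simp [deg, h])⟩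
    · simp [lastDerTree, hf d h, isHomog_zero]
  | op i a b _ hb =>
    rcases i with _ | i
    · have := IsHomog.incl_mul (ofTree_mem_homogeneous (a := a) rfl) hb
      simp only [lastDerTree, deg_op]
      convert this using 1
      push_cast
      ring
    · exact isHomog_zero _

theorem flipHalf_eq {x : Eilh 𝒱} {X : ShuffleOne 𝒱} {p m : ℤ} (hx : x ∈ homogeneous 𝒱 p)
    (hX : IsHomog X m) : flipHalf x X = paritySign (p * m) • half X x := by
  rw [flipHalf_apply, flipOp_eq hx hX.1, half, smul_add]
  rcases hX.2 with h | h
  · simp [h]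
  · simp [h, paritySign]

/-! ### Removing the last letter of a word that ends with `⊘₁` -/

variable (f) in
/-- The operation that contracts the last letter of a word with a linear form, for words in which
`⊘₁` occurs at the last place, and only there. -/
noncomputable def lastOneTree : EilhTree 𝒱 → Eilh 𝒱
  | leaf _ _ => 0
  | EilhTree.op 0 a b =>
    if a.wt = 0 then paritySign a.deg • op 0 (ofTree a) (lastOneTree b) else 0
  | EilhTree.op 1 a b =>
    if a.wt = 0 ∧ b.wt = 0 then flipHalf (ofTree a) (lastDer f (ofTree b)) else 0
  | EilhTree.op (_ + 2) _ _ => 0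

-- Only total weight one contributes, so the nontrivial relations have index pairs `(0, 0)`, `(0,
-- 1)` and `(1, 0)`. They reduce to the Zinbiel identity, `op_zero_flipHalf` and
-- `flipHalf_incl_mul`. The correction terms contain two positive indices and are sent to zero.
variable (f) in
theorem isEilhMap_lastOneTree : IsEilhMap (lastOneTree f) where
  leaf_add d v w := by simp [lastOneTree]
  leaf_smul d c v := by simp [lastOneTree]
  eq i a b c := by
    rcases i with _ | _ | i
    · by_cases ha : a.wt = 0 <;> by_cases hb : b.wt = 0
      · simp only [lastOneTree, ha, hb, wt_op, if_true, ← op_ofTree, deg_op, op_units_smul_right,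
          add_zero, op_zero_op_zero, shuffleMul_ofTree, op_add_left, op_units_smul_left]
        simp only [Units.smul_def]
        match_scalars <;>
          simp only [paritySign_eq_ite, Int.even_add, Int.even_mul, Nat.cast_zero, add_zero,
            zero_mul, zero_add] <;>
          by_cases h0 : Even a.deg <;>
          by_cases h1 : Even b.deg <;>
          simp [h0, h1]
      all_goals simp [lastOneTree, ha, hb, wt_op]
    · simp [lastOneTree, wt_op]
    · simp [lastOneTree]
  lt i j h a b c := by
    obtain ⟨j, rfl⟩ : ∃ k, j = k + 1 := ⟨j - 1, by omega⟩
    rcases i with _ | i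
    · rcases j with _ | j
      · by_cases ha : a.wt = 0 <;> by_cases hb : b.wt = 0 <;> by_cases hc : c.wt = 0 <;>
          simp [lastOneTree, ha, hb, hc, wt_op, op_zero_flipHalf, op_ofTree]
      · simp [lastOneTree]
    · obtain ⟨j, rfl⟩ : ∃ k, j = k + 1 := ⟨j - 1, by omega⟩
      rcases i with _ | i
      · simp [lastOneTree, wt_op]
      · simp [lastOneTree]
  gt_one i a b c := by
    rcases i with _ | i
    · by_cases ha : a.wt = 0 <;> by_cases hb : b.wt = 0 <;> by_cases hc : c.wt = 0 <;>
        simp [lastOneTree, ha, hb, hc, wt_op, ← op_ofTree, lastDer_op_zero, flipHalf_incl_mul]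
    · simp [lastOneTree]
  gt_two i a b c := by
    rcases i with _ | i
    · simp [lastOneTree, wt_op]
    · simp [lastOneTree]
  gt_many i k a b c := by
    rcases i with _ | i
    · simp [lastOneTree, wt_op]
    · simp [lastOneTree]
  left i a u := by
    rcases i with _ | _ | i
    · refine ⟨if a.wt = 0 then .signSmul (paritySign a.deg) (op 0 (ofTree a)) else 0, 0, ?_⟩
      intro b _
      by_cases ha : a.wt = 0 <;> simp [lastOneTree, ha]
    · refine ⟨0, if a.wt = 0 ∧ u.2.2 = 0 then flipHalf (ofTree a) ∘ₗ lastDer f else 0, ?_⟩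
      rintro b rfl
      by_cases ha : a.wt = 0 <;> by_cases hb : b.wt = 0 <;> simp [lastOneTree, ha, hb, type]
    · exact ⟨0, 0, fun b _ => by simp [lastOneTree]⟩
  right i b u := by
    rcases i with _ | _ | i
    · refine ⟨0, if u.2.2 = 0 then
        .signSmul (paritySign u.1) ((op 0).flip (lastOneTree f b)) else 0, ?_⟩
      rintro a rfl
      by_cases ha : a.wt = 0 <;> simp [lastOneTree, ha, type]
    · refine ⟨0, if u.2.2 = 0 ∧ b.wt = 0 then
        aug (lastDer f (ofTree b)) • LinearMap.id + flipOp.flip (proj (lastDer f (ofTree b)))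
        else 0, ?_⟩
      rintro a rfl
      by_cases ha : a.wt = 0 <;> by_cases hb : b.wt = 0 <;>
        simp [lastOneTree, ha, hb, type, flipHalf_apply]
    · exact ⟨0, 0, fun a _ => by simp [lastOneTree]⟩

variable (f) in
/-- The linear extension of `lastOneTree` to `ℰ(V)`. -/
noncomputable def lastOne : Eilh 𝒱 →ₗ[K] Eilh 𝒱 := lift _ (isEilhMap_lastOneTree f)

variable (f) in
theorem lastOne_ofTree (a : EilhTree 𝒱) : lastOne f (ofTree a) = lastOneTree f a :=
  lift_ofTree _ _ _

variable (f) in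
theorem lastOne_op_zero_gen (x : Eilh 𝒱) {d : ℤ} (v : 𝒱 d) : lastOne f (op 0 x (gen v)) = 0 := by
  have : lastOne f ∘ₗ (op 0).flip (gen v) = 0 := by
    refine ext_ofTree fun a => ?_
    simp [gen, op_ofTree, lastOne_ofTree, lastOneTree]
  exact LinearMap.congr_fun this x

end Eilh

/-! ### Words in `⊘₀` -/

namespace EilhTree

/-- The left-nested monomials in which only `⊘₀` occurs. -/
inductive IsZeroTree : EilhTree 𝒱 → Prop
  | leaf (d : ℤ) (v : 𝒱 d) : IsZeroTree (leaf d v)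
  | op (a : EilhTree 𝒱) (d : ℤ) (v : 𝒱 d) (h : IsZeroTree a) : IsZeroTree (op 0 a (.leaf d v))

theorem IsZeroTree.wt_eq_zero {a : EilhTree 𝒱} (h : IsZeroTree a) : a.wt = 0 := by
  induction h with
  | leaf => rfl
  | op a d v h ih => simp [wt_op, wt_leaf, ih]

theorem isZeroTree_word (n : ℕ) (T : ℕ → EilhTree 𝒱) (hT : ∀ l, ∃ d v, T l = leaf d v) :
    IsZeroTree (word n 0 T) := by
  induction n with
  | zero =>
    obtain ⟨d, v, h⟩ := hT 0
    rw [word, h]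
    exact .leaf d v
  | succ n ih =>
    obtain ⟨d, v, h⟩ := hT (n + 1)
    rw [word, h]
    exact .op _ d v ih

end EilhTree

namespace Eilh

open EilhTree ShuffleOne

/-- The span of the left-nested monomials in which only `⊘₀` occurs. -/
noncomputable def zeroSpan (𝒱 : ℤ → Submodule K V) : Submodule K (Eilh 𝒱) :=
  Submodule.span K {x | ∃ a : EilhTree 𝒱, IsZeroTree a ∧ x = ofTree a}

theorem zeroWord_mem_zeroSpan {n : ℕ} (d : Fin (n + 1) → ℤ) (v : ∀ i, 𝒱 (d i))
    (σ : Equiv.Perm (Fin (n + 1))) : zeroWord d v σ ∈ zeroSpan 𝒱 :=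
  Submodule.subset_span ⟨_, isZeroTree_word _ _ fun _ => ⟨_, _, rfl⟩, rfl⟩

theorem zeroWords_le_zeroSpan : zeroWords 𝒱 ≤ zeroSpan 𝒱 := by
  refine Submodule.span_le.2 ?_
  rintro _ ⟨n, d, v, rfl⟩
  exact zeroWord_mem_zeroSpan d v 1

theorem eq_of_mem_zeroSpan {W : Type*} [AddCommGroup W] [Module K W] {f g : Eilh 𝒱 →ₗ[K] W}
    (h : ∀ a : EilhTree 𝒱, IsZeroTree a → f (ofTree a) = g (ofTree a)) {x : Eilh 𝒱}
    (hx : x ∈ zeroSpan 𝒱) : f x = g x := by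
  have : Set.EqOn f g (zeroSpan 𝒱) := by
    apply LinearMap.eqOn_span
    rintro _ ⟨b, hb, rfl⟩
    exact h b hb
  exact this hx

theorem zeroSpan_le_comap {W : Type*} [AddCommGroup W] [Module K W] {f : Eilh 𝒱 →ₗ[K] W}
    {p : Submodule K W} (h : ∀ a : EilhTree 𝒱, IsZeroTree a → f (ofTree a) ∈ p) {x : Eilh 𝒱}
    (hx : x ∈ zeroSpan 𝒱) : f x ∈ p := by
  have : zeroSpan 𝒱 ≤ p.comap f := by
    refine Submodule.span_le.2 ?_
    rintro _ ⟨b, hb, rfl⟩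
    exact h b hb
  exact this hx

variable {f : ∀ d, 𝒱 d →ₗ[K] K}

theorem proj_lastDer_mem_zeroSpan {z : Eilh 𝒱} (hz : z ∈ zeroSpan 𝒱) :
    proj (lastDer f z) ∈ zeroSpan 𝒱 := by
  refine zeroSpan_le_comap (f := proj ∘ₗ lastDer f) (fun a ha => ?_) hz
  rw [LinearMap.comp_apply]
  cases ha with
  | leaf d v => simp [lastDer_ofTree, lastDerTree]
  | op a d v h =>
    simp only [lastDer_ofTree, lastDerTree, mul_smul_comm, mul_one, map_smul, proj_incl]
    exact Submodule.smul_mem _ _ (Submodule.subset_span ⟨a, h, rfl⟩)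

/-- The derivation of `ℰ(V)` that vanishes on `V`. -/
noncomputable def der₀ : Eilh 𝒱 →ₗ[K] Eilh 𝒱 := der 0 fun _ _ => by simp

theorem isDerivation_der₀ : IsDerivation (der₀ : Eilh 𝒱 →ₗ[K] Eilh 𝒱) := isDerivation_der _

theorem der₀_gen {d : ℤ} (v : 𝒱 d) : der₀ (gen v) = 0 := der_gen _ v

theorem gen_mem_homogeneous {d : ℤ} (v : 𝒱 d) : gen v ∈ homogeneous 𝒱 d :=
  ofTree_mem_homogeneous rfl

theorem der₀_op_zero_gen (a : EilhTree 𝒱) {d : ℤ} (v : 𝒱 d) :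
    der₀ (op 0 (ofTree a) (gen v)) = op 0 (der₀ (ofTree a)) (gen v) +
      op 1 (ofTree a) (gen v) - paritySign (a.deg * d) • op 1 (gen v) (ofTree a) := by
  rw [isDerivation_der₀.leibniz 0 a.deg d _ (ofTree_mem_homogeneous rfl) _
    (gen_mem_homogeneous v), der₀_gen, leibnizOp]
  simp [paritySign]

/-- Applied to `a ⊘₀ v`, `der₀` gives `der₀ a ⊘₀ v` and two terms with outer product `⊘₁`, and the
contraction kills the latter. Stripping a last letter thus commutes with `der₀` on words in `⊘₀`. -/
theorem lastDer_der₀ {z : Eilh 𝒱} (hz : z ∈ zeroSpan 𝒱) :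
    lastDer f (der₀ z) = incl (der₀ (proj (lastDer f z))) := by
  refine eq_of_mem_zeroSpan (f := lastDer f ∘ₗ der₀)
    (g := incl ∘ₗ der₀ ∘ₗ proj ∘ₗ lastDer f) (fun a ha => ?_) hz
  simp only [LinearMap.comp_apply]
  cases ha with
  | leaf d v =>
    change lastDer f (der₀ (gen v)) = incl (der₀ (proj (lastDer f (gen v))))
    simp [der₀_gen, lastDer_gen]
  | op a d v h =>
    rw [← op_ofTree]
    change lastDer f (der₀ (op 0 (ofTree a) (gen v))) =
      incl (der₀ (proj (lastDer f (op 0 (ofTree a) (gen v)))))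
    rw [der₀_op_zero_gen, map_sub, map_add, LinearMap.map_units_int_smul, lastDer_op_succ f 0,
      lastDer_op_succ f 0, lastDer_op_zero, lastDer_op_zero, lastDer_gen]
    simp

/-- For `a ⊘₀ v` the terms `a ⊘₁ v` and `v ⊘₁ a` of `der₀` contain the last letter of `a` and the
letter `v` in both orders. Contracting first behind `⊘₁` with `f` and then with `g` reads off both
orders. The term `der₀ a ⊘₀ v` is invisible by `lastOne_op_zero_gen`. -/
theorem lastDer_lastOne_der₀ {g : ∀ d, 𝒱 d →ₗ[K] K} {p q : ℤ} (hf : ∀ d, d ≠ p → f d = 0)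
    (hg : ∀ d, d ≠ q → g d = 0) {z : Eilh 𝒱} (hz : z ∈ zeroSpan 𝒱) :
    lastDer g (lastOne f (der₀ z)) = lastDer g (proj (lastDer f z)) -
      paritySign (q * p) • lastDer f (proj (lastDer g z)) := by
  have key : (lastDer g ∘ₗ lastOne f ∘ₗ der₀) z = (lastDer g ∘ₗ proj ∘ₗ lastDer f -
      .signSmul (paritySign (q * p)) (lastDer f ∘ₗ proj ∘ₗ lastDer g)) z := by
    refine eq_of_mem_zeroSpan (fun a ha => ?_) hz
    simp only [LinearMap.comp_apply, LinearMap.sub_apply, LinearMap.signSmul_apply]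
    cases ha with
    | leaf d v =>
      change lastDer g (lastOne f (der₀ (gen v))) = lastDer g (proj (lastDer f (gen v))) -
        paritySign (q * p) • lastDer f (proj (lastDer g (gen v)))
      simp [der₀_gen, lastDer_gen]
    | op a d v h =>
      rw [← op_ofTree]
      change lastDer g (lastOne f (der₀ (op 0 (ofTree a) (gen v)))) =
        lastDer g (proj (lastDer f (op 0 (ofTree a) (gen v)))) -
          paritySign (q * p) • lastDer f (proj (lastDer g (op 0 (ofTree a) (gen v))))
      rw [der₀_op_zero_gen, map_sub, map_add, LinearMap.map_units_int_smul, lastOne_op_zero_gen,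
        lastDer_op_zero, lastDer_op_zero, lastDer_gen, lastDer_gen]
      simp only [gen, op_ofTree, lastOne_ofTree, lastOneTree, h.wt_eq_zero, wt_leaf, and_self,
        if_true]
      rw [show ofTree (leaf d v) = gen v from rfl]
      rw [lastDer_gen, lastDer_ofTree, flipHalf_eq (gen_mem_homogeneous v)
        (isHomog_lastDerTree hf a), map_sub, map_add, map_smul, LinearMap.map_units_int_smul,
        LinearMap.map_units_int_smul]
      rw [lastDer_half_gen]
      simp only [mul_smul_comm, mul_one, map_smul, proj_incl, map_zero, zero_add, flipHalf_apply,
        aug_one, proj_one, add_zero, one_smul, lastDer_ofTree, deg_leaf]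
      congr 1
      -- The form `g` is nonzero on `v` only in degree `q`; in that case the sign of the flip and
      -- the sign of moving `v` past the shortened word combine to `(-1)^(q p)`.
      by_cases hd : d = q
      · subst hd
        rw [smul_smul, ← paritySign_add]
        congr 1
        apply paritySign_congr
        exact ⟨a.deg * d - d * p, by ring⟩
      · simp [hg d hd]
  simpa using key

/-! ### Coefficients -/

/-- The coefficient of the word `f₀ ⋯ f_{N-1}` of linear forms. -/
noncomputable def coeff (f : ℕ → ∀ d, 𝒱 d →ₗ[K] K) : ℕ → ShuffleOne 𝒱 →ₗ[K] K
  | 0 => aug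
  | N + 1 => coeff f N ∘ₗ lastDer (f N) ∘ₗ proj

theorem coeff_congr {f g : ℕ → ∀ d, 𝒱 d →ₗ[K] K} {N : ℕ} (h : ∀ l < N, f l = g l) :
    coeff f N = coeff g N := by
  induction N with
  | zero => rfl
  | succ N ih => rw [coeff, coeff, h N (by omega), ih fun l hl => h l (by omega)]

theorem coeff_succ_incl_proj (f : ℕ → ∀ d, 𝒱 d →ₗ[K] K) (N : ℕ) (X : ShuffleOne 𝒱) :
    coeff f (N + 1) (incl (proj X)) = coeff f (N + 1) X := rfl

theorem coeff_succ_incl (f : ℕ → ∀ d, 𝒱 d →ₗ[K] K) (N : ℕ) (x : Eilh 𝒱) :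
    coeff f (N + 1) (incl x) = coeff f N (lastDer (f N) x) := rfl

/-- The letters behind place `k + 1` are stripped first, which commutes with `der₀`. At the places
`k`, `k + 1` the functional uses `lastOne`, and the remaining `k` letters are read off by ordinary
coefficients. -/
theorem exists_coeff_swap {f : ℕ → ∀ d, 𝒱 d →ₗ[K] K} {e : ℕ → ℤ}
    (hf : ∀ l d, d ≠ e l → f l d = 0) {N k : ℕ} (hk : k + 1 < N) :
    ∃ κ : Eilh 𝒱 →ₗ[K] K, ∀ z ∈ zeroSpan 𝒱, κ (der₀ z) = coeff f N (incl z) -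
      paritySign (e k * e (k + 1)) •
        coeff (fun l => f (Equiv.swap k (k + 1) l)) N (incl z) := by
  induction N with
  | zero => omega
  | succ N ih =>
    rcases Nat.lt_or_ge (k + 1) N with h | h
    · obtain ⟨κ, hκ⟩ := ih h
      refine ⟨κ ∘ₗ proj ∘ₗ lastDer (f N), fun z hz => ?_⟩
      obtain ⟨M, rfl⟩ : ∃ M, N = M + 1 := ⟨N - 1, by omega⟩
      rw [LinearMap.comp_apply, LinearMap.comp_apply, lastDer_der₀ hz, proj_incl,
        hκ _ (proj_lastDer_mem_zeroSpan hz), coeff_succ_incl_proj, coeff_succ_incl_proj,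
        coeff_succ_incl f, coeff_succ_incl _ (M + 1), Equiv.swap_apply_of_ne_of_ne] <;> omega
    · obtain rfl : N = k + 1 := by omega
      refine ⟨coeff f k ∘ₗ lastDer (f k) ∘ₗ lastOne (f (k + 1)), fun z hz => ?_⟩
      rw [LinearMap.comp_apply, LinearMap.comp_apply,
        lastDer_lastOne_der₀ (hf (k + 1)) (hf k) hz, map_sub, LinearMap.map_units_int_smul,
        coeff_succ_incl, ← coeff_succ_incl_proj, coeff_succ_incl, coeff_succ_incl,
        ← coeff_succ_incl_proj, coeff_succ_incl]
      simp only [Equiv.swap_apply_left, Equiv.swap_apply_right]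
      congr 3
      refine coeff_congr fun l hl => ?_
      rw [Equiv.swap_apply_of_ne_of_ne] <;> omega

end Eilh

end Coefficients

/-! ### Inserting a letter into a word, and products of letters -/

section Words

variable {K V : Type*} [Field K] [AddCommGroup V] [Module K V]
variable {𝒱 : ℤ → Submodule K V}

/-- The sequence `T 0, …, T (k-1), a, T k, T (k+1), …`. -/
def insertSeq {α : Type*} (k : ℕ) (a : α) (T : ℕ → α) : ℕ → α :=
  fun l => if l < k then T l else if l = k then a else T (l - 1)

theorem permSeq_insertPerm {α : Type*} {n : ℕ} (f : Fin (n + 2) → α) (k : Fin (n + 2))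
    (π : Equiv.Perm (Fin (n + 1))) (l : ℕ) (hl : l < n + 2) :
    permSeq f (insertPerm k π) l = insertSeq k (f 0) (permSeq (fun i => f i.succ) π) l := by
  obtain ⟨l, rfl⟩ : ∃ i : Fin (n + 2), l = i := ⟨⟨l, hl⟩, rfl⟩
  rw [permSeq_apply, insertSeq]
  split_ifs with h1 h2
  · obtain ⟨j, rfl⟩ : ∃ j : Fin (n + 1), l = k.succAbove j :=
      (Fin.exists_succAbove_eq (Fin.ne_of_lt h1)).imp fun _ h => h.symm
    have : k.succAbove j = j.castSucc := by
      rw [Fin.succAbove_of_castSucc_lt]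
      rw [← Fin.succAbove_lt_iff_castSucc_lt]
      exact h1
    rw [insertPerm_succAbove, this, Fin.val_castSucc, permSeq_apply]
  · obtain rfl : l = k := Fin.ext h2
    rw [insertPerm_self]
  · obtain ⟨j, rfl⟩ : ∃ j : Fin (n + 1), l = k.succAbove j :=
      (Fin.exists_succAbove_eq (fun h => h2 (congrArg _ h))).imp fun _ h => h.symm
    have : k.succAbove j = j.succ := by
      rw [Fin.succAbove_of_le_castSucc]
      rw [← Fin.lt_succAbove_iff_le_castSucc]
      exact lt_of_le_of_ne (not_lt.1 h1) (Fin.succAbove_ne _ _).symm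
    rw [insertPerm_succAbove, this, Fin.val_succ, Nat.add_sub_cancel, permSeq_apply]

theorem Finset.sum_range_eq_filter {M : Type*} [AddCommMonoid M] (g : ℕ → M) {k n : ℕ}
    (h : k ≤ n) : ∑ l ∈ range k, g l = ∑ l : Fin n with l.val < k, g l := by
  rw [sum_filter, Fin.sum_univ_eq_sum_range (fun l => if l < k then g l else 0), ← sum_filter]
  congr 1
  ext l
  simp only [mem_range, mem_filter]
  omega

namespace Eilh

/-- The inclusion of the homogeneous components of `V` as a linear map. -/
noncomputable def genLin (d : ℤ) : 𝒱 d →ₗ[K] Eilh 𝒱 where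
  toFun := gen
  map_add' := ofTree_leaf_add d
  map_smul' := ofTree_leaf_smul d

end Eilh

namespace ShuffleOne

open EilhTree Eilh

/-- The right action `X ⊘₀ a` as a linear map in `X`. -/
noncomputable def halfLin (a : Eilh 𝒱) : ShuffleOne 𝒱 →ₗ[K] Eilh 𝒱 where
  toFun X := half X a
  map_add' X Y := half_add X Y a
  map_smul' c X := half_smul c X a

theorem halfLin_apply (a : Eilh 𝒱) (X : ShuffleOne 𝒱) : halfLin a X = half X a := rfl

/-- The word `(⋯(T 0 ⊘₀ T 1) ⊘₀ ⋯) ⊘₀ T (n-1)`, which is `1` for `n = 0`. -/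
noncomputable def uword : ℕ → (ℕ → EilhTree 𝒱) → ShuffleOne 𝒱
  | 0, _ => 1
  | n + 1, T => incl (half (uword n T) (ofTree (T n)))

theorem uword_add_one (n : ℕ) (T : ℕ → EilhTree 𝒱) :
    uword (n + 1) T = incl (half (uword n T) (ofTree (T n))) := rfl

theorem uword_succ (n : ℕ) (T : ℕ → EilhTree 𝒱) :
    uword (n + 1) T = incl (ofTree (word n 0 T)) := by
  induction n with
  | zero => simp [uword, word]
  | succ n ih =>
    rw [uword, ih, half_incl, op_ofTree]
    rfl

theorem uword_congr {n : ℕ} {T T' : ℕ → EilhTree 𝒱} (h : ∀ l < n, T l = T' l) :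
    uword n T = uword n T' := by
  induction n with
  | zero => rfl
  | succ n ih => rw [uword, uword, h n (by omega), ih fun l hl => h l (by omega)]

theorem isHomog_uword (n : ℕ) (T : ℕ → EilhTree 𝒱) :
    IsHomog (uword n T) (∑ l ∈ range n, (T l).deg) := by
  induction n with
  | zero => exact isHomog_one
  | succ n ih =>
    rw [sum_range_succ]
    exact isHomog_incl (half_mem_homogeneous ih (ofTree_mem_homogeneous rfl))

/-- Induction on `q`: by `incl_mul_incl_half` the last place is taken either by the last letter of
the word, and then `a` is inserted further left, or by `a` itself, which is the summand `k = q + 1`.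
-/
theorem incl_mul_uword (a : EilhTree 𝒱) (q : ℕ) (T : ℕ → EilhTree 𝒱) :
    incl (ofTree a) * uword q T = ∑ k ∈ range (q + 1),
      paritySign (a.deg * ∑ l ∈ range k, (T l).deg) • uword (q + 1) (insertSeq k a T) := by
  induction q with
  | zero => simp [uword, paritySign, insertSeq]
  | succ q ih =>
    rw [uword, incl_mul_incl_half (ofTree_mem_homogeneous rfl) (ofTree_mem_homogeneous rfl)
      (isHomog_uword q T), ih, ← sum_range_succ, sum_range_succ _ (q + 1), ← halfLin_apply,
      map_sum, map_sum]
    congr 1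
    · refine sum_congr rfl fun k hk => ?_
      have hk : k < q + 1 := mem_range.1 hk
      rw [LinearMap.map_units_int_smul, LinearMap.map_units_int_smul, halfLin_apply,
        uword_add_one (q + 1)]
      congr 4
      simp [insertSeq, show ¬ q + 1 < k by omega, show q + 1 ≠ k by omega]
    · rw [← uword, uword_add_one (q + 1)]
      congr 3
      · exact uword_congr fun l hl => by simp [insertSeq, hl]
      · simp [insertSeq]

/-- The first factor is inserted at every place of every word in the other factors. `insertPerm`
turns these pairs into all permutations with the right Koszul sign. -/
theorem prod_incl_ofTree {n : ℕ} (t : Fin (n + 1) → EilhTree 𝒱) :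
    (List.ofFn fun i => incl (ofTree (t i))).prod =
      ∑ σ : Equiv.Perm (Fin (n + 1)),
        koszulSign σ (fun i => (t i).deg) • uword (n + 1) (permSeq t σ) := by
  induction n with
  | zero =>
    rw [Fintype.sum_subsingleton _ (1 : Equiv.Perm (Fin 1)), koszulSign_one]
    simp [uword, permSeq]
  | succ n ih =>
    rw [List.ofFn_succ, List.prod_cons, ih fun i => t i.succ,
      ← Equiv.sum_comp (Equiv.ofBijective _ (insertPerm_bijective (n + 1))),
      Fintype.sum_prod_type_right, mul_sum]
    refine sum_congr rfl fun π _ => ?_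
    rw [mul_smul_comm, incl_mul_uword, smul_sum, ← Fin.sum_univ_eq_sum_range]
    refine sum_congr rfl fun k _ => ?_
    rw [Equiv.ofBijective_apply, koszulSign_insertPerm, mul_smul, smul_comm,
      uword_congr fun l hl => (permSeq_insertPerm t k π l hl).symm,
      sum_range_eq_filter _ (Nat.lt_succ_iff.1 k.2)]
    simp only [permSeq_apply]

end ShuffleOne

namespace Eilh

open EilhTree ShuffleOne

variable {d : ℕ → ℤ}

theorem coeff_uword (f : ℕ → ∀ d, 𝒱 d →ₗ[K] K) (v : ∀ l, 𝒱 (d l)) (N M : ℕ) :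
    coeff f N (uword M fun l => leaf (d l) (v l)) =
      if M = N then ∏ l ∈ range N, f l (d l) (v l) else 0 := by
  induction N generalizing M with
  | zero => cases M <;> simp [uword, coeff]
  | succ N ih =>
    cases M with
    | zero => simp [uword, coeff]
    | succ M =>
      rw [uword, coeff_succ_incl]
      change coeff f N (lastDer (f N) (half _ (gen (v M)))) = _
      rw [lastDer_half_gen, map_smul, ih]
      by_cases h : M = N
      · subst h
        simp [prod_range_succ, mul_comm]
      · simp [h]

/-- When `der₀ z = 0`, the functional of `exists_coeff_swap` vanishes, so coefficients of words that
differ by an adjacent transposition agree up to the Koszul sign; such transpositions generate. -/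
theorem coeff_perm {n : ℕ} {f : Fin (n + 1) → ∀ d, 𝒱 d →ₗ[K] K} {e : Fin (n + 1) → ℤ}
    (hf : ∀ l d, d ≠ e l → f l d = 0) {z : Eilh 𝒱} (hz : z ∈ zeroSpan 𝒱) (h : der₀ z = 0)
    (σ : Equiv.Perm (Fin (n + 1))) :
    coeff (permSeq f σ) (n + 1) (incl z) =
      koszulSign σ e • coeff (permSeq f 1) (n + 1) (incl z) := by
  induction σ using Equiv.Perm.adjacent_induction with
  | one => simp [koszulSign_one]
  | mul_swap σ k ih =>
    obtain ⟨κ, hκ⟩ := exists_coeff_swap (f := permSeq f σ) (e := permSeq e σ)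
      (fun l d hd => hf _ d hd) (N := n + 1) (k := k) (by omega)
    have := hκ z hz
    rw [h, map_zero, eq_comm, sub_eq_zero, ih, ← coeff_congr fun l hl =>
      permSeq_mul_swap f σ k l (by omega)] at this
    have e1 := permSeq_apply e σ k.castSucc
    have e2 := permSeq_apply e σ k.succ
    rw [Fin.val_castSucc] at e1
    rw [Fin.val_succ] at e2
    rw [e1, e2] at this
    rw [koszulSign_mul_swap, mul_comm, mul_smul, this, units_smul_smul_self]

/-! ### Separation of words by their coefficients -/

/-- The span of the left-nested monomials of length at most `N` in which only `⊘₀` occurs. -/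
noncomputable def zeroSpanLE (𝒱 : ℤ → Submodule K V) (N : ℕ) : Submodule K (Eilh 𝒱) :=
  Submodule.span K {x | ∃ a : EilhTree 𝒱, (IsZeroTree a ∧ a.len ≤ N) ∧ x = ofTree a}

theorem exists_mem_zeroSpanLE {z : Eilh 𝒱} (hz : z ∈ zeroSpan 𝒱) : ∃ N, z ∈ zeroSpanLE 𝒱 N := by
  have mono : Monotone (zeroSpanLE 𝒱) := fun N M h => Submodule.span_mono
    fun _ ⟨a, ha, hx⟩ => ⟨a, ⟨ha.1, ha.2.trans h⟩, hx⟩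
  refine Submodule.span_induction (p := fun z _ => ∃ N, z ∈ zeroSpanLE 𝒱 N)
    ?_ ⟨0, zero_mem _⟩ ?_ ?_ hz
  · rintro _ ⟨a, ha, rfl⟩
    exact ⟨a.len, Submodule.subset_span ⟨a, ⟨ha, le_rfl⟩, rfl⟩⟩
  · rintro x y _ _ ⟨N, hN⟩ ⟨M, hM⟩
    exact ⟨max N M, add_mem (mono (le_max_left _ _) hN) (mono (le_max_right _ _) hM)⟩
  · rintro c x _ ⟨N, hN⟩
    exact ⟨N, Submodule.smul_mem _ _ hN⟩

theorem proj_lastDer_mem_zeroSpanLE {f : ∀ d, 𝒱 d →ₗ[K] K} {N : ℕ} {z : Eilh 𝒱}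
    (hz : z ∈ zeroSpanLE 𝒱 (N + 1)) : proj (lastDer f z) ∈ zeroSpanLE 𝒱 N := by
  have : zeroSpanLE 𝒱 (N + 1) ≤ (zeroSpanLE 𝒱 N).comap (proj ∘ₗ lastDer f) := by
    refine Submodule.span_le.2 ?_
    rintro _ ⟨a, ⟨ha, hN⟩, rfl⟩
    change proj (lastDer f (ofTree a)) ∈ zeroSpanLE 𝒱 N
    cases ha with
    | leaf d v => simp [lastDer_ofTree, lastDerTree]
    | op a d v h =>
      simp only [lastDer_ofTree, lastDerTree, mul_smul_comm, mul_one, map_smul, proj_incl]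
      exact Submodule.smul_mem _ _ (Submodule.subset_span
        ⟨a, ⟨h, by rw [len_op, len_leaf] at hN; omega⟩, rfl⟩)
  exact this hz

section Basis

variable {ι : ℤ → Type*} (b : ∀ d, Module.Basis (ι d) K (𝒱 d))

/-- The coordinate form of a basis vector, extended by zero to the other degrees. -/
noncomputable def coordForm (x : Σ d, ι d) : ∀ d, 𝒱 d →ₗ[K] K := Pi.single x.1 ((b x.1).coord x.2)

theorem coordForm_of_ne (x : Σ d, ι d) (d : ℤ) (h : d ≠ x.1) : coordForm b x d = 0 :=
  Pi.single_eq_of_ne h _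

theorem coordForm_self (d : ℤ) (i : ι d) : coordForm b ⟨d, i⟩ d = (b d).coord i :=
  Pi.single_eq_same _ _

/-- A combination of words is recovered from its contractions with the dual basis by appending the
basis vectors again. Finitely many basis vectors suffice, and permitting every larger finite set
makes the statement additive in `z`. -/
theorem exists_sum_half_lastDer {z : Eilh 𝒱} (hz : z ∈ zeroSpan 𝒱) :
    ∃ s : Finset (Σ d, ι d), ∀ s', s ⊆ s' →
      z = ∑ x ∈ s', half (lastDer (coordForm b x) z) (gen (b x.1 x.2)) := by
  classical
  refine Submodule.span_induction (p := fun z _ => ∃ s : Finset (Σ d, ι d), ∀ s', s ⊆ s' →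
      z = ∑ x ∈ s', half (lastDer (coordForm b x) z) (gen (b x.1 x.2))) ?_
      ⟨∅, fun s' _ => ?_⟩ ?_ ?_ hz
  · have key (X : ShuffleOne 𝒱) (d : ℤ) (v : 𝒱 d) : ∃ s : Finset (Σ d, ι d), ∀ s', s ⊆ s' →
        half X (gen v) =
          ∑ x ∈ s', half (lastDer (coordForm b x) (half X (gen v))) (gen (b x.1 x.2)) := by
      refine ⟨((b d).repr v).support.map (Function.Embedding.sigmaMk d), fun s' h => ?_⟩
      simp only [lastDer_half_gen, half_smul]
      rw [← sum_subset h, sum_map]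
      · have h1 : gen v = ∑ i ∈ ((b d).repr v).support, (b d).repr v i • gen (b d i) := by
          have := congrArg (genLin d) ((b d).linearCombination_repr v).symm
          rw [Finsupp.linearCombination_apply, Finsupp.sum, map_sum] at this
          simp only [map_smul] at this
          exact this
        conv_lhs => rw [h1, half, map_sum, smul_sum, ← sum_add_distrib]
        refine sum_congr rfl fun i _ => ?_
        change _ = (coordForm b ⟨d, i⟩ d v) • half X (gen (b d i))
        rw [coordForm_self]
        simp [half, smul_comm (aug X)]
      · rintro ⟨d', i⟩ _ hx
        by_cases hd : d = d'
        · subst hd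
          have : (b d).repr v i = 0 := by simpa using hx
          simp [coordForm, this]
        · rw [coordForm_of_ne b _ _ hd]
          simp
    rintro _ ⟨a, ha, rfl⟩
    cases ha with
    | leaf d v => simpa only [half_one, gen] using key 1 d v
    | op a d v h => simpa only [half_incl, gen, op_ofTree] using key (incl (ofTree a)) d v
  · simp [half]
  · rintro x y _ _ ⟨s, hs⟩ ⟨t, ht⟩
    refine ⟨s ∪ t, fun s' h => ?_⟩
    simp only [map_add, half_add, sum_add_distrib]
    rw [← hs s' (union_subset_left h), ← ht s' (union_subset_right h)]
  · rintro c x _ ⟨s, hs⟩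
    refine ⟨s, fun s' h => ?_⟩
    simp only [map_smul, half_smul, ← smul_sum]
    rw [← hs s' h]

end Basis

theorem eq_zero_of_coeff_eq_zero {z : Eilh 𝒱} (hz : z ∈ zeroSpan 𝒱)
    (h : ∀ (N : ℕ) (f : Fin (N + 1) → ∀ d, 𝒱 d →ₗ[K] K) (e : Fin (N + 1) → ℤ),
      (∀ l d, d ≠ e l → f l d = 0) → coeff (permSeq f 1) (N + 1) (incl z) = 0) : z = 0 := by
  -- Forms are now indexed by `ℕ`, and length zero is included: `incl z` has augmentation zero.
  replace h : ∀ (N : ℕ) (f : ℕ → ∀ d, 𝒱 d →ₗ[K] K) (e : ℕ → ℤ),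
      (∀ l d, d ≠ e l → f l d = 0) → coeff f N (incl z) = 0 := by
    intro N f e hf
    cases N with
    | zero => rfl
    | succ N =>
      rw [← h N (fun i => f i) (fun i => e i) fun l d hd => hf l d hd]
      refine LinearMap.congr_fun (coeff_congr fun l hl => ?_) _
      exact (permSeq_apply (fun i : Fin (N + 1) => f i) 1 ⟨l, hl⟩).symm
  obtain ⟨M, hM⟩ := exists_mem_zeroSpanLE hz
  induction M generalizing z with
  | zero =>
    have : zeroSpanLE 𝒱 0 = ⊥ := by
      refine (Submodule.eq_bot_iff _).2 fun x hx => ?_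
      refine Submodule.span_induction ?_ rfl ?_ ?_ hx
      · rintro _ ⟨a, ha, rfl⟩
        exact absurd a.len_pos (by omega)
      · rintro x y _ _ rfl rfl
        simp
      · rintro c x _ rfl
        simp
    rw [this] at hM
    exact hM
  | succ M ih =>
    have b d := Module.Basis.ofVectorSpace K (𝒱 d)
    obtain ⟨s, hs⟩ := exists_sum_half_lastDer b hz
    rw [hs s subset_rfl]
    refine sum_eq_zero fun x _ => ?_
    -- A coefficient of the contraction is the coefficient of `z` for the word extended by
    -- `coordForm b x` at place `N`. Length zero controls the scalar part, and the inductive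
    -- hypothesis controls the projection to `ℰ(V)`, whose words are shorter.
    have key : lastDer (coordForm b x) z = 0 := by
      have h1 (N : ℕ) (f : ℕ → ∀ d, 𝒱 d →ₗ[K] K) (e : ℕ → ℤ)
          (hf : ∀ l d, d ≠ e l → f l d = 0) : coeff f N (lastDer (coordForm b x) z) = 0 := by
        rw [← h (N + 1) (fun l => if l < N then f l else coordForm b x)
          (fun l => if l < N then e l else x.1) ?_, coeff_succ_incl]
        · rw [if_neg (lt_irrefl N), coeff_congr (g := f) fun l hl => if_pos hl]
        · intro l d hd
          by_cases hl : l < N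
          · simp only [if_pos hl] at hd ⊢
            exact hf l d hd
          · simp only [if_neg hl] at hd ⊢
            exact coordForm_of_ne b x d hd
      refine ext' (h1 0 (fun _ => 0) 0 (fun _ _ _ => rfl)) ?_
      rw [map_zero]
      refine ih (proj_lastDer_mem_zeroSpan hz) (fun N f e hf => ?_)
        (proj_lastDer_mem_zeroSpanLE hM)
      cases N with
      | zero => rfl
      | succ N => exact h1 (N + 1) f e hf
    simp [key, half]

end Eilh

end Words

/-! ### The free graded commutative algebra -/

section GradedSymmetric

variable {K V : Type*} [Field K] [AddCommGroup V] [Module K V]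
variable {𝒱 : ℤ → Submodule K V}

namespace GradedSym

theorem gen_mul_gen {d e : ℤ} (v : 𝒱 d) (w : 𝒱 e) :
    gen v * gen w = paritySign (d * e) • (gen w * gen v) := by
  have h := RingQuot.mkAlgHom_rel K (GradedSymRel.comm d e v w)
  rw [map_mul, Units.smul_def, map_zsmul, map_mul, ← Units.smul_def] at h
  exact h

theorem monomial_ofFn {n : ℕ} (d : Fin n → ℤ) (v : ∀ i, 𝒱 (d i)) :
    ((List.ofFn fun i => (⟨d i, v i⟩ : Σ d, 𝒱 d)).map fun x => gen x.2).prod = monomial d v := by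
  rw [List.map_ofFn]
  rfl

theorem exists_monomial_eq_prod (L : List (Σ d, 𝒱 d)) :
    ∃ (d : Fin L.length → ℤ) (v : ∀ i, 𝒱 (d i)), ∑ i, d i = (L.map fun x => x.1).sum ∧
      (L.map fun x => gen x.2).prod = monomial d v := by
  refine ⟨fun i => L[i].1, fun i => L[i].2, ?_, ?_⟩
  · rw [← List.sum_ofFn]
    congr 1
    exact List.ext_getElem (by simp) fun i h h' => by simp
  · rw [monomial]
    congr 1
    exact List.ext_getElem (by simp) fun i h h' => by simp

theorem prod_mem_homogeneous (L : List (Σ d, 𝒱 d)) :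
    (L.map fun x => gen x.2).prod ∈ homogeneous 𝒱 (L.map fun x => x.1).sum := by
  obtain ⟨d, v, h1, h2⟩ := exists_monomial_eq_prod L
  exact Submodule.subset_span ⟨_, d, v, h1, h2⟩

theorem homogeneous_induction {m : ℤ} {p : Submodule K (GradedSym 𝒱)}
    (h : ∀ L : List (Σ d, 𝒱 d), (L.map fun x => x.1).sum = m → (L.map fun x => gen x.2).prod ∈ p)
    {x : GradedSym 𝒱} (hx : x ∈ homogeneous 𝒱 m) : x ∈ p := by
  have : homogeneous 𝒱 m ≤ p := by
    refine Submodule.span_le.2 ?_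
    rintro _ ⟨n, d, v, rfl, rfl⟩
    rw [← monomial_ofFn]
    refine h _ ?_
    rw [List.map_ofFn, List.sum_ofFn]
    rfl
  exact this hx

theorem mul_mem_homogeneous {m k : ℤ} {x y : GradedSym 𝒱} (hx : x ∈ homogeneous 𝒱 m)
    (hy : y ∈ homogeneous 𝒱 k) : x * y ∈ homogeneous 𝒱 (m + k) := by
  refine homogeneous_induction (p := (homogeneous 𝒱 (m + k)).comap (LinearMap.mulRight K y))
    (fun L hL => ?_) hx
  refine homogeneous_induction (p := (homogeneous 𝒱 (m + k)).comap (LinearMap.mulLeft K _))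
    (fun L' hL' => ?_) hy
  have := prod_mem_homogeneous (L ++ L')
  simp only [List.map_append, List.prod_append, List.sum_append, hL, hL'] at this
  exact this

theorem gen_mem_homogeneous {d : ℤ} (v : 𝒱 d) : gen v ∈ homogeneous 𝒱 d := by
  simpa using prod_mem_homogeneous [(⟨d, v⟩ : Σ d, 𝒱 d)]

theorem gen_mul_prod {d : ℤ} (v : 𝒱 d) (L : List (Σ d, 𝒱 d)) :
    gen v * (L.map fun x => gen x.2).prod = paritySign (d * (L.map fun x => x.1).sum) •
      ((L.map fun x => gen x.2).prod * gen v) := by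
  induction L with
  | nil => simp [paritySign]
  | cons x L ih =>
    simp only [List.map_cons, List.prod_cons, List.sum_cons]
    rw [← mul_assoc, gen_mul_gen, smul_mul_assoc, mul_assoc, ih, mul_smul_comm, smul_smul,
      ← paritySign_add, ← mul_add, mul_assoc]

theorem mul_comm_of_homogeneous {m k : ℤ} {x y : GradedSym 𝒱} (hx : x ∈ homogeneous 𝒱 m)
    (hy : y ∈ homogeneous 𝒱 k) : x * y = paritySign (m * k) • (y * x) := by
  refine homogeneous_induction (p := LinearMap.eqLocus (LinearMap.mulRight K y)
    (LinearMap.signSmul (paritySign (m * k)) (LinearMap.mulLeft K y))) (fun L hL => ?_) hx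
  refine homogeneous_induction (p := LinearMap.eqLocus (LinearMap.mulLeft K _)
    (LinearMap.signSmul (paritySign (m * k)) (LinearMap.mulRight K _))) (fun L' hL' => ?_) hy
  simp only [LinearMap.mem_eqLocus, LinearMap.mulLeft_apply, LinearMap.signSmul_apply,
    LinearMap.mulRight_apply]
  subst hL hL'
  clear hx
  induction L with
  | nil => simp [paritySign]
  | cons x L ih =>
    simp only [List.map_cons, List.prod_cons, List.sum_cons]
    rw [mul_assoc, ih, mul_smul_comm, ← mul_assoc, gen_mul_prod, smul_mul_assoc, smul_smul,
      ← paritySign_add, mul_assoc]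
    congr 2
    ring

/-- The inclusion of the homogeneous components of `V` as a linear map. -/
noncomputable def genLin (d : ℤ) : 𝒱 d →ₗ[K] GradedSym 𝒱 :=
  (RingQuot.mkAlgHom K (GradedSymRel 𝒱)).toLinearMap ∘ₗ TensorAlgebra.ι K ∘ₗ (𝒱 d).subtype

section Decomposition

variable [DirectSum.Decomposition 𝒱]

/-- The decomposition of `V` reduces multiplication by an arbitrary vector to multiplication by
homogeneous generators. -/
theorem induction_on {p : Submodule K (GradedSym 𝒱)} (one : 1 ∈ p)
    (gen_mul : ∀ (d : ℤ) (v : 𝒱 d), ∀ x ∈ p, gen v * x ∈ p) (x : GradedSym 𝒱) : x ∈ p := by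
  suffices h : ∀ y : TensorAlgebra K V, ∀ x ∈ p, RingQuot.mkAlgHom K (GradedSymRel 𝒱) y * x ∈ p by
    obtain ⟨y, rfl⟩ := RingQuot.mkAlgHom_surjective K (GradedSymRel 𝒱) x
    simpa using h y 1 one
  intro y
  induction y using TensorAlgebra.induction with
  | algebraMap r =>
    intro x hx
    rw [AlgHom.commutes, ← Algebra.smul_def]
    exact p.smul_mem r hx
  | ι v =>
    intro x hx
    induction v using DirectSum.Decomposition.inductionOn 𝒱 with
    | zero => simp
    | homogeneous v => exact gen_mul _ v x hx
    | add v w hv hw =>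
      rw [map_add, map_add, add_mul]
      exact p.add_mem hv hw
  | mul a b ha hb =>
    intro x hx
    rw [map_mul, mul_assoc]
    exact ha _ (hb _ hx)
  | add a b ha hb =>
    intro x hx
    rw [map_add, add_mul]
    exact p.add_mem (ha _ hx) (hb _ hx)

theorem hom_ext {W : Type*} [AddCommGroup W] [Module K W] {f g : GradedSym 𝒱 →ₗ[K] W}
    (one : f 1 = g 1) (gen_mul : ∀ (d : ℤ) (v : 𝒱 d) (x : GradedSym 𝒱), f x = g x →
      f (gen v * x) = g (gen v * x)) : f = g :=
  LinearMap.ext fun x => induction_on (p := LinearMap.eqLocus f g) one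
    (fun d v x hx => gen_mul d v x hx) x

theorem induction_on_prod {p : Submodule K (GradedSym 𝒱)}
    (h : ∀ L : List (Σ d, 𝒱 d), (L.map fun x => gen x.2).prod ∈ p) (x : GradedSym 𝒱) : x ∈ p := by
  set q : Submodule K (GradedSym 𝒱) := Submodule.span K
    (Set.range fun L : List (Σ d, 𝒱 d) => (L.map fun x => gen x.2).prod) with hq
  have hx : x ∈ q := by
    refine induction_on (p := q) (Submodule.subset_span ⟨[], rfl⟩) (fun d v x hx => ?_) x
    have : q ≤ q.comap (LinearMap.mulLeft K (gen v)) := by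
      refine Submodule.span_le.2 ?_
      rintro _ ⟨L, rfl⟩
      exact Submodule.subset_span ⟨(⟨d, v⟩ : Σ d, 𝒱 d) :: L, by simp⟩
    exact this hx
  have : q ≤ p := by
    refine Submodule.span_le.2 ?_
    rintro _ ⟨L, rfl⟩
    exact h L
  exact this hx

theorem gen_mul_mem_augmentation {d : ℤ} (v : 𝒱 d) (x : GradedSym 𝒱) :
    gen v * x ∈ augmentation 𝒱 := by
  refine induction_on_prod (p := (augmentation 𝒱).comap (LinearMap.mulLeft K (gen v)))
    (fun L => ?_) x
  obtain ⟨d, v, -, h⟩ := exists_monomial_eq_prod ((⟨d, v⟩ : Σ d, 𝒱 d) :: L)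
  rw [List.map_cons, List.prod_cons] at h
  rw [Submodule.mem_comap, LinearMap.mulLeft_apply, h]
  exact Submodule.subset_span ⟨_, d, v, rfl⟩

section Lift

variable {A : Type*} [Ring A] [Algebra K A] (f : ∀ d, 𝒱 d →ₗ[K] A)
  (hf : ∀ (d e : ℤ) (v : 𝒱 d) (w : 𝒱 e), f d v * f e w = paritySign (d * e) • (f e w * f d v))

/-- The universal property of the free graded commutative algebra. -/
noncomputable def liftAlg : GradedSym 𝒱 →ₐ[K] A :=
  RingQuot.liftAlgHom K ⟨TensorAlgebra.lift K
    (DirectSum.toModule K ℤ A f ∘ₗ (DirectSum.decomposeLinearEquiv 𝒱).toLinearMap), by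
      rintro _ _ ⟨d, e, v, w⟩
      simp only [map_mul, TensorAlgebra.lift_ι_apply, Units.smul_def, map_zsmul]
      simp [hf d e v w, Units.smul_def]⟩

theorem liftAlg_gen {d : ℤ} (v : 𝒱 d) : liftAlg f hf (gen v) = f d v := by
  simp [liftAlg, gen]

end Lift

end Decomposition

end GradedSym

end GradedSymmetric

/-! ### Symmetrization as an algebra map -/

section Symmetrization

variable {K V : Type*} [Field K] [AddCommGroup V] [Module K V]
variable {𝒱 : ℤ → Submodule K V}

open EilhTree Eilh ShuffleOne

namespace Eilh

/-! ### Derivations and the shuffle product -/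

/-- The deformation terms `x ⊘₁ y - ± y ⊘₁ x` are graded antisymmetric in `x` and `y`, so they
disappear from the symmetrized product. -/
theorem IsDerivation.shuffleMul {D : Eilh 𝒱 →ₗ[K] Eilh 𝒱} (hD : IsDerivation D) {m : ℤ}
    {x : Eilh 𝒱} (hx : x ∈ homogeneous 𝒱 m) (y : Eilh 𝒱) :
    D (shuffleMul x y) = shuffleMul (D x) y + paritySign m • shuffleMul x (D y) := by
  have : D ∘ₗ Eilh.shuffleMul x = Eilh.shuffleMul (D x) +
      LinearMap.signSmul (paritySign m) (Eilh.shuffleMul x ∘ₗ D) := by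
    refine ext_ofTree fun b => ?_
    have hb := ofTree_mem_homogeneous (a := b) rfl
    simp only [LinearMap.comp_apply, LinearMap.add_apply, LinearMap.signSmul_apply]
    rw [shuffleMul_eq hx hb, shuffleMul_eq (hD.degree_one m x hx) hb,
      shuffleMul_eq hx (hD.degree_one _ _ hb), map_add, LinearMap.map_units_int_smul,
      hD.leibniz 0 m _ x hx _ hb, hD.leibniz 0 _ m _ hb _ hx, leibnizOp, leibnizOp]
    simp only [Units.smul_def]
    match_scalars <;>
      simp only [paritySign_eq_ite, Int.even_add, Int.even_mul, Nat.cast_zero] <;>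
      by_cases h0 : Even m <;>
      by_cases h1 : Even b.deg <;>
      simp [h0, h1]
  simpa using LinearMap.congr_fun this y

theorem zeroWord_mem_zeroWords {n : ℕ} (d : Fin (n + 1) → ℤ) (v : ∀ i, 𝒱 (d i))
    (σ : Equiv.Perm (Fin (n + 1))) : zeroWord d v σ ∈ zeroWords 𝒱 :=
  Submodule.subset_span ⟨n, fun i => d (σ i), fun i => v (σ i), rfl⟩

end Eilh

namespace ShuffleOne

/-- The extension of a linear map of `ℰ(V)` to `K ⊕ ℰ(V)` that vanishes on `1`. -/
noncomputable def extend (D : Eilh 𝒱 →ₗ[K] Eilh 𝒱) : ShuffleOne 𝒱 →ₗ[K] ShuffleOne 𝒱 :=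
  incl ∘ₗ D ∘ₗ proj

theorem extend_apply (D : Eilh 𝒱 →ₗ[K] Eilh 𝒱) (X : ShuffleOne 𝒱) :
    extend D X = incl (D (proj X)) := rfl

theorem extend_incl (D : Eilh 𝒱 →ₗ[K] Eilh 𝒱) (x : Eilh 𝒱) : extend D (incl x) = incl (D x) := rfl

theorem extend_one (D : Eilh 𝒱 →ₗ[K] Eilh 𝒱) : extend D 1 = 0 := by simp [extend_apply]

theorem extend_incl_mul {D : Eilh 𝒱 →ₗ[K] Eilh 𝒱} (hD : IsDerivation D) {m : ℤ} {x : Eilh 𝒱}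
    (hx : x ∈ homogeneous 𝒱 m) (Y : ShuffleOne 𝒱) :
    extend D (incl x * Y) = incl (D x) * Y + paritySign m • (incl x * extend D Y) := by
  induction Y using ShuffleOne.induction_on with
  | one c => simp [extend_apply]
  | incl y =>
    rw [incl_mul_incl, extend_incl, extend_incl, incl_mul_incl, incl_mul_incl, hD.shuffleMul hx,
      map_add, LinearMap.map_units_int_smul]
  | add X Y hX hY =>
    rw [mul_add, map_add, hX, hY, mul_add, map_add, mul_add, smul_add]
    abel

theorem extend_mul {D : Eilh 𝒱 →ₗ[K] Eilh 𝒱} (hD : IsDerivation D) {m : ℤ} {X : ShuffleOne 𝒱}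
    (hX : IsHomog X m) (Y : ShuffleOne 𝒱) :
    extend D (X * Y) = extend D X * Y + paritySign m • (X * extend D Y) := by
  -- A homogeneous element has a scalar part in degree zero only, where the Leibniz sign is trivial.
  have hs : aug X • extend D Y = paritySign m • (aug X • extend D Y) := by
    rcases hX.2 with h | h
    · simp [h]
    · simp [h, paritySign]
  have hX' : extend D X = incl (D (proj X)) := rfl
  rw [hX']
  conv_lhs => rw [← aug_smul_one_add_incl X]
  conv_rhs => rw [← aug_smul_one_add_incl X]
  simp only [map_add, proj_incl, map_smul, proj_one, smul_zero, zero_add, map_zero]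
  rw [add_mul, map_add, extend_incl_mul hD hX.1, smul_mul_assoc, one_mul, map_smul, add_mul,
    smul_add, smul_mul_assoc, one_mul, ← hs]
  abel

end ShuffleOne

namespace GradedSym

variable [DirectSum.Decomposition 𝒱]

/-- The algebra map from the free graded commutative algebra. -/
noncomputable def toShuffle : GradedSym 𝒱 →ₐ[K] ShuffleOne 𝒱 :=
  liftAlg (fun d => incl ∘ₗ Eilh.genLin d) fun _ _ _ _ =>
    incl_mul_comm (ofTree_mem_homogeneous rfl) (ofTree_mem_homogeneous rfl)

theorem toShuffle_gen {d : ℤ} (v : 𝒱 d) : toShuffle (gen v) = incl (Eilh.gen v) := liftAlg_gen _ _ v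

/-- The symmetrization map. -/
noncomputable def symmetrization : GradedSym 𝒱 →ₗ[K] Eilh 𝒱 := proj ∘ₗ toShuffle.toLinearMap

theorem symmetrization_apply (x : GradedSym 𝒱) : symmetrization x = proj (toShuffle x) := rfl

theorem toShuffle_monomial {n : ℕ} (d : Fin (n + 1) → ℤ) (v : ∀ i, 𝒱 (d i)) :
    toShuffle (monomial d v) =
      incl (∑ σ : Equiv.Perm (Fin (n + 1)), koszulSign σ d • zeroWord d v σ) := by
  have h := prod_incl_ofTree fun i => leaf (d i) (v i)
  rw [monomial, map_list_prod, List.map_ofFn]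
  refine (congrArg List.prod (congrArg List.ofFn (funext fun i => toShuffle_gen (v i)))).trans
    (h.trans ?_)
  rw [map_sum]
  refine sum_congr rfl fun σ _ => ?_
  rw [uword_succ, LinearMap.map_units_int_smul]
  rfl

theorem isSymmetrization : IsSymmetrization (symmetrization : GradedSym 𝒱 →ₗ[K] Eilh 𝒱) := by
  refine ⟨by simp [symmetrization_apply], fun n d v => ?_⟩
  rw [symmetrization_apply, toShuffle_monomial, proj_incl]

/-- The image of the augmentation ideal has no scalar part, so nothing is lost in projecting to
`ℰ(V)`. -/
theorem toShuffle_of_mem_augmentation {x : GradedSym 𝒱} (hx : x ∈ augmentation 𝒱) :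
    toShuffle x = incl (symmetrization x) := by
  refine LinearMap.eqOn_span (f := toShuffle.toLinearMap) (g := incl ∘ₗ symmetrization) ?_ hx
  rintro _ ⟨n, d, v, rfl⟩
  change toShuffle _ = incl (proj (toShuffle _))
  rw [toShuffle_monomial, proj_incl]

/-- Every `x` differs from a scalar by an element of the augmentation ideal, and `aug ∘ toShuffle`
reads off that scalar. -/
theorem mem_augmentation_of_aug {x : GradedSym 𝒱} (hx : aug (toShuffle x) = 0) :
    x ∈ augmentation 𝒱 := by
  have key : x - aug (toShuffle x) • 1 ∈ augmentation 𝒱 := by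
    refine induction_on (p := (augmentation 𝒱).comap
      (LinearMap.id - (aug ∘ₗ toShuffle.toLinearMap).smulRight 1)) (by simp)
      (fun d v x _ => ?_) x
    simp [toShuffle_gen, gen_mul_mem_augmentation]
  simpa [hx] using key

theorem isHomog_toShuffle {m : ℤ} {x : GradedSym 𝒱} (hx : x ∈ homogeneous 𝒱 m) :
    symmetrization x ∈ Eilh.homogeneous 𝒱 m ∧ IsHomog (toShuffle x) m := by
  have key (L : List (Σ d, 𝒱 d)) :
      IsHomog (toShuffle (L.map fun x => gen x.2).prod) (L.map fun x => x.1).sum := by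
    induction L with
    | nil => simpa using isHomog_one
    | cons x L ih =>
      simp only [List.map_cons, List.prod_cons, List.sum_cons, map_mul, toShuffle_gen]
      exact IsHomog.incl_mul (Eilh.gen_mem_homogeneous x.2) ih
  have h1 : symmetrization x ∈ Eilh.homogeneous 𝒱 m := by
    refine homogeneous_induction (p := (Eilh.homogeneous 𝒱 m).comap symmetrization)
      (fun L hL => ?_) hx
    have := (key L).1
    rwa [hL] at this
  refine ⟨h1, h1, ?_⟩
  by_cases hm : m = 0
  · exact Or.inr hm
  left
  refine homogeneous_induction (p := (LinearMap.ker (aug ∘ₗ toShuffle.toLinearMap)))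
    (fun L hL => ?_) hx
  have := (key L).2
  rw [hL] at this
  exact this.resolve_right hm

end GradedSym

end Symmetrization

/-! ### The retraction onto `⨀V` and the image of the symmetrization -/

section Symmetrization

variable {K V : Type*} [Field K] [AddCommGroup V] [Module K V]
variable {𝒱 : ℤ → Submodule K V}

open EilhTree Eilh ShuffleOne

namespace Eilh

theorem units_smul_zero {M : Type*} [AddCommGroup M] (u : ℤˣ) : u • (0 : M) = 0 := smul_zero u

theorem smul_eq_add_units_smul {M : Type*} [AddCommGroup M] [Module K M] (s : ℤˣ) {a b c : K}
    (h : a = b + c) (x : M) : a • x = b • x + s • c • s • x := by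
  rw [smul_comm c s, units_smul_smul_self, h, add_smul]

/-! ### The projection to the free graded commutative algebra -/

/-- The operation that replaces `⊘₀` by a weighted graded commutative product, in such a way that
the shuffle product becomes the graded commutative product, and `⊘ᵢ` for `i > 0` by zero. -/
noncomputable def toSymTree : EilhTree 𝒱 → GradedSym 𝒱
  | leaf _ v => GradedSym.gen v
  | EilhTree.op 0 a b => ((b.len : K) / (a.len + b.len)) • (toSymTree a * toSymTree b)
  | EilhTree.op (_ + 1) _ _ => 0

theorem toSymTree_mem_homogeneous (a : EilhTree 𝒱) :
    toSymTree a ∈ GradedSym.homogeneous 𝒱 a.deg := by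
  induction a with
  | leaf d v => exact GradedSym.gen_mem_homogeneous v
  | op i a b ha hb =>
    rcases i with _ | i
    · have := Submodule.smul_mem _ ((b.len : K) / (a.len + b.len))
        (GradedSym.mul_mem_homogeneous ha hb)
      simpa [toSymTree, deg_op] using this
    · exact zero_mem _

variable [CharZero K]

/-- For lengths `a`, `b`, `c` the relation with all indices `0` becomes `c/(a+b+c) = c/(a+b+c) ·
(b/(a+b) + a/(a+b))`. Characteristic zero makes the lengths invertible. In the other relations every
term contains a positive index. -/
theorem isEilhMap_toSymTree : IsEilhMap (toSymTree : EilhTree 𝒱 → GradedSym 𝒱) where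
  leaf_add d v w := map_add (GradedSym.genLin d) v w
  leaf_smul d c v := map_smul (GradedSym.genLin d) c v
  eq i a b c := by
    rcases i with _ | i
    · have h := GradedSym.mul_comm_of_homogeneous (toSymTree_mem_homogeneous b)
        (toSymTree_mem_homogeneous a)
      have ha : (a.len : K) ≠ 0 := by exact_mod_cast a.len_pos.ne'
      have hab : (a.len + b.len : K) ≠ 0 := by exact_mod_cast (by have := a.len_pos; omega)
      have hba : (b.len + a.len : K) ≠ 0 := by exact_mod_cast (by have := a.len_pos; omega)
      have hbc : (b.len + c.len : K) ≠ 0 := by exact_mod_cast (by have := b.len_pos; omega)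
      have habc : (a.len + b.len + c.len : K) ≠ 0 := by
        exact_mod_cast (by have := a.len_pos; omega)
      have habc' : (a.len + (b.len + c.len) : K) ≠ 0 := by rwa [← add_assoc]
      have hbac : (b.len + a.len + c.len : K) ≠ 0 := by rwa [add_comm (b.len : K)]
      have hs : paritySign ((0 : ℕ) + a.deg * b.deg) = paritySign (b.deg * a.deg) := by
        rw [mul_comm, Nat.cast_zero, zero_add]
      have hs' : paritySign ((0 : ℕ) * (a.deg + 1)) = 1 := by simp [paritySign]
      rw [hs, hs', one_smul]
      generalize paritySign (b.deg * a.deg) = s at h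
      have h2 : toSymTree b * toSymTree a * toSymTree c =
          s • (toSymTree a * toSymTree b * toSymTree c) := by rw [h, smul_mul_assoc]
      simp only [toSymTree, len_op, Nat.cast_add, smul_mul_assoc, mul_smul_comm, ← mul_assoc, h2,
        smul_smul]
      refine smul_eq_add_units_smul s ?_ _
      field_simp
      ring
    · simp [toSymTree, units_smul_zero]
  lt i j h a b c := by
    obtain ⟨j, rfl⟩ : ∃ k, j = k + 1 := ⟨j - 1, by omega⟩
    rcases i with _ | i <;> simp [toSymTree, units_smul_zero]
  gt_one i a b c := by simp [toSymTree, units_smul_zero]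
  gt_two i a b c := by simp [toSymTree, units_smul_zero]
  gt_many i k a b c := by simp [toSymTree, units_smul_zero]
  left i a u := by
    rcases i with _ | i
    · refine ⟨((u.2.1 : K) / (a.len + u.2.1)) • LinearMap.mulLeft K (toSymTree a), 0, ?_⟩
      rintro b rfl
      simp [toSymTree, type]
    · exact ⟨0, 0, fun b _ => by simp [toSymTree, units_smul_zero]⟩
  right i b u := by
    rcases i with _ | i
    · refine ⟨((b.len : K) / (u.2.1 + b.len)) • LinearMap.mulRight K (toSymTree b), 0, ?_⟩
      rintro a rfl
      simp [toSymTree, type]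
    · exact ⟨0, 0, fun a _ => by simp [toSymTree, units_smul_zero]⟩

/-- The linear extension of `toSymTree` to `ℰ(V)`. -/
noncomputable def toSym : Eilh 𝒱 →ₗ[K] GradedSym 𝒱 := lift _ isEilhMap_toSymTree

theorem toSym_ofTree (a : EilhTree 𝒱) : toSym (ofTree a) = toSymTree a := lift_ofTree _ _ _

theorem toSym_gen {d : ℤ} (v : 𝒱 d) : toSym (gen v) = GradedSym.gen v := toSym_ofTree _

theorem toSym_mem_homogeneous {m : ℤ} {x : Eilh 𝒱} (hx : x ∈ homogeneous 𝒱 m) :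
    toSym x ∈ GradedSym.homogeneous 𝒱 m := by
  have : homogeneous 𝒱 m ≤ (GradedSym.homogeneous 𝒱 m).comap toSym := by
    refine Submodule.span_le.2 ?_
    rintro _ ⟨a, rfl, rfl⟩
    change toSym (ofTree a) ∈ GradedSym.homogeneous 𝒱 _
    rw [toSym_ofTree]
    exact toSymTree_mem_homogeneous a
  exact this hx

/-- The two halves of the shuffle product contribute the weights `b/(a+b)` and `a/(a+b)`, which add
up to one. -/
theorem toSym_shuffleMul (x y : Eilh 𝒱) : toSym (shuffleMul x y) = toSym x * toSym y := by
  have : shuffleMul.compr₂ toSym = ((LinearMap.mul K (GradedSym 𝒱)).comp toSym).compl₂ toSym := by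
    refine ext_ofTree fun a => ext_ofTree fun b => ?_
    change toSym (shuffleMul (ofTree a) (ofTree b)) = toSym (ofTree a) * toSym (ofTree b)
    have h := GradedSym.mul_comm_of_homogeneous (toSymTree_mem_homogeneous b)
      (toSymTree_mem_homogeneous a)
    have hab : (a.len + b.len : K) ≠ 0 := by exact_mod_cast (by have := a.len_pos; omega)
    rw [shuffleMul_ofTree, op_ofTree, op_ofTree, map_add, LinearMap.map_units_int_smul,
      toSym_ofTree, toSym_ofTree, toSym_ofTree, toSym_ofTree, toSymTree, toSymTree, h,
      smul_comm _ (paritySign _), mul_comm b.deg, units_smul_smul_self, ← add_smul,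
      add_comm (b.len : K), ← add_div, add_comm (b.len : K), div_self hab, one_smul]
  exact LinearMap.congr_fun (LinearMap.congr_fun this x) y

end Eilh

namespace ShuffleOne

variable [CharZero K]

/-- The algebra map to the free graded commutative algebra. -/
noncomputable def toSym : ShuffleOne 𝒱 →ₐ[K] GradedSym 𝒱 :=
  Unitization.lift (R := K) (A := Shuffle 𝒱) (C := GradedSym 𝒱)
    { toFun := fun x => Eilh.toSym x
      map_smul' := fun c x => map_smul Eilh.toSym c x
      map_zero' := map_zero Eilh.toSym
      map_add' := fun x y => map_add Eilh.toSym x y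
      map_mul' := fun x y => toSym_shuffleMul x y }

theorem toSym_incl (x : Eilh 𝒱) : toSym (incl x) = Eilh.toSym x := by
  change algebraMap K _ (aug (incl x)) + Eilh.toSym (proj (incl x)) = _
  simp

variable [DirectSum.Decomposition 𝒱]

/-- Both maps are multiplicative and fix the generators. -/
theorem toSym_toShuffle (x : GradedSym 𝒱) : toSym (GradedSym.toShuffle x) = x := by
  have : toSym.toLinearMap ∘ₗ GradedSym.toShuffle.toLinearMap =
      (LinearMap.id : GradedSym 𝒱 →ₗ[K] GradedSym 𝒱) := by
    refine GradedSym.hom_ext (by simp) fun d v x hx => ?_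
    simp only [LinearMap.comp_apply, AlgHom.toLinearMap_apply, LinearMap.id_apply] at hx ⊢
    rw [map_mul, map_mul, hx, GradedSym.toShuffle_gen, toSym_incl, toSym_gen]
  exact LinearMap.congr_fun this x

theorem toShuffle_injective :
    Function.Injective (GradedSym.toShuffle : GradedSym 𝒱 → ShuffleOne 𝒱) :=
  Function.LeftInverse.injective toSym_toShuffle

end ShuffleOne

namespace Eilh

theorem coeff_zeroWord_of_ne {n N : ℕ} (h : n ≠ N) (f : ℕ → ∀ d, 𝒱 d →ₗ[K] K)
    (d : Fin (n + 1) → ℤ) (v : ∀ i, 𝒱 (d i)) (σ : Equiv.Perm (Fin (n + 1))) :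
    coeff f (N + 1) (incl (zeroWord d v σ)) = 0 := by
  rw [zeroWord, ← uword_succ]
  refine (coeff_uword f (fun l => v (σ (Fin.ofNat (n + 1) l))) (N + 1) (n + 1)).trans ?_
  simp [h]

theorem coeff_zeroWord {n : ℕ} (f : Fin (n + 1) → ∀ d, 𝒱 d →ₗ[K] K)
    (d : Fin (n + 1) → ℤ) (v : ∀ i, 𝒱 (d i)) (τ σ : Equiv.Perm (Fin (n + 1))) :
    coeff (permSeq f τ) (n + 1) (incl (zeroWord d v σ)) = ∏ i, f (τ i) (d (σ i)) (v (σ i)) := by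
  rw [zeroWord, ← uword_succ]
  refine (coeff_uword _ (fun l => v (σ (Fin.ofNat (n + 1) l))) (n + 1) (n + 1)).trans ?_
  rw [if_pos rfl, ← Fin.prod_univ_eq_prod_range (fun l => permSeq f τ l
    (d (σ (Fin.ofNat (n + 1) l))) (v (σ (Fin.ofNat (n + 1) l))))]
  refine prod_congr rfl fun i _ => ?_
  rw [permSeq_apply]
  change (fun j => f (τ i) (d (σ j)) (v (σ j))) (Fin.ofNat (n + 1) i) = _
  rw [Fin.ofNat_val_eq_self]

variable [CharZero K]

/-- Appending one letter to a word of length `n + 1` contributes the weight `1/(n + 2)`. -/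
theorem toSymTree_word (n : ℕ) (d : ℕ → ℤ) (v : ∀ l, 𝒱 (d l)) :
    toSymTree (word n 0 fun l => leaf (d l) (v l)) =
      ((n + 1).factorial : K)⁻¹ • GradedSym.monomial (fun i : Fin (n + 1) => d i) fun i => v i := by
  have hl (n : ℕ) : (word n 0 fun l => leaf (d l) (v l) : EilhTree 𝒱).len = n + 1 := by
    induction n with
    | zero => rfl
    | succ n ih => rw [word, len_op]; exact congrArg (· + 1) ih
  induction n with
  | zero => simp [word, toSymTree, GradedSym.monomial]
  | succ n ih =>
    rw [word, Pi.zero_apply, toSymTree]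
    have h0 : (fun j : Fin n => (0 : Fin (n + 1) → ℕ) j.castSucc) = 0 := rfl
    have h1 : (n + 1 + 1 : K) ≠ 0 := by exact_mod_cast Nat.succ_ne_zero (n + 1)
    rw [h0, hl, len_leaf, ih, toSymTree, smul_mul_assoc, smul_smul, Nat.factorial_succ (n + 1)]
    congr 1
    · push_cast
      field_simp
    · rw [GradedSym.monomial, GradedSym.monomial, List.ofFn_succ' (n := n + 1),
        List.concat_eq_append, List.prod_append]
      simp

theorem toSym_zeroWord_one {n : ℕ} (d : Fin (n + 1) → ℤ) (v : ∀ i, 𝒱 (d i)) :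
    toSym (zeroWord d v 1) = ((n + 1).factorial : K)⁻¹ • GradedSym.monomial d v := by
  refine (toSym_ofTree _).trans ((toSymTree_word n (fun l => d (Fin.ofNat (n + 1) l))
    fun l => v (Fin.ofNat (n + 1) l)).trans ?_)
  refine congrArg _ (congrArg List.prod (congrArg List.ofFn (funext fun i => ?_)))
  change (fun i => GradedSym.gen (v i)) (Fin.ofNat (n + 1) i) = _
  rw [Fin.ofNat_val_eq_self]

variable [DirectSum.Decomposition 𝒱]

theorem toSym_mem_augmentation (x : Eilh 𝒱) : toSym x ∈ GradedSym.augmentation 𝒱 := by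
  refine GradedSym.mem_augmentation_of_aug ?_
  have : aug ∘ₗ GradedSym.toShuffle.toLinearMap ∘ₗ toSym = (0 : Eilh 𝒱 →ₗ[K] K) := by
    refine ext_ofTree fun a => ?_
    simp only [LinearMap.comp_apply, AlgHom.toLinearMap_apply, toSym_ofTree, LinearMap.zero_apply]
    induction a with
    | leaf d v => rw [toSymTree, GradedSym.toShuffle_gen, aug_incl]
    | op i a b ha hb =>
      rcases i with _ | i
      · rw [toSymTree, map_smul, map_smul, map_mul, aug_mul, ha, zero_mul, smul_zero]
      · simp [toSymTree, units_smul_zero]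
  exact LinearMap.congr_fun this x

/-- The composite replaces a word by the average of all its signed permutations; moving the
permutations from the letters to the forms turns this into an average of coefficients of `z`. -/
theorem coeff_symmetrization_toSym {n : ℕ} {f : Fin (n + 1) → ∀ d, 𝒱 d →ₗ[K] K}
    {e : Fin (n + 1) → ℤ} (hf : ∀ l d, d ≠ e l → f l d = 0) {z : Eilh 𝒱} (hz : z ∈ zeroWords 𝒱) :
    coeff (permSeq f 1) (n + 1) (incl (GradedSym.symmetrization (toSym z))) =
      ((n + 1).factorial : K)⁻¹ • ∑ σ : Equiv.Perm (Fin (n + 1)),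
        koszulSign σ (fun i => e (σ⁻¹ i)) • coeff (permSeq f σ⁻¹) (n + 1) (incl z) := by
  have key := LinearMap.eqOn_span 
    (s := {x | ∃ (n : ℕ) (d : Fin (n + 1) → ℤ) (v : ∀ i, 𝒱 (d i)), x = zeroWord d v 1})
    (f := coeff (permSeq f 1) (n + 1) ∘ₗ incl ∘ₗ GradedSym.symmetrization ∘ₗ toSym)
    (g := ((n + 1).factorial : K)⁻¹ • ∑ σ : Equiv.Perm (Fin (n + 1)), LinearMap.signSmul
      (koszulSign σ (fun i => e (σ⁻¹ i))) (coeff (permSeq f σ⁻¹) (n + 1) ∘ₗ incl)) ?_ hz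
  · simpa [LinearMap.sum_apply] using key
  rintro _ ⟨m, d, v, rfl⟩
  simp only [LinearMap.comp_apply, LinearMap.smul_apply, LinearMap.sum_apply,
    LinearMap.signSmul_apply]
  rw [toSym_zeroWord_one, map_smul, map_smul, map_smul, GradedSym.isSymmetrization.2, map_sum,
    map_sum]
  simp only [LinearMap.map_units_int_smul]
  by_cases hm : m = n
  · subst hm
    congr 1
    refine sum_congr rfl fun σ _ => ?_
    have h1 : ∏ i, f (σ⁻¹ i) (d i) (v i) = ∏ i, f i (d (σ i)) (v (σ i)) := by
      rw [← Equiv.prod_comp σ]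
      simp
    refine Eq.trans (congrArg _ (coeff_zeroWord f d v 1 σ))
      (Eq.trans ?_ (congrArg _ ((coeff_zeroWord f d v σ⁻¹ 1).trans h1)).symm)
    simp only [Equiv.Perm.one_apply]
    -- On the left the Koszul sign refers to the letters, on the right to the forms. If some degrees
    -- do not match, both coefficients vanish; otherwise `d` is `e ∘ σ⁻¹`.
    by_cases h : ∃ i, d (σ i) ≠ e i
    · obtain ⟨i, hi⟩ := h
      rw [prod_eq_zero (mem_univ i) (by rw [hf i _ hi]; rfl), smul_zero, smul_zero]
    · push Not at h
      have : d = fun i => e (σ⁻¹ i) := by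
        funext i
        rw [← h]
        simp
      rw [← this]
  · simp [coeff_zeroWord_of_ne hm]

/-- By `coeff_perm` all `(n+1)!` signed summands of the average equal the original coefficient, so
both sides have the same coefficients and hence agree. -/
theorem symmetrization_toSym {z : Eilh 𝒱} (hz : z ∈ zeroWords 𝒱) (h : der₀ z = 0) :
    GradedSym.symmetrization (toSym z) = z := by
  rw [← sub_eq_zero]
  have hS : GradedSym.symmetrization (toSym z) ∈ zeroWords 𝒱 := by
    have : zeroWords 𝒱 ≤ (zeroWords 𝒱).comap (GradedSym.symmetrization ∘ₗ toSym) := by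
      refine Submodule.span_le.2 ?_
      rintro _ ⟨n, d, v, rfl⟩
      change GradedSym.symmetrization (toSym _) ∈ zeroWords 𝒱
      rw [toSym_zeroWord_one, map_smul, GradedSym.isSymmetrization.2]
      exact Submodule.smul_mem _ _ (sum_mem fun σ _ =>
        Submodule.units_int_smul_mem _ _ (zeroWord_mem_zeroWords d v σ))
    exact this hz
  refine eq_zero_of_coeff_eq_zero (sub_mem (zeroWords_le_zeroSpan hS) (zeroWords_le_zeroSpan hz))
    fun N f e hf => ?_
  rw [map_sub, map_sub, sub_eq_zero, coeff_symmetrization_toSym hf hz]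
  rw [sum_congr rfl fun σ _ => by
    rw [coeff_perm hf (zeroWords_le_zeroSpan hz) h σ⁻¹, koszulSign_inv, units_smul_smul_self]]
  simp only [sum_const, card_univ, Fintype.card_perm,
    Fintype.card_fin]
  rw [← Nat.cast_smul_eq_nsmul K, smul_smul, inv_mul_cancel₀, one_smul]
  exact_mod_cast Nat.factorial_ne_zero _

end Eilh

end Symmetrization

/-! ### The correspondence of differentials -/

section Differentials

variable {K V : Type*} [Field K] [AddCommGroup V] [Module K V]
variable {𝒱 : ℤ → Submodule K V}

open EilhTree Eilh ShuffleOne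

namespace Eilh

/-- The span of the monomials of weight `n`. -/
noncomputable def wtSpan (𝒱 : ℤ → Submodule K V) (n : ℕ) : Submodule K (Eilh 𝒱) :=
  Submodule.span K {x | ∃ a : EilhTree 𝒱, a.wt = n ∧ x = ofTree a}

theorem ofTree_mem_wtSpan {a : EilhTree 𝒱} {n : ℕ} (h : a.wt = n) : ofTree a ∈ wtSpan 𝒱 n :=
  Submodule.subset_span ⟨a, h, rfl⟩

theorem op_mem_wtSpan {i m k n : ℕ} (h : m + k + i = n) {x y : Eilh 𝒱} (hx : x ∈ wtSpan 𝒱 m)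
    (hy : y ∈ wtSpan 𝒱 k) : op i x y ∈ wtSpan 𝒱 n := by
  have : wtSpan 𝒱 m ≤ (wtSpan 𝒱 n).comap ((op i).flip y) := by
    refine Submodule.span_le.2 ?_
    rintro _ ⟨a, ha, rfl⟩
    have : wtSpan 𝒱 k ≤ (wtSpan 𝒱 n).comap (op i (ofTree a)) := by
      refine Submodule.span_le.2 ?_
      rintro _ ⟨b, hb, rfl⟩
      change op i (ofTree a) (ofTree b) ∈ wtSpan 𝒱 n
      rw [op_ofTree]
      exact ofTree_mem_wtSpan (by rw [wt_op, ha, hb, h])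
    exact this hy
  exact this hx

theorem zeroSpan_le_wtSpan : zeroSpan 𝒱 ≤ wtSpan 𝒱 0 := by
  refine Submodule.span_le.2 ?_
  rintro _ ⟨a, ha, rfl⟩
  exact ofTree_mem_wtSpan ha.wt_eq_zero

theorem IsDerivation.ofTree_op {D : Eilh 𝒱 →ₗ[K] Eilh 𝒱} (hD : IsDerivation D) (i : ℕ)
    (a b : EilhTree 𝒱) : D (ofTree (EilhTree.op i a b)) =
      leibnizOp i a.deg b.deg (ofTree a) (D (ofTree a)) (ofTree b) (D (ofTree b)) := by
  rw [← op_ofTree]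
  exact hD.leibniz i _ _ _ (ofTree_mem_homogeneous rfl) _ (ofTree_mem_homogeneous rfl)

theorem der₀_mem_wtSpan (a : EilhTree 𝒱) : der₀ (ofTree a) ∈ wtSpan 𝒱 (a.wt + 1) := by
  induction a with
  | leaf d v =>
    change der₀ (gen v) ∈ _
    rw [der₀_gen]
    exact zero_mem _
  | op i a b ha hb =>
    have ha' := ofTree_mem_wtSpan (a := a) rfl
    have hb' := ofTree_mem_wtSpan (a := b) rfl
    rw [isDerivation_der₀.ofTree_op, wt_op, leibnizOp]
    refine sub_mem (add_mem ?_ ?_) ?_ <;> refine Submodule.units_int_smul_mem _ _ ?_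
    · refine add_mem ?_ (Submodule.units_int_smul_mem _ _ ?_)
      · exact op_mem_wtSpan (by ring) ha hb'
      · exact op_mem_wtSpan (by ring) ha' hb
    · exact op_mem_wtSpan (by ring) ha' hb'
    · exact op_mem_wtSpan (by ring) hb' ha'

/-- In `D - der₀` the deformation terms cancel, leaving an undeformed Leibniz rule for `⊘₀`, which
keeps weight zero. -/
theorem IsDerivation.sub_der₀_mem_wtSpan {D : Eilh 𝒱 →ₗ[K] Eilh 𝒱} (hD : IsDerivation D)
    (h : ∀ (d : ℤ) (v : 𝒱 d), D (gen v) ∈ wtSpan 𝒱 0) {a : EilhTree 𝒱} (ha : a.wt = 0) :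
    D (ofTree a) - der₀ (ofTree a) ∈ wtSpan 𝒱 0 := by
  induction a with
  | leaf d v =>
    change D (gen v) - der₀ (gen v) ∈ _
    rw [der₀_gen, sub_zero]
    exact h d v
  | op i a b iha ihb =>
    rw [wt_op] at ha
    obtain ⟨ha0, hb0, rfl⟩ : a.wt = 0 ∧ b.wt = 0 ∧ i = 0 := by omega
    have key : D (ofTree (EilhTree.op 0 a b)) - der₀ (ofTree (EilhTree.op 0 a b)) =
        op 0 (D (ofTree a) - der₀ (ofTree a)) (ofTree b) +
          paritySign a.deg • op 0 (ofTree a) (D (ofTree b) - der₀ (ofTree b)) := by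
      rw [isDerivation_der₀.ofTree_op, hD.ofTree_op, leibnizOp, leibnizOp, op_sub_left,
        op_sub_right, smul_sub]
      simp only [paritySign, Nat.cast_zero, Int.negOnePow_zero, one_smul]
      abel
    rw [key]
    have h1 := ofTree_mem_wtSpan ha0
    have h2 := ofTree_mem_wtSpan hb0
    refine Submodule.add_mem _ ?_ (Submodule.units_int_smul_mem _ _ ?_)
    · exact op_mem_wtSpan (m := 0) (k := 0) (by rfl) (iha ha0) h2
    · exact op_mem_wtSpan (m := 0) (k := 0) (by rfl) h1 (ihb hb0)

/-- On weight zero, `D` is the sum of a part of weight zero and the part `der₀` of weight one. The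
vanishing of `D z` is tested by projecting onto weight one. -/
theorem IsDerivation.der₀_eq_zero {D : Eilh 𝒱 →ₗ[K] Eilh 𝒱} (hD : IsDerivation D)
    (h : ∀ (d : ℤ) (v : 𝒱 d), D (gen v) ∈ wtSpan 𝒱 0) {z : Eilh 𝒱} (hz : z ∈ wtSpan 𝒱 0)
    (hDz : D z = 0) : der₀ z = 0 := by
  set π : Eilh 𝒱 →ₗ[K] Eilh 𝒱 := scale fun u => if u.2.2 = 1 then 1 else 0 with hπ
  have h0 : ∀ x ∈ wtSpan 𝒱 0, π x = 0 := fun x hx => by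
    have : wtSpan 𝒱 0 ≤ LinearMap.ker π := by
      refine Submodule.span_le.2 ?_
      rintro _ ⟨a, ha, rfl⟩
      simp [hπ, scale_ofTree, type, ha]
    exact this hx
  have h1 : ∀ x ∈ wtSpan 𝒱 1, π x = x := fun x hx => by
    have : wtSpan 𝒱 1 ≤ LinearMap.eqLocus π LinearMap.id := by
      refine Submodule.span_le.2 ?_
      rintro _ ⟨a, ha, rfl⟩
      simp [hπ, scale_ofTree, type, ha]
    exact this hx
  have h2 : wtSpan 𝒱 0 ≤ (wtSpan 𝒱 0).comap (D - der₀) := by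
    refine Submodule.span_le.2 ?_
    rintro _ ⟨a, ha, rfl⟩
    exact hD.sub_der₀_mem_wtSpan h ha
  have h3 : wtSpan 𝒱 0 ≤ (wtSpan 𝒱 1).comap der₀ := by
    refine Submodule.span_le.2 ?_
    rintro _ ⟨a, ha, rfl⟩
    have := der₀_mem_wtSpan a
    rwa [ha] at this
  have h4 := h0 _ (h2 hz)
  rw [LinearMap.sub_apply, hDz, zero_sub, map_neg, neg_eq_zero, h1 _ (h3 hz)] at h4
  exact h4

end Eilh

theorem EilhDifferential.isDerivation (D : EilhDifferential 𝒱) : IsDerivation D.Q :=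
  ⟨D.degree_one, D.leibniz⟩

theorem EilhDifferential.ext {D D' : EilhDifferential 𝒱}
    (h : ∀ (d : ℤ) (v : 𝒱 d), D.Q (Eilh.gen v) = D'.Q (Eilh.gen v)) : D = D' := by
  have := D.isDerivation.ext D'.isDerivation h
  cases D
  cases D'
  cases this
  rfl

section Correspondence

variable [DirectSum.Decomposition 𝒱]

theorem symmetrization_mem_zeroWords {x : GradedSym 𝒱} (hx : x ∈ GradedSym.augmentation 𝒱) :
    GradedSym.symmetrization x ∈ zeroWords 𝒱 := by
  have : GradedSym.augmentation 𝒱 ≤ (zeroWords 𝒱).comap GradedSym.symmetrization := by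
    refine Submodule.span_le.2 ?_
    rintro _ ⟨n, d, v, rfl⟩
    change GradedSym.symmetrization _ ∈ zeroWords 𝒱
    rw [GradedSym.isSymmetrization.2]
    exact sum_mem fun σ _ => Submodule.units_int_smul_mem _ _ (zeroWord_mem_zeroWords d v σ)
  exact this hx

theorem GradedSymDifferential.ext {D D' : GradedSymDifferential 𝒱}
    (h : ∀ (d : ℤ) (v : 𝒱 d), D.Q (GradedSym.gen v) = D'.Q (GradedSym.gen v)) : D = D' := by
  have h1 (D : GradedSymDifferential 𝒱) : D.Q 1 = 0 := by
    have := D.leibniz 0 1 (by simpa using GradedSym.prod_mem_homogeneous []) 1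
    simpa [paritySign] using this
  have : D.Q = D'.Q := by
    refine GradedSym.hom_ext (by rw [h1, h1]) fun d v x hx => ?_
    rw [D.leibniz d _ (GradedSym.gen_mem_homogeneous v),
      D'.leibniz d _ (GradedSym.gen_mem_homogeneous v), h, hx]
  cases D
  cases D'
  cases this
  rfl

/-- Both composites vanish on `1`, satisfy the same Leibniz rule along `toShuffle`, and agree on
generators. -/
theorem GradedSymDifferential.extend_toShuffle (D : GradedSymDifferential 𝒱)
    {D' : Eilh 𝒱 →ₗ[K] Eilh 𝒱} (hD' : IsDerivation D')
    (h : ∀ (d : ℤ) (v : 𝒱 d), D' (Eilh.gen v) = GradedSym.symmetrization (D.Q (GradedSym.gen v)))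
    (x : GradedSym 𝒱) : extend D' (GradedSym.toShuffle x) = GradedSym.toShuffle (D.Q x) := by
  have h1 : D.Q 1 = 0 := by
    have := D.leibniz 0 1 (by simpa using GradedSym.prod_mem_homogeneous []) 1
    simpa [paritySign] using this
  have : extend D' ∘ₗ GradedSym.toShuffle.toLinearMap = GradedSym.toShuffle.toLinearMap ∘ₗ D.Q := by
    refine GradedSym.hom_ext (by simp [h1, extend_one]) fun d v x hx => ?_
    simp only [LinearMap.comp_apply] at hx ⊢
    rw [D.leibniz d _ (GradedSym.gen_mem_homogeneous v), map_add, LinearMap.map_units_int_smul,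
      AlgHom.toLinearMap_apply, AlgHom.toLinearMap_apply, AlgHom.toLinearMap_apply,
      map_mul GradedSym.toShuffle, map_mul GradedSym.toShuffle, map_mul GradedSym.toShuffle,
      GradedSym.toShuffle_gen, extend_incl_mul hD' (Eilh.gen_mem_homogeneous v),
      h, ← GradedSym.toShuffle_of_mem_augmentation (D.uncurved d v)]
    rw [AlgHom.toLinearMap_apply] at hx
    rw [hx]
    rfl
  exact LinearMap.congr_fun this x

variable [CharZero K]

/-- The differential on the free graded commutative algebra that belongs to a differential on
`ℰ(V)`. -/
noncomputable def Eilh.symMap (D : Eilh 𝒱 →ₗ[K] Eilh 𝒱) : GradedSym 𝒱 →ₗ[K] GradedSym 𝒱 :=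
  ShuffleOne.toSym.toLinearMap ∘ₗ extend D ∘ₗ GradedSym.toShuffle.toLinearMap

theorem Eilh.symMap_apply (D : Eilh 𝒱 →ₗ[K] Eilh 𝒱) (x : GradedSym 𝒱) :
    symMap D x = ShuffleOne.toSym (extend D (GradedSym.toShuffle x)) := rfl

variable {D : Eilh 𝒱 →ₗ[K] Eilh 𝒱}

/-- The hypothesis places `D (gen v)` in the range of `toShuffle`. By the Leibniz rule the whole
range is then stable under `extend D`, and on the range `toSym` inverts `toShuffle`. -/
theorem Eilh.IsDerivation.toShuffle_symMap (hD : IsDerivation D)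
    (h : ∀ (d : ℤ) (v : 𝒱 d), incl (D (gen v)) = GradedSym.toShuffle (Eilh.toSym (D (gen v))))
    (x : GradedSym 𝒱) :
    GradedSym.toShuffle (symMap D x) = extend D (GradedSym.toShuffle x) := by
  obtain ⟨y, hy⟩ : ∃ y, GradedSym.toShuffle y = extend D (GradedSym.toShuffle x) := by
    refine GradedSym.induction_on (p := (LinearMap.range GradedSym.toShuffle.toLinearMap).comap
      (extend D ∘ₗ GradedSym.toShuffle.toLinearMap)) ⟨0, ?_⟩ ?_ x
    · simp [extend_one]
    · rintro d v x ⟨y, hy⟩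
      simp only [AlgHom.toLinearMap_apply, LinearMap.comp_apply] at hy
      rw [Submodule.mem_comap, LinearMap.comp_apply, AlgHom.toLinearMap_apply, map_mul,
        GradedSym.toShuffle_gen, extend_incl_mul hD (Eilh.gen_mem_homogeneous v), ← hy, h]
      refine ⟨Eilh.toSym (D (gen v)) * x + paritySign d • (GradedSym.gen v * y), ?_⟩
      rw [LinearMap.map_add, LinearMap.map_units_int_smul]
      simp [GradedSym.toShuffle_gen]
  rw [symMap_apply, ← hy, toSym_toShuffle]

/-- The differential on the free graded commutative algebra that belongs to a differential on
`ℰ(V)` with values in `⊘₀^• V` on `V`. -/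
noncomputable def EilhDifferential.toGradedSym (D : EilhDifferential 𝒱)
    (h : ∀ (d : ℤ) (v : 𝒱 d),
      incl (D.Q (Eilh.gen v)) = GradedSym.toShuffle (Eilh.toSym (D.Q (Eilh.gen v)))) :
    GradedSymDifferential 𝒱 where
  Q := symMap D.Q
  degree_one m a ha := by
    rw [symMap_apply, extend_apply, toSym_incl]
    exact toSym_mem_homogeneous (D.degree_one m _ (GradedSym.isHomog_toShuffle ha).1)
  leibniz m a ha b := by
    apply toShuffle_injective
    rw [D.isDerivation.toShuffle_symMap h, map_mul, extend_mul D.isDerivation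
      (GradedSym.isHomog_toShuffle ha).2, map_add, ← AlgHom.toLinearMap_apply _ (_ • _),
      LinearMap.map_units_int_smul, AlgHom.toLinearMap_apply, map_mul, map_mul,
      D.isDerivation.toShuffle_symMap h, D.isDerivation.toShuffle_symMap h]
  square_zero a := by
    apply toShuffle_injective
    rw [D.isDerivation.toShuffle_symMap h, D.isDerivation.toShuffle_symMap h, extend_apply,
      extend_apply, proj_incl, D.square_zero, map_zero, map_zero]
  uncurved d v := by
    rw [symMap_apply, extend_apply, toSym_incl]
    exact toSym_mem_augmentation _

theorem exists_equiv_gradedSymDifferential (𝒱 : ℤ → Submodule K V) [DirectSum.Decomposition 𝒱] :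
    ∃ Ψ : {D : EilhDifferential 𝒱 // ∀ (d : ℤ) (v : 𝒱 d), D.Q (Eilh.gen v) ∈ Eilh.zeroWords 𝒱} ≃
        GradedSymDifferential 𝒱,
      ∀ (D : {D : EilhDifferential 𝒱 //
            ∀ (d : ℤ) (v : 𝒱 d), D.Q (Eilh.gen v) ∈ Eilh.zeroWords 𝒱}) (d : ℤ) (v : 𝒱 d),
        D.1.Q (Eilh.gen v) = GradedSym.symmetrization ((Ψ D).Q (GradedSym.gen v)) := by
  -- Here `Q² = 0` on generators is used: its weight-one part forces `der₀ (Q v) = 0`, so `Q v` is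
  -- symmetric.
  have key (D : {D : EilhDifferential 𝒱 //
      ∀ (d : ℤ) (v : 𝒱 d), D.Q (Eilh.gen v) ∈ Eilh.zeroWords 𝒱}) (d : ℤ) (v : 𝒱 d) :
      GradedSym.symmetrization (Eilh.toSym (D.1.Q (Eilh.gen v))) = D.1.Q (Eilh.gen v) := by
    have h d v := zeroSpan_le_wtSpan (zeroWords_le_zeroSpan (D.2 d v))
    exact symmetrization_toSym (D.2 d v)
      (D.1.isDerivation.der₀_eq_zero h (h d v) (D.1.square_zero _))
  have key' (D) (d : ℤ) (v : 𝒱 d) := (congrArg incl (key D d v)).symm.trans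
    (GradedSym.toShuffle_of_mem_augmentation (toSym_mem_augmentation (D.1.Q (gen v)))).symm
  set Ψ : {D : EilhDifferential 𝒱 // ∀ (d : ℤ) (v : 𝒱 d), D.Q (Eilh.gen v) ∈ Eilh.zeroWords 𝒱} →
      GradedSymDifferential 𝒱 := fun D => D.1.toGradedSym (key' D) with hΨ
  have spec (D) (d : ℤ) (v : 𝒱 d) :
      D.1.Q (Eilh.gen v) = GradedSym.symmetrization ((Ψ D).Q (GradedSym.gen v)) := by
    change _ = GradedSym.symmetrization (symMap D.1.Q (GradedSym.gen v))
    rw [symMap_apply, GradedSym.toShuffle_gen, extend_incl, toSym_incl, key]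
  refine ⟨Equiv.ofBijective Ψ ⟨fun D D' h => Subtype.ext (EilhDifferential.ext fun d v => ?_),
    fun D => ?_⟩, spec⟩
  · rw [spec, spec, h]
  · set f : ∀ d, 𝒱 d →ₗ[K] Eilh 𝒱 := fun d =>
      GradedSym.symmetrization ∘ₗ D.Q ∘ₗ GradedSym.genLin d with hf
    have hf' (d : ℤ) (v : 𝒱 d) : f d v ∈ Eilh.homogeneous 𝒱 (d + 1) :=
      (GradedSym.isHomog_toShuffle (D.degree_one d _ (GradedSym.gen_mem_homogeneous v))).1
    have hD' := isDerivation_der hf'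
    have hgen (d : ℤ) (v : 𝒱 d) :
        der f hf' (gen v) = GradedSym.symmetrization (D.Q (GradedSym.gen v)) := der_gen hf' v
    -- The square on a generator is the image under `toShuffle` of the square on `⨀V`.
    have h2 (d : ℤ) (v : 𝒱 d) : der f hf' (der f hf' (gen v)) = 0 := by
      apply incl_injective
      have h3 := D.extend_toShuffle hD' hgen
      rw [map_zero, ← extend_incl, ← extend_incl, ← GradedSym.toShuffle_gen, h3, h3, D.square_zero,
        map_zero]
    refine ⟨⟨⟨der f hf', hD'.degree_one, hD'.leibniz, fun a => hD'.square_zero h2 a⟩,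
      fun d v => ?_⟩, GradedSymDifferential.ext fun d v => ?_⟩
    · rw [hgen]
      exact symmetrization_mem_zeroWords (D.uncurved d v)
    · apply toShuffle_injective
      rw [GradedSym.toShuffle_of_mem_augmentation (D.uncurved d v), ← hgen]
      rw [GradedSym.toShuffle_of_mem_augmentation (GradedSymDifferential.uncurved _ d v), ← spec]

end Correspondence

end Differentials

theorem paritySign_sum {ι : Type*} (s : Finset ι) (f : ι → ℤ) :
    paritySign (∑ i ∈ s, f i) = ∏ i ∈ s, paritySign (f i) := by
  classical
  induction s using Finset.induction_on with
  | empty => simp [paritySign]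
  | insert a s ha ih => rw [sum_insert ha, prod_insert ha, paritySign_add, ih]

/-! ### Products of two words -/

section Shuffles

variable {K V : Type*} [Field K] [AddCommGroup V] [Module K V]
variable {𝒱 : ℤ → Submodule K V}

namespace ShuffleOne

open EilhTree Eilh

theorem half_units_smul (u : ℤˣ) (X : ShuffleOne 𝒱) (a : Eilh 𝒱) :
    half (u • X) a = u • half X a := LinearMap.map_units_int_smul (halfLin a) u X

theorem incl_mul_comm_of_isHomog {x : Eilh 𝒱} {Y : ShuffleOne 𝒱} {p q : ℤ}
    (hx : x ∈ homogeneous 𝒱 p) (hY : IsHomog Y q) :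
    incl x * Y = paritySign (p * q) • (Y * incl x) := by
  rw [← aug_smul_one_add_incl Y, mul_add, add_mul, incl_mul_comm hx hY.1, smul_add]
  congr 1
  rcases hY.2 with h | rfl
  · simp [h]
  · simp [paritySign]

theorem uword_mul_comm (a b : ℕ) (S S' : ℕ → EilhTree 𝒱) :
    uword a S * uword b S' = paritySign ((∑ i ∈ range a, (S i).deg) *
      ∑ j ∈ range b, (S' j).deg) • (uword b S' * uword a S) := by
  rcases a with _ | a
  · simp [uword, paritySign]
  rcases b with _ | b
  · simp [uword, paritySign]
  exact incl_mul_comm (isHomog_uword (a + 1) S).1 (isHomog_uword (b + 1) S').1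

theorem lastDer_proj_uword (f : ∀ d, 𝒱 d →ₗ[K] K) (n : ℕ) (d : ℕ → ℤ) (v : ∀ l, 𝒱 (d l)) :
    lastDer f (proj (uword (n + 1) fun l => leaf (d l) (v l))) =
      f (d n) (v n) • uword n fun l => leaf (d l) (v l) := by
  rw [uword_add_one, proj_incl]
  exact lastDer_half_gen f _ (v n)

/-- The last letter of a shuffle of two words is the last letter of one of them; if it comes from
the first word, it moves past the whole second word and picks up the sign. -/
theorem lastDer_proj_uword_mul_uword (f : ∀ d, 𝒱 d →ₗ[K] K) (a b : ℕ) (d d' : ℕ → ℤ)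
    (v : ∀ l, 𝒱 (d l)) (v' : ∀ l, 𝒱 (d' l)) :
    lastDer f (proj (uword a (fun l => leaf (d l) (v l)) * uword b fun l => leaf (d' l) (v' l))) =
      (if b = 0 then 0 else f (d' (b - 1)) (v' (b - 1)) •
        (uword a (fun l => leaf (d l) (v l)) * uword (b - 1) fun l => leaf (d' l) (v' l))) +
      if a = 0 then 0 else paritySign (d (a - 1) * ∑ j ∈ range b, d' j) • f (d (a - 1)) (v (a - 1)) •
        (uword (a - 1) (fun l => leaf (d l) (v l)) * uword b fun l => leaf (d' l) (v' l)) := by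
  rcases a with _ | a
  · rcases b with _ | b
    · simp [uword]
    · simp [uword.eq_1, lastDer_proj_uword]
  rcases b with _ | b
  · simp [uword.eq_1, lastDer_proj_uword, paritySign]
  simp only [Nat.add_eq_zero_iff, one_ne_zero, and_false, if_false, Nat.add_sub_cancel]
  set S : ℕ → EilhTree 𝒱 := fun l => leaf (d l) (v l) with hS
  set S' : ℕ → EilhTree 𝒱 := fun l => leaf (d' l) (v' l) with hS'
  have hx := (isHomog_uword (a + 1) S).1
  have hy := (isHomog_uword (b + 1) S').1
  have ex : incl (proj (uword (a + 1) S)) = uword (a + 1) S := by rw [uword_add_one, proj_incl]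
  have ey : incl (proj (uword (b + 1) S')) = uword (b + 1) S' := by rw [uword_add_one, proj_incl]
  rw [← ex, ← ey, incl_mul_incl, proj_incl, lastDer_shuffleMul f hx hy, ex, ey,
    lastDer_proj_uword, lastDer_proj_uword, mul_smul_comm, mul_smul_comm, uword_mul_comm (b + 1) a,
    smul_comm (f _ _), smul_smul, ← paritySign_add]
  congr 2
  apply paritySign_congr
  simp only [sum_range_succ _ a, hS, hS', deg_leaf]
  exact ⟨(∑ j ∈ range (b + 1), d' j) * ∑ i ∈ range a, d i, by ring⟩

/-- The coefficient of the word `v₀ v₁ ⋯` in the product of two words whose letters are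
`v₀, v₁, …` in some order. -/
theorem coeff_uword_mul_uword {M : ℕ} {f : ℕ → ∀ d, 𝒱 d →ₗ[K] K} {d : ℕ → ℤ} {v : ∀ l, 𝒱 (d l)}
    (hf : ∀ l j, l < M → j < M → f l (d j) (v j) = if l = j then 1 else 0)
    {N : ℕ} (hN : N ≤ M) {a b : ℕ} {s s' : ℕ → ℕ} (hs : ∀ i < a, s i < N) (hs' : ∀ j < b, s' j < N)
    (hi : ∀ i < a, ∀ j < a, s i = s j → i = j) (hi' : ∀ i < b, ∀ j < b, s' i = s' j → i = j)
    (hne : ∀ i < a, ∀ j < b, s i ≠ s' j)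
    (hsurj : ∀ l < N, (∃ i < a, s i = l) ∨ ∃ j < b, s' j = l) :
    coeff f N (uword a (fun i => leaf (d (s i)) (v (s i))) *
        uword b fun j => leaf (d (s' j)) (v (s' j))) =
      if (∀ j < a, ∀ i < j, s i < s j) ∧ (∀ j < b, ∀ i < j, s' i < s' j) then
        (∏ i ∈ range a, ∏ j ∈ range b,
          if s' j < s i then paritySign (d (s i) * d (s' j)) else 1) • (1 : K)
      else 0 := by
  induction N generalizing a b with
  | zero =>
    obtain rfl : a = 0 := by
      by_contra h
      exact absurd (hs 0 (by omega)) (by omega)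
    obtain rfl : b = 0 := by
      by_contra h
      exact absurd (hs' 0 (by omega)) (by omega)
    simp [uword, coeff]
  | succ N ih =>
    change coeff f N (lastDer (f N) (proj _)) = _
    rw [lastDer_proj_uword_mul_uword (f N) a b (fun i => d (s i)) (fun j => d (s' j))
      (fun i => v (s i)) fun j => v (s' j)]
    have hval (j : ℕ) (hj : j < N + 1) : f N (d j) (v j) = if N = j then 1 else 0 :=
      hf N j (by omega) (by omega)
    -- The form for the largest index `N` is contracted first, so the letter `N` must end one of the
    -- two words. If it stands elsewhere in its word, the contraction is zero and that word is not
    -- increasing.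
    rcases hsurj N (by omega) with ⟨i, hia, hiN⟩ | ⟨j, hjb, hjN⟩
    · obtain ⟨a, rfl⟩ : ∃ k, a = k + 1 := ⟨a - 1, by omega⟩
      have h1 : (if b = 0 then (0 : ShuffleOne 𝒱) else f N (d (s' (b - 1))) (v (s' (b - 1))) •
          (uword (a + 1) (fun i => leaf (d (s i)) (v (s i))) *
            uword (b - 1) fun j => leaf (d (s' j)) (v (s' j)))) = 0 := by
        split_ifs with hb
        · rfl
        · rw [hval _ (hs' _ (by omega)), if_neg, zero_smul]
          rw [← hiN]
          exact hne i hia _ (by omega)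
      rw [h1, zero_add, if_neg (Nat.succ_ne_zero a), Nat.add_sub_cancel, hval _ (hs a (by omega))]
      by_cases hia' : i = a
      · subst hia'
        rw [if_pos hiN.symm, one_smul, LinearMap.map_units_int_smul, ih (by omega)
          (fun l hl => ?_) (fun j hj => ?_) (fun l hl j hj => hi l (by omega) j (by omega)) hi'
          (fun l hl => hne l (by omega)) (fun l hl => ?_)]
        · have hc : (∀ j < i + 1, ∀ l < j, s l < s j) ↔ ∀ j < i, ∀ l < j, s l < s j := by
            refine ⟨fun h j hj l hl => h j (by omega) l hl, fun h j hj l hl => ?_⟩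
            rcases Nat.lt_succ_iff_lt_or_eq.1 hj with hj | rfl
            · exact h j hj l hl
            · have := hs l (by omega)
              have : s l ≠ s j := fun e => by have := hi l (by omega) j (by omega) e; omega
              omega
          simp only [hc]
          split_ifs with h
          · rw [smul_smul, prod_range_succ, mul_comm]
            congr 2
            -- The letter `s i = N` exceeds every letter of the second word, so its row of the
            -- product has all its factors and equals the sign of the contraction.
            have : ∀ j ∈ range b, (if s' j < s i then paritySign (d (s i) * d (s' j)) else 1) =
                paritySign (d (s i) * d (s' j)) := fun j hj => by
              have hj := mem_range.1 hj
              have := hs' j hj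
              have := hne i hia j hj
              rw [if_pos (by omega)]
            rw [prod_congr rfl this, mul_sum]
            exact paritySign_sum _ _
          · exact smul_zero _
        · have := hs l (by omega)
          have : s l ≠ s i := fun e => by have := hi l (by omega) i (by omega) e; omega
          omega
        · have := hs' j hj
          have := hne i hia j hj
          omega
        · rcases hsurj l (by omega) with ⟨i', hi1, hi2⟩ | h
          · have : i' ≠ i := by rintro rfl; omega
            exact Or.inl ⟨i', by omega, hi2⟩
          · exact Or.inr h
      · have hs1 := hs a (by omega)
        have hs2 : s a ≠ s i := fun e => hia' (hi i hia a (by omega) e.symm)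
        rw [if_neg (by omega), zero_smul, smul_zero, map_zero, if_neg]
        rintro ⟨h, -⟩
        have := h a (by omega) i (by omega)
        omega
    · obtain ⟨b, rfl⟩ : ∃ k, b = k + 1 := ⟨b - 1, by omega⟩
      have h1 : (if a = 0 then (0 : ShuffleOne 𝒱) else
          paritySign (d (s (a - 1)) * ∑ j ∈ range (b + 1), d (s' j)) •
            f N (d (s (a - 1))) (v (s (a - 1))) •
          (uword (a - 1) (fun i => leaf (d (s i)) (v (s i))) *
            uword (b + 1) fun j => leaf (d (s' j)) (v (s' j)))) = 0 := by
        split_ifs with ha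
        · rfl
        · rw [hval _ (hs _ (by omega)), if_neg, zero_smul, smul_zero]
          rw [← hjN]
          exact (hne _ (by omega) j hjb).symm
      rw [h1, add_zero, if_neg (Nat.succ_ne_zero b), Nat.add_sub_cancel, hval _ (hs' b (by omega))]
      by_cases hjb' : j = b
      · subst hjb'
        rw [if_pos hjN.symm, one_smul, ih (by omega)
          (fun l hl => ?_) (fun l hl => ?_) hi (fun l hl j hj => hi' l (by omega) j (by omega))
          (fun l hl i hi => hne l hl i (by omega)) (fun l hl => ?_)]
        · have hc : (∀ i < j + 1, ∀ l < i, s' l < s' i) ↔ ∀ i < j, ∀ l < i, s' l < s' i := by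
            refine ⟨fun h i hi l hl => h i (by omega) l hl, fun h i hi l hl => ?_⟩
            rcases Nat.lt_succ_iff_lt_or_eq.1 hi with hi | rfl
            · exact h i hi l hl
            · have := hs' l (by omega)
              have : s' l ≠ s' i := fun e => by have := hi' l (by omega) i (by omega) e; omega
              omega
          simp only [hc]
          split_ifs with h
          · congr 1
            refine prod_congr rfl fun i hi => ?_
            rw [prod_range_succ, if_neg, mul_one]
            have := hs i (mem_range.1 hi)
            omega
          · rfl
        · have := hs l hl
          have := hne l hl j hjb
          omega
        · have := hs' l (by omega)
          have : s' l ≠ s' j := fun e => by have := hi' l (by omega) j (by omega) e; omega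
          omega
        · rcases hsurj l (by omega) with h | ⟨j', hj1, hj2⟩
          · exact Or.inl h
          · have : j' ≠ j := by rintro rfl; omega
            exact Or.inr ⟨j', by omega, hj2⟩
      · have hs1 := hs' b (by omega)
        have hs2 : s' b ≠ s' j := fun e => hjb' (hi' j hjb b (by omega) e.symm)
        rw [if_neg (by omega), zero_smul, map_zero, if_neg]
        rintro ⟨-, h⟩
        have := h b (by omega) j (by omega)
        omega

/-! ### Products of words as combinations of words -/

variable {α : Type*} (t : α → EilhTree 𝒱)

/-- The word of a list of monomials, read from the right to the left. -/
noncomputable def listWord : List α → ShuffleOne 𝒱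
  | [] => 1
  | a :: L => incl (half (listWord L) (ofTree (t a)))

theorem listWord_map_range (n : ℕ) (w : ℕ → α) :
    listWord t ((List.range n).map w).reverse = uword n fun l => t (w l) := by
  induction n with
  | zero => rfl
  | succ n ih => simp [List.range_succ, listWord, ih, uword_add_one]

theorem isHomog_listWord (L : List α) :
    IsHomog (listWord t L) (L.map fun a => (t a).deg).sum := by
  induction L with
  | nil => exact isHomog_one
  | cons a L ih =>
    rw [List.map_cons, List.sum_cons, add_comm]
    exact isHomog_incl (half_mem_homogeneous ih (ofTree_mem_homogeneous rfl))

theorem incl_half_mem_span {L M : List α} {a : α} (h : (a :: L).Perm M)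
    {X : ShuffleOne 𝒱} (hX : X ∈ Submodule.span K (listWord t '' {P | P.Perm L})) :
    incl (half X (ofTree (t a))) ∈ Submodule.span K (listWord t '' {P | P.Perm M}) := by
  have : Submodule.span K (listWord t '' {P | P.Perm L}) ≤
      (Submodule.span K (listWord t '' {P | P.Perm M})).comap (incl ∘ₗ halfLin (ofTree (t a))) := by
    refine Submodule.span_le.2 ?_
    rintro _ ⟨P, hP, rfl⟩
    exact Submodule.subset_span ⟨a :: P, (List.Perm.cons a hP).trans h, rfl⟩
  exact this hX

/-- Induction on both lists, stored with the last letter at the head: the product splits according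
to which of the two heads becomes the last letter. -/
theorem listWord_mul_listWord_mem_span (L M : List α) :
    listWord t L * listWord t M ∈ Submodule.span K (listWord t '' {P | P.Perm (L ++ M)}) := by
  induction L generalizing M with
  | nil =>
    rw [listWord.eq_1, one_mul]
    exact Submodule.subset_span ⟨M, List.Perm.refl M, rfl⟩
  | cons a L ihL =>
    induction M with
    | nil =>
      rw [listWord.eq_1, mul_one]
      exact Submodule.subset_span ⟨a :: L, by simp, rfl⟩
    | cons b M ihM =>
      have hx := ofTree_mem_homogeneous (a := t a) rfl
      have hy := ofTree_mem_homogeneous (a := t b) rfl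
      have hX := isHomog_listWord t L
      have hY := isHomog_listWord t M
      have e : listWord t (a :: L) * listWord t (b :: M) =
          incl (half (listWord t (a :: L) * listWord t M) (ofTree (t b))) +
            paritySign ((t a).deg * ((M.map fun a => (t a).deg).sum + (t b).deg)) •
              incl (half (listWord t L * listWord t (b :: M)) (ofTree (t a))) := by
        rw [listWord, listWord, incl_mul_incl_half (half_mem_homogeneous hX hx) hy hY, half_incl,
          op_zero_half, incl_mul_comm_of_isHomog (half_mem_homogeneous hY hy) hX, half_units_smul,
          LinearMap.map_units_int_smul, smul_smul, ← paritySign_add]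
        congr 2
        apply paritySign_congr
        exact ⟨(L.map fun a => (t a).deg).sum *
          ((M.map fun a => (t a).deg).sum + (t b).deg), by ring⟩
      rw [e]
      refine add_mem (incl_half_mem_span t ?_ ihM)
        (Submodule.units_int_smul_mem _ _ (incl_half_mem_span t ?_ (ihL (b :: M))))
      · exact List.perm_middle.symm
      · exact List.Perm.refl _

end ShuffleOne

end Shuffles

theorem units_smul_one_smul {K E : Type*} [Field K] [AddCommGroup E] [Module K E] (u : ℤˣ) (x : E) :
    (u • (1 : K)) • x = u • x := by
  rcases Int.units_eq_one_or u with rfl | rfl <;> simp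

/-! ### Words in letters, and the weight-one relation as antisymmetry -/

section Letters

variable {K E : Type*} [Field K] [AddCommGroup E] [Module K E]

open EilhTree Eilh ShuffleOne TensorProduct

variable {n : ℕ} (e : Fin (n + 1) → ℤ)

variable (K) in
/-- The basis vector `tᵢ`. -/
noncomputable def letterVec (i : Fin (n + 1)) : letterGrading K e (e i) :=
  ⟨Finsupp.single i 1, Finsupp.single_mem_supported K 1 rfl⟩

variable (K) in
/-- The linear form dual to `tᵢ`. -/
noncomputable def letterForm (i : Fin (n + 1)) (d : ℤ) : letterGrading K e d →ₗ[K] K :=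
  Finsupp.lapply i ∘ₗ (letterGrading K e d).subtype

theorem letterForm_of_ne (i : Fin (n + 1)) (d : ℤ) (h : d ≠ e i) : letterForm K e i d = 0 := by
  refine LinearMap.ext fun v => ?_
  by_contra hv
  exact h (v.2 (Finsupp.mem_support_iff.2 hv)).symm

theorem letterForm_letterVec (i j : Fin (n + 1)) :
    letterForm K e i (e j) (letterVec K e j) = if i = j then 1 else 0 := by
  simp [letterForm, letterVec, Finsupp.single_apply, eq_comm]

/-- The coefficients are dual to the words in the letters, so these words are linearly independent.
-/
theorem coeff_zeroWord_letterVec (τ σ : Equiv.Perm (Fin (n + 1))) :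
    coeff (permSeq (letterForm K e) τ) (n + 1) (incl (zeroWord e (letterVec K e) σ)) =
      if σ = τ then 1 else 0 := by
  rw [coeff_zeroWord]
  simp only [letterForm_letterVec]
  split_ifs with h
  · simp [h]
  · obtain ⟨i, hi⟩ : ∃ i, τ i ≠ σ i := by
      by_contra hc
      push Not at hc
      exact h (Equiv.ext fun i => (hc i).symm)
    exact prod_eq_zero (mem_univ i) (if_neg hi)

/-- The contraction of the first factor of a tensor product. -/
noncomputable def contract {M : Type*} [AddCommGroup M] [Module K M] (κ : M →ₗ[K] K) :
    M ⊗[K] E →ₗ[K] E :=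
  TensorProduct.lift (LinearMap.lsmul K E ∘ₗ κ)

theorem contract_tmul {M : Type*} [AddCommGroup M] [Module K M] (κ : M →ₗ[K] K) (z : M) (y : E) :
    contract κ (z ⊗ₜ[K] y) = κ z • y := by
  simp [contract]

theorem tmul_units_smul {M : Type*} [AddCommGroup M] [Module K M] (u : ℤˣ) (z : M) (y : E) :
    z ⊗ₜ[K] (u • y) = u • (z ⊗ₜ[K] y) := by
  rcases Int.units_eq_one_or u with rfl | rfl <;> simp [tmul_neg]

theorem units_smul_tmul {M : Type*} [AddCommGroup M] [Module K M] (u : ℤˣ) (z : M) (y : E) :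
    (u • z) ⊗ₜ[K] y = u • (z ⊗ₜ[K] y) := by
  rcases Int.units_eq_one_or u with rfl | rfl <;> simp [neg_tmul]

/-- A family of products as a family of higher products that vanish for nonzero multi-indices. -/
noncomputable def strict (μ : (n : ℕ) → MultilinearMap K (fun _ : Fin (n + 1) => E) E) (n : ℕ)
    (I : Fin n → ℕ) : MultilinearMap K (fun _ : Fin (n + 1) => E) E := if I = 0 then μ n else 0

variable (μ : (n : ℕ) → MultilinearMap K (fun _ : Fin (n + 1) => E) E)

theorem strict_zero (n : ℕ) : strict μ n 0 = μ n := if_pos rfl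

theorem strict_of_ne {n : ℕ} {I : Fin n → ℕ} (h : I ≠ 0) : strict μ n I = 0 := if_neg h

/-- Either the outer product is zero, or the inner product puts a zero into slot `k`. -/
theorem strict_splice_eq_zero {q m k : ℕ} (hk : k < q + 1) {I : Fin q → ℕ} {J : Fin m → ℕ}
    (h : I ≠ 0 ∨ J ≠ 0) (y : ℕ → E) (z : Fin (m + 1) → E) :
    strict μ q I (fun i => splice y m k (strict μ m J z) i) = 0 := by
  rcases h with h | h
  · rw [strict_of_ne μ h]
    rfl
  · refine MultilinearMap.map_coord_zero _ ⟨k, hk⟩ ?_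
    rw [strict_of_ne μ h]
    simp [splice]

theorem mkQ_Q₀ {V : Type*} [AddCommGroup V] [Module K V] {𝒱 : ℤ → Submodule K V}
    (a : EilhTree 𝒱) : (eilhIdeal 𝒱).mkQ (Q₀ a) = der₀ (ofTree a) := by
  induction a with
  | leaf d v => exact (der₀_gen v).symm
  | op i a b ha hb =>
    rw [isDerivation_der₀.ofTree_op, leibnizOp, Q₀, ← ha, ← hb, op_ofTree, op_ofTree, ofTree,
      ofTree, op_mkQ, op_mkQ, map_sub, map_add, LinearMap.map_units_int_smul, map_add,
      LinearMap.map_units_int_smul, LinearMap.map_units_int_smul, LinearMap.map_units_int_smul]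
    rfl

theorem ne_zero_of_mem_antidiagonalTuple {m r : ℕ} {I : Fin m → ℕ} (hr : r ≠ 0)
    (h : I ∈ Finset.Nat.antidiagonalTuple m r) : I ≠ 0 := by
  rintro rfl
  rw [Finset.Nat.mem_antidiagonalTuple] at h
  simp at h
  exact hr h.symm

/-- In positive weight the nested terms vanish, because one of the two multi-indices is nonzero.
Only the deformation of the Leibniz rule contributes. -/
theorem homotopyRelation_strict_succ (p : ℕ) (d : Fin (n + 1) → ℤ) (x : Fin (n + 1) → E) :
    homotopyRelation (strict μ) n (p + 1) d x = ∑ σ : Equiv.Perm (Fin (n + 1)),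
      ∑ I ∈ Finset.Nat.antidiagonalTuple n p, extensionSign n (∑ j, I j) (permSeq d σ) •
        (der₀ (ofTree (word n I (permSeq (letter K fun i => 1 - d i) σ))) ⊗ₜ[K]
          strict μ n I fun i => x (σ i)) := by
  unfold homotopyRelation
  refine sum_congr rfl fun σ _ => ?_
  simp only [mkQ_Q₀, permSeq_apply]
  refine (sub_eq_self.2 ?_).trans rfl
  refine sum_eq_zero fun qm _ => sum_eq_zero fun ab hab => sum_eq_zero fun I hI =>
    sum_eq_zero fun J hJ => sum_eq_zero fun k hk => ?_
  have hIJ : I ≠ 0 ∨ J ≠ 0 := by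
    rw [HasAntidiagonal.mem_antidiagonal] at hab
    by_cases ha : ab.1 = 0
    · exact Or.inr (ne_zero_of_mem_antidiagonalTuple (by omega) hJ)
    · exact Or.inl (ne_zero_of_mem_antidiagonalTuple ha hI)
  rw [strict_splice_eq_zero μ (mem_range.1 hk) hIJ, tmul_zero, smul_zero]

theorem homotopyRelation_strict_add_two (p : ℕ) (d : Fin (n + 1) → ℤ) (x : Fin (n + 1) → E) :
    homotopyRelation (strict μ) n (p + 2) d x = 0 := by
  rw [homotopyRelation_strict_succ]
  refine sum_eq_zero fun σ _ => sum_eq_zero fun I hI => ?_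
  rw [strict_of_ne μ (ne_zero_of_mem_antidiagonalTuple (by omega) hI), zero_apply, tmul_zero,
    smul_zero]

theorem homotopyRelation_strict_one (d : Fin (n + 1) → ℤ) (x : Fin (n + 1) → E) :
    homotopyRelation (strict μ) n 1 d x = ∑ σ : Equiv.Perm (Fin (n + 1)),
      extensionSign n 0 (permSeq d σ) •
        (der₀ (zeroWord (fun i => 1 - d i) (letterVec K _) σ) ⊗ₜ[K] μ n fun i => x (σ i)) := by
  rw [homotopyRelation_strict_succ]
  refine sum_congr rfl fun σ _ => ?_
  rw [Finset.Nat.antidiagonalTuple_zero_right, sum_singleton, strict_zero]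
  simp only [Pi.zero_apply, sum_const_zero]
  rfl

/-- Graded antisymmetry of a family of products. -/
def IsGradedAntisymm (𝓔 : ℤ → Submodule K E) : Prop :=
  ∀ (n : ℕ) (d : Fin (n + 1) → ℤ) (x : Fin (n + 1) → E), (∀ i, x i ∈ 𝓔 (d i)) →
    ∀ σ : Equiv.Perm (Fin (n + 1)), μ n x = koszulAltSign σ d • μ n fun i => x (σ i)

/-- The functional of `exists_coeff_swap` on `der₀` of a word in the letters is nonzero for the
permutations `σ` and `σ * s` at most, so contracting the relation leaves two terms.
`extensionSign_perm` converts their signs into antisymmetric ones. -/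
theorem koszulAltSign_smul_eq (d : Fin (n + 1) → ℤ) (x : Fin (n + 1) → E)
    (h : homotopyRelation (strict μ) n 1 d x = 0) (σ : Equiv.Perm (Fin (n + 1))) (k : Fin n) :
    koszulAltSign σ d • μ n (fun i => x (σ i)) =
      koszulAltSign (σ * Equiv.swap k.castSucc k.succ) d •
        μ n fun i => x ((σ * Equiv.swap k.castSucc k.succ) i) := by
  set e : Fin (n + 1) → ℤ := fun i => 1 - d i with he
  set s := Equiv.swap k.castSucc k.succ with hs
  obtain ⟨κ, hκ⟩ := exists_coeff_swap (f := permSeq (letterForm K e) σ) (e := permSeq e σ)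
    (fun l d hd => letterForm_of_ne e _ d hd) (N := n + 1) (k := k) (by omega)
  have key (τ : Equiv.Perm (Fin (n + 1))) : κ (der₀ (zeroWord e (letterVec K e) τ)) =
      (if τ = σ then 1 else 0) -
        paritySign (e (σ k.castSucc) * e (σ k.succ)) • (if τ = σ * s then (1 : K) else 0) := by
    have e1 := permSeq_apply e σ k.castSucc
    have e2 := permSeq_apply e σ k.succ
    rw [Fin.val_castSucc] at e1
    rw [Fin.val_succ] at e2
    rw [hκ _ (zeroWord_mem_zeroSpan _ _ _), coeff_zeroWord_letterVec, ← coeff_congr fun l hl =>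
      permSeq_mul_swap (letterForm K e) σ k l (by omega), coeff_zeroWord_letterVec, e1, e2]
  have h1 := congrArg (contract κ) h
  rw [homotopyRelation_strict_one, map_sum, map_zero] at h1
  simp only [LinearMap.map_units_int_smul, contract_tmul] at h1
  change ∑ τ, extensionSign n 0 (permSeq d τ) •
    κ (der₀ (zeroWord e (letterVec K e) τ)) • μ n (fun i => x (τ i)) = 0 at h1
  simp only [key, sub_smul, smul_sub, sum_sub_distrib, ite_smul, one_smul, zero_smul, smul_ite,
    smul_zero, sum_ite_eq', mem_univ, if_true, units_smul_one_smul, sub_eq_zero] at h1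
  have hk : koszulSign (σ * s) (fun i => 1 - d i) = koszulSign σ e *
    paritySign (e (σ k.castSucc) * e (σ k.succ)) := koszulSign_mul_swap σ k e
  rw [extensionSign_perm d σ, extensionSign_perm d (σ * s), hk] at h1
  change (_ * koszulSign σ e * _) • _ = _ at h1
  generalize paritySign (e (σ k.castSucc) * e (σ k.succ)) = u₁ at h1
  generalize koszulSign σ e = u₂ at h1
  generalize extensionSign n 0 (permSeq d 1) = u₃ at h1
  rcases Int.units_eq_one_or u₁ with rfl | rfl <;> rcases Int.units_eq_one_or u₂ with rfl | rfl <;>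
    rcases Int.units_eq_one_or u₃ with rfl | rfl <;> simpa using h1

theorem isGradedAntisymm_of_homotopyRelation {𝓔 : ℤ → Submodule K E}
    (h : ∀ (n : ℕ) (d : Fin (n + 1) → ℤ) (x : Fin (n + 1) → E), (∀ i, x i ∈ 𝓔 (d i)) →
      homotopyRelation (strict μ) n 1 d x = 0) : IsGradedAntisymm μ 𝓔 := by
  intro n d x hx σ
  induction σ using Equiv.Perm.adjacent_induction with
  | one => simp [koszulAltSign_one]
  | mul_swap σ k ih => rw [ih, koszulAltSign_smul_eq μ d x (h n d x hx)]

/-- `der₀` is a derivation of the shuffle product and annihilates each factor. -/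
theorem extend_der₀_prod {V : Type*} [AddCommGroup V] [Module K V] {𝒱 : ℤ → Submodule K V}
    (L : List (Σ d, 𝒱 d)) : extend der₀ (L.map fun x => incl (gen x.2)).prod = 0 := by
  induction L with
  | nil => exact extend_one _
  | cons x L ih =>
    rw [List.map_cons, List.prod_cons, extend_incl_mul isDerivation_der₀ (gen_mem_homogeneous x.2),
      ih, der₀_gen, map_zero, zero_mul, mul_zero, smul_zero, add_zero]

theorem sum_koszulSign_smul_der₀ {V : Type*} [AddCommGroup V] [Module K V]
    {𝒱 : ℤ → Submodule K V} (d : Fin (n + 1) → ℤ) (v : ∀ i, 𝒱 (d i)) :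
    ∑ σ : Equiv.Perm (Fin (n + 1)), koszulSign σ d • der₀ (zeroWord d v σ) = 0 := by
  have h := extend_der₀_prod (List.ofFn fun i => (⟨d i, v i⟩ : Σ d, 𝒱 d))
  rw [List.map_ofFn] at h
  have h2 := (prod_incl_ofTree fun i => leaf (d i) (v i))
  have h3 := (congrArg (extend der₀) h2).symm.trans h
  rw [map_sum] at h3
  apply incl_injective
  rw [map_zero, map_sum, ← h3]
  refine sum_congr rfl fun σ _ => ?_
  rw [LinearMap.map_units_int_smul, LinearMap.map_units_int_smul, uword_succ, extend_incl]
  rfl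

/-- Antisymmetry makes the second tensor factor equal to `μ n x` in all summands. The signs that
remain are the Koszul signs of the letters, so the first factors sum to `der₀` of a shuffle product
of letters. -/
theorem IsGradedAntisymm.homotopyRelation_one {𝓔 : ℤ → Submodule K E} (hμ : IsGradedAntisymm μ 𝓔)
    (d : Fin (n + 1) → ℤ) (x : Fin (n + 1) → E) (hx : ∀ i, x i ∈ 𝓔 (d i)) :
    homotopyRelation (strict μ) n 1 d x = 0 := by
  have h : ∀ σ : Equiv.Perm (Fin (n + 1)), extensionSign n 0 (permSeq d σ) •
      (der₀ (zeroWord (fun i => 1 - d i) (letterVec K _) σ) ⊗ₜ[K] μ n fun i => x (σ i)) =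
      extensionSign n 0 (permSeq d 1) • ((koszulSign σ (fun i => 1 - d i) •
        der₀ (zeroWord (fun i => 1 - d i) (letterVec K _) σ)) ⊗ₜ[K] μ n x) := by
    intro σ
    rw [extensionSign_perm, hμ n d x hx σ, tmul_units_smul, units_smul_tmul, smul_smul, smul_smul]
    congr 1
    ac_rfl
  rw [homotopyRelation_strict_one, sum_congr rfl fun σ _ => h σ, ← smul_sum,
    ← TensorProduct.sum_tmul, sum_koszulSign_smul_der₀, TensorProduct.zero_tmul, smul_zero]

end Letters

/-! ### Moving the inner block to the front -/

section BlockPermutations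

theorem koszulSign_mul {n : ℕ} (σ ρ : Equiv.Perm (Fin (n + 1))) (d : Fin (n + 1) → ℤ) :
    koszulSign (σ * ρ) d = koszulSign σ d * koszulSign ρ fun i => d (σ i) := by
  induction ρ using Equiv.Perm.adjacent_induction with
  | one => simp [koszulSign_one]
  | mul_swap ρ k ih =>
    rw [← mul_assoc, koszulSign_mul_swap, koszulSign_mul_swap, ih, mul_assoc]
    rfl

theorem koszulAltSign_mul {n : ℕ} (σ ρ : Equiv.Perm (Fin (n + 1))) (d : Fin (n + 1) → ℤ) :
    koszulAltSign (σ * ρ) d = koszulAltSign σ d * koszulAltSign ρ fun i => d (σ i) := by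
  rw [koszulAltSign, koszulAltSign, koszulAltSign, koszulSign_mul, Equiv.Perm.sign_mul]
  ac_rfl

/-- The permutation that moves the first `m + 1` places to the places `k, …, k + m`. -/
def blockPerm {n : ℕ} (m k : ℕ) (h : m + k ≤ n) : Equiv.Perm (Fin (n + 1)) where
  toFun l := ⟨if l.1 < k then m + 1 + l.1 else if l.1 ≤ k + m then l.1 - k else l.1, by
    have := l.2
    split_ifs <;> omega⟩
  invFun l := ⟨if l.1 ≤ m then l.1 + k else if l.1 ≤ m + k then l.1 - (m + 1) else l.1, by
    have := l.2
    split_ifs <;> omega⟩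
  left_inv l := by
    ext
    simp only
    split_ifs <;> omega
  right_inv l := by
    ext
    simp only
    split_ifs <;> omega

variable {α : Type*} {n m k : ℕ} (h : m + k ≤ n) (f : Fin (n + 1) → α)
  (σ : Equiv.Perm (Fin (n + 1)))

theorem permSeq_mul_blockPerm (l : ℕ) (hl : l < n + 1) : permSeq f (σ * blockPerm m k h) l =
    permSeq f σ (if l < k then m + 1 + l else if l ≤ k + m then l - k else l) := by
  have h1 : ∀ j (hj : j < n + 1), Fin.ofNat (n + 1) j = ⟨j, hj⟩ := fun j hj => by
    simp [Fin.ext_iff, Nat.mod_eq_of_lt hj]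
  unfold permSeq
  rw [Equiv.Perm.mul_apply, h1 l hl, h1 _ (by split_ifs <;> omega)]
  rfl

theorem permSeq_mul_blockPerm_add (j : ℕ) (hj : j ≤ m) :
    permSeq f (σ * blockPerm m k h) (k + j) = permSeq f σ j := by
  rw [permSeq_mul_blockPerm h f σ _ (by omega), if_neg (by omega), if_pos (by omega),
    Nat.add_sub_cancel_left]

theorem splice_permSeq_mul_blockPerm (y : α) (l : ℕ) (hl : l + m ≤ n) :
    splice (permSeq f (σ * blockPerm m k h)) m k y l =
      insertSeq k y (fun l => permSeq f σ (m + 1 + l)) l := by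
  unfold splice insertSeq
  split_ifs with h1 h2
  · rw [permSeq_mul_blockPerm h f σ _ (by omega), if_pos h1]
  · rfl
  · rw [permSeq_mul_blockPerm h f σ _ (by omega), if_neg (by omega), if_neg (by omega)]
    congr 1
    omega

theorem insertSeq_succ (k : ℕ) (y : α) (T : ℕ → α) (l : ℕ) :
    insertSeq (k + 1) y T l = insertSeq k y T (Equiv.swap k (k + 1) l) := by
  simp only [insertSeq, Equiv.swap_apply_def]
  split_ifs <;> first | rfl | omega | skip
  all_goals congr 1

theorem insertSeq_zero (y : ℕ → α) (z : α) :
    insertSeq 0 z (fun l => y (m + 1 + l)) = splice y m 0 z := by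
  funext l
  simp only [insertSeq, splice]
  split_ifs
  · omega
  · rfl
  · congr 1
    omega

/-- The entry `D` travels from place `0` to place `k` by adjacent transpositions, each contributing
`(-1)^(D + C l)`. -/
theorem extensionSign_insertSeq (q : ℕ) (D : ℤ) (C : ℕ → ℤ) (hk : k ≤ q) :
    extensionSign q 0 (insertSeq k D C) =
      paritySign (∑ l ∈ range k, (D + C l)) * extensionSign q 0 (insertSeq 0 D C) := by
  induction k with
  | zero => simp [paritySign]
  | succ k ih =>
    rw [extensionSign_congr q 0 (fun l _ => insertSeq_succ k D C l), extensionSign_swap q 0 _ k hk,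
      ih (by omega), sum_range_succ, ← mul_assoc, mul_comm (paritySign _) (paritySign _),
      ← paritySign_add]
    simp [insertSeq]

end BlockPermutations

/-! ### The weight-zero relation as a sum of products of words -/

section Jacobi

variable {K E : Type*} [Field K] [AddCommGroup E] [Module K E]

open EilhTree Eilh ShuffleOne TensorProduct

variable (μ : (n : ℕ) → MultilinearMap K (fun _ : Fin (n + 1) => E) E) {𝓔 : ℤ → Submodule K E}

theorem IsGradedAntisymm.map_swap {μ} (hμ : IsGradedAntisymm μ 𝓔) {q k : ℕ} (hk : k + 1 ≤ q)
    {C : ℕ → ℤ} {y : ℕ → E} (hy : ∀ l ≤ q, y l ∈ 𝓔 (C l)) :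
    μ q (fun i => y (Equiv.swap k (k + 1) (i : ℕ))) =
      paritySign (1 + C k * C (k + 1)) • μ q fun i => y i := by
  have h := hμ q (fun i => C i) (fun i => y i) (fun i => hy i (by omega))
    (1 * Equiv.swap (Fin.castSucc ⟨k, by omega⟩ : Fin (q + 1)) (Fin.succ ⟨k, by omega⟩))
  have h2 : (fun i : Fin (q + 1) => y (Equiv.swap k (k + 1) (i : ℕ))) = fun i =>
      y (Equiv.swap (Fin.castSucc ⟨k, by omega⟩ : Fin (q + 1)) (Fin.succ ⟨k, by omega⟩) i) := by
    funext i
    simp only [Equiv.swap_apply_def, Fin.ext_iff, Fin.val_castSucc, Fin.val_succ]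
    split_ifs <;> rfl
  rw [koszulAltSign_mul_swap, koszulAltSign_one] at h
  have h1 : paritySign 1 = -1 := by simp [paritySign]
  rw [h, h2, paritySign_add, h1, smul_smul]
  simp [units_mul_self]

/-- The inserted element is moved to the front by adjacent transpositions, each contributing
`(-1)^(1 + D C l)`. -/
theorem IsGradedAntisymm.map_insertSeq {μ} (hμ : IsGradedAntisymm μ 𝓔) {q k : ℕ} (hk : k ≤ q)
    {C : ℕ → ℤ} {y : ℕ → E} (hy : ∀ l < q, y l ∈ 𝓔 (C l)) {D : ℤ} {z : E} (hz : z ∈ 𝓔 D) :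
    μ q (fun i => insertSeq k z y i) =
      paritySign (∑ l ∈ range k, (1 + D * C l)) • μ q fun i => insertSeq 0 z y i := by
  induction k with
  | zero => simp [paritySign]
  | succ k ih =>
    simp only [insertSeq_succ]
    rw [hμ.map_swap hk (C := insertSeq k D C) fun l hl => ?_, ih (by omega), smul_smul,
      ← paritySign_add, sum_range_succ, add_comm (∑ l ∈ range k, _)]
    · simp [insertSeq]
    · unfold insertSeq
      split_ifs
      · exact hy _ (by omega)
      · exact hz
      · exact hy _ (by omega)

theorem deg_word_zero {V : Type*} [AddCommGroup V] [Module K V] {𝒱 : ℤ → Submodule K V} (n : ℕ)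
    (T : ℕ → EilhTree 𝒱) : (word n 0 T).deg = ∑ j ∈ range (n + 1), (T j).deg := by
  induction n with
  | zero => simp [word]
  | succ n ih =>
    rw [sum_range_succ, word, deg_op, ← ih]
    simp
    rfl

theorem word_congr {V : Type*} [AddCommGroup V] [Module K V] {𝒱 : ℤ → Submodule K V} {n : ℕ}
    (I : Fin n → ℕ) {T T' : ℕ → EilhTree 𝒱} (h : ∀ l ≤ n, T l = T' l) : word n I T = word n I T' := by
  induction n with
  | zero => simp [word, h]
  | succ n ih => rw [word, word, h (n + 1) le_rfl, ih _ fun l hl => h l (by omega)]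

end Jacobi

section Jacobi

variable {K E : Type*} [Field K] [AddCommGroup E] [Module K E]

open EilhTree Eilh ShuffleOne TensorProduct

variable (μ : (n : ℕ) → MultilinearMap K (fun _ : Fin (n + 1) => E) E) {𝓔 : ℤ → Submodule K E}
variable {n : ℕ}

/-- The contribution of the insertion of `μ_{m+1}` into place `k` of `μ_{q+1}` to the homotopy
relation. -/
noncomputable def insertionTerm {V : Type*} [AddCommGroup V] [Module K V] {𝒱 : ℤ → Submodule K V}
    (q m k : ℕ) (T : ℕ → EilhTree 𝒱) (y : ℕ → E) (c : ℕ → ℤ) : Eilh 𝒱 ⊗[K] E :=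
  let c' : ℕ → ℤ := splice c m k (∑ j ∈ range (m + 1), c (k + j) + 1 - m)
  (paritySign (∑ l ∈ range k, (1 - c' l)) * extensionSign q 0 c' *
      extensionSign m 0 fun j => c (k + j)) •
    (ofTree (word q 0 (splice T m k (word m 0 fun j => T (k + j)))) ⊗ₜ[K]
      μ q fun i => splice y m k (μ m fun j => y (k + j)) i)

theorem homotopyRelation_strict_zero (d : Fin (n + 1) → ℤ) (x : Fin (n + 1) → E) :
    homotopyRelation (strict μ) n 0 d x = -∑ qm ∈ HasAntidiagonal.antidiagonal n,
      ∑ k ∈ range (qm.1 + 1), ∑ σ : Equiv.Perm (Fin (n + 1)),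
        insertionTerm μ qm.1 qm.2 k (permSeq (letter K fun i => 1 - d i) σ) (permSeq x σ)
          (permSeq d σ) := by
  simp only [sum_comm (s := range _) (t := univ)]
  rw [sum_comm, ← sum_neg_distrib]
  unfold homotopyRelation
  refine sum_congr rfl fun σ _ => ?_
  have h : HasAntidiagonal.antidiagonal 0 = {((0 : ℕ), (0 : ℕ))} := by
    ext ⟨a, b⟩
    simp
  simp only [predTuples, sum_empty, zero_sub, h, sum_singleton,
    Finset.Nat.antidiagonalTuple_zero_right, strict_zero, Nat.cast_zero, zero_add, sub_zero]
  rfl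

-- Precomposing with the block permutation lets the inner product always use the first `m + 1`
-- entries. Antisymmetry of the outer product then removes the dependence of the second tensor
-- factor on `k`. In the first factor the inner word `W` is inserted at every place of the remaining
-- word, which by `incl_mul_uword` is the shuffle product.
variable {μ} in
theorem IsGradedAntisymm.sum_insertionTerm (hμ : IsGradedAntisymm μ 𝓔)
    (hdeg : ∀ (n : ℕ) (d : Fin (n + 1) → ℤ) (x : Fin (n + 1) → E),
      (∀ i, x i ∈ 𝓔 (d i)) → μ n x ∈ 𝓔 (∑ i, d i + 1 - n))
    {q m : ℕ} (hqm : q + m = n) (d : Fin (n + 1) → ℤ) (x : Fin (n + 1) → E)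
    (hx : ∀ i, x i ∈ 𝓔 (d i)) {V : Type*} [AddCommGroup V] [Module K V] {𝒱 : ℤ → Submodule K V}
    (t : Fin (n + 1) → EilhTree 𝒱) (ht : ∀ i, (t i).deg = 1 - d i)
    (σ : Equiv.Perm (Fin (n + 1))) (β : ℕ → Equiv.Perm (Fin (n + 1)))
    (hβ : ∀ k (hk : k ≤ q), β k = blockPerm m k (by omega)) :
    ∑ k ∈ range (q + 1), insertionTerm μ q m k (permSeq t (σ * β k)) (permSeq x (σ * β k))
        (permSeq d (σ * β k)) =
      (paritySign (q + 1 + ∑ i, (1 - d i)) * extensionSign n 0 (permSeq d σ)) •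
        (proj (uword (m + 1) (permSeq t σ) * uword q fun l => permSeq t σ (m + 1 + l)) ⊗ₜ[K]
          μ q fun l => splice (permSeq x σ) m 0 (μ m fun j => permSeq x σ j) l) := by
  set T := permSeq t σ with hT
  set y := permSeq x σ with hy
  set c := permSeq d σ with hc
  set D := ∑ j ∈ range (m + 1), c j + 1 - m with hD
  set W := word m 0 T with hW
  set Y := μ m fun j => y j with hY
  have hyc (l : ℕ) : y l ∈ 𝓔 (c l) := hx _
  have hTc (l : ℕ) : (T l).deg = 1 - c l := ht _
  have hYD : Y ∈ 𝓔 D := by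
    have := hdeg m (fun j => c j) (fun j => y j) fun j => hyc j
    rwa [Fin.sum_univ_eq_sum_range c] at this
  have hWD : W.deg = 2 - D := by
    rw [hW, deg_word_zero, hD, sum_congr rfl fun j _ => hTc j, sum_sub_distrib]
    simp
    ring
  have key : ∀ k ∈ range (q + 1), insertionTerm μ q m k (permSeq t (σ * β k))
      (permSeq x (σ * β k)) (permSeq d (σ * β k)) =
      (paritySign (q + 1 + ∑ i, (1 - d i)) * extensionSign n 0 c) •
        (proj (paritySign (W.deg * ∑ l ∈ range k, (T (m + 1 + l)).deg) •
            uword (q + 1) (insertSeq k W fun l => T (m + 1 + l))) ⊗ₜ[K]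
          μ q fun l => splice y m 0 Y l) := by
    intro k hk
    replace hk : k ≤ q := by simpa [Nat.lt_succ_iff] using hk
    rw [hβ k hk, insertionTerm]
    have hkn : m + k ≤ n := by omega
    have e1 : ∑ j ∈ range (m + 1), permSeq d (σ * blockPerm m k hkn) (k + j) + 1 - m = D := by
      rw [hD]
      congr 2
      exact sum_congr rfl fun j hj =>
        permSeq_mul_blockPerm_add hkn d σ j (by simpa [Nat.lt_succ_iff] using hj)
    have e2 : word m 0 (fun j => permSeq t (σ * blockPerm m k hkn) (k + j)) = W :=
      word_congr 0 fun j hj => permSeq_mul_blockPerm_add hkn t σ j hj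
    have e3 : (μ m fun j => permSeq x (σ * blockPerm m k hkn) (k + j)) = Y := by
      rw [hY]
      congr 1
      funext j
      exact permSeq_mul_blockPerm_add hkn x σ j (by omega)
    have e4 : extensionSign m 0 (fun j => permSeq d (σ * blockPerm m k hkn) (k + j)) =
        extensionSign m 0 c :=
      extensionSign_congr m 0 fun j hj => permSeq_mul_blockPerm_add hkn d σ j hj
    have e5 := splice_permSeq_mul_blockPerm hkn d σ D
    have e6 : extensionSign q 0 (splice (permSeq d (σ * blockPerm m k hkn)) m k D) =
        extensionSign q 0 (insertSeq k D fun l => c (m + 1 + l)) :=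
      extensionSign_congr q 0 fun l hl => e5 l (by omega)
    have e7 : ∑ l ∈ range k, (1 - splice (permSeq d (σ * blockPerm m k hkn)) m k D l) =
        ∑ l ∈ range k, (1 - c (m + 1 + l)) := by
      refine sum_congr rfl fun l hl => ?_
      rw [mem_range] at hl
      rw [e5 l (by omega), insertSeq, if_pos hl]
    have e8 : word q 0 (splice (permSeq t (σ * blockPerm m k hkn)) m k W) =
        word q 0 (insertSeq k W fun l => T (m + 1 + l)) :=
      word_congr 0 fun l hl => splice_permSeq_mul_blockPerm hkn t σ W l (by omega)
    have e9 : (fun i : Fin (q + 1) => splice (permSeq x (σ * blockPerm m k hkn)) m k Y i) =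
        fun i : Fin (q + 1) => insertSeq k Y (fun l => y (m + 1 + l)) i := by
      funext i
      exact splice_permSeq_mul_blockPerm hkn x σ Y i (by omega)
    have e10 := extensionSign_cons q m c D hD
    have e11 : insertSeq 0 D (fun l => c (m + 1 + l)) = fun l => if l = 0 then D else c (l + m) := by
      rw [insertSeq_zero]
      funext l
      simp [splice]
    have e12 : ∑ j ∈ range (n + 1), (1 - c j) = ∑ i, (1 - d i) :=
      sum_range_permSeq (fun i => 1 - d i) σ
    rw [hqm, e12] at e10
    simp only [e1, e2, e3, e4, e6, e7, e8, e9]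
    rw [hμ.map_insertSeq hk (C := fun l => c (m + 1 + l)) (fun l _ => hyc _) hYD,
      extensionSign_insertSeq q D _ hk, e11, insertSeq_zero, tmul_units_smul, smul_smul,
      LinearMap.map_units_int_smul, units_smul_tmul, smul_smul, uword_succ, proj_incl]
    congr 1
    rw [mul_assoc (paritySign _), mul_assoc (paritySign _) (extensionSign q 0 _), e10]
    -- For each letter passed, `(1 - c) + (D + c) + (1 + D c) ≡ (2 - D)(1 - c)` modulo 2, where `2 -
    -- D` is the degree of `W`.
    have e13 : paritySign (W.deg * ∑ l ∈ range k, (T (m + 1 + l)).deg) =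
        paritySign (∑ l ∈ range k, (1 - c (m + 1 + l))) *
          paritySign (∑ l ∈ range k, (D + c (m + 1 + l))) *
          paritySign (∑ l ∈ range k, (1 + D * c (m + 1 + l))) := by
      rw [← paritySign_add, ← paritySign_add]
      apply paritySign_congr
      simp only [hWD, hTc, mul_sum, ← sum_sub_distrib, ← sum_add_distrib]
      refine ⟨∑ l ∈ range k, (- c (m + 1 + l) - D * 1), ?_⟩
      rw [← sum_add_distrib]
      exact sum_congr rfl fun l _ => by ring
    rw [e13]
    ac_rfl
  rw [sum_congr rfl key, ← smul_sum, ← TensorProduct.sum_tmul, ← map_sum, ← incl_mul_uword,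
    uword_succ]

/-- The sum of the Jacobiators of all permutations of `x₀, …, xₙ`, with coefficients in the free
`Eilh`-algebra. -/
noncomputable def jacobiTensor (d : Fin (n + 1) → ℤ) (x : Fin (n + 1) → E) :
    Eilh (letterGrading K fun i => 1 - d i) ⊗[K] E :=
  ∑ ij ∈ HasAntidiagonal.antidiagonal n, ∑ σ : Equiv.Perm (Fin (n + 1)),
    (koszulAltSign σ d * paritySign ij.2 * koszulSign σ fun i => 1 - d i) •
      (proj (uword (ij.1 + 1) (permSeq (letter K fun i => 1 - d i) σ) *
          uword ij.2 fun l => permSeq (letter K fun i => 1 - d i) σ (ij.1 + 1 + l)) ⊗ₜ[K]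
        μ ij.2 fun l => splice (permSeq x σ) ij.1 0 (μ ij.1 fun j => permSeq x σ j) l)

variable {μ} in
theorem IsGradedAntisymm.homotopyRelation_zero (hμ : IsGradedAntisymm μ 𝓔)
    (hdeg : ∀ (n : ℕ) (d : Fin (n + 1) → ℤ) (x : Fin (n + 1) → E),
      (∀ i, x i ∈ 𝓔 (d i)) → μ n x ∈ 𝓔 (∑ i, d i + 1 - n))
    (d : Fin (n + 1) → ℤ) (x : Fin (n + 1) → E) (hx : ∀ i, x i ∈ 𝓔 (d i)) :
    ∃ u : ℤˣ, homotopyRelation (strict μ) n 0 d x = u • jacobiTensor μ d x := by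
  refine ⟨-(paritySign (1 + ∑ i, (1 - d i)) * extensionSign n 0 (permSeq d 1)), ?_⟩
  rw [homotopyRelation_strict_zero, jacobiTensor, Units.neg_smul, ← Nat.sum_antidiagonal_swap, smul_sum]
  congr 1
  refine sum_congr rfl fun mq hqm => ?_
  obtain ⟨m, q⟩ := mq
  rw [HasAntidiagonal.mem_antidiagonal, add_comm] at hqm
  simp only [Prod.swap_prod_mk]
  -- `blockPerm` needs a proof of its bound, so it is extended by the identity to all `k`; only `k ≤
  -- q` is used.
  obtain ⟨β, hβ⟩ : ∃ β : ℕ → Equiv.Perm (Fin (n + 1)), ∀ k (hk : k ≤ q),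
      β k = blockPerm m k (by omega) :=
    ⟨fun k => if h : m + k ≤ n then blockPerm m k h else 1, fun k hk => dif_pos (by omega)⟩
  have h (k : ℕ) := (Equiv.sum_comp (Equiv.mulRight (β k)) fun σ : Equiv.Perm (Fin (n + 1)) =>
    insertionTerm μ q m k (permSeq (letter K fun i => 1 - d i) σ) (permSeq x σ)
      (permSeq d σ)).symm
  rw [sum_congr rfl fun k _ => h k, sum_comm, smul_sum]
  refine sum_congr rfl fun σ _ => ?_
  refine (hμ.sum_insertionTerm hdeg hqm d x hx (letter K fun i => 1 - d i) (fun _ => rfl) σ β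
    hβ).trans ?_
  rw [smul_smul, extensionSign_perm d σ, add_assoc, paritySign_add]
  congr 1
  ac_rfl

end Jacobi

/-! ### Shuffles in terms of sequences of values -/

section Shuffles

variable {n : ℕ} (ρ : Equiv.Perm (Fin (n + 1)))

/-- The sequence of values of a permutation. -/
def valSeq : ℕ → ℕ := permSeq (fun i => (i : ℕ)) ρ

theorem valSeq_lt (l : ℕ) : valSeq ρ l < n + 1 := Fin.isLt _

theorem permSeq_valSeq {α : Type*} (f : Fin (n + 1) → α) (τ : Equiv.Perm (Fin (n + 1))) (l : ℕ) :
    permSeq f τ (valSeq ρ l) = permSeq f (τ * ρ) l := by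
  simp [permSeq, valSeq]

theorem valSeq_inj {i j : ℕ} (hi : i < n + 1) (hj : j < n + 1) (h : valSeq ρ i = valSeq ρ j) :
    i = j := by
  have := ρ.injective (Fin.ext h)
  simpa [Fin.ext_iff, Nat.mod_eq_of_lt hi, Nat.mod_eq_of_lt hj] using this

theorem exists_valSeq_eq {l : ℕ} (hl : l < n + 1) : ∃ i < n + 1, valSeq ρ i = l :=
  ⟨ρ.symm ⟨l, hl⟩, Fin.isLt _, by simp [valSeq, permSeq]⟩

theorem valSeq_val (i : Fin (n + 1)) : valSeq ρ i = ρ i := by simp [valSeq, permSeq]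

theorem shuffle_iff {a b : ℕ} (h : a + b = n) :
    (∀ i j : Fin (n + 1), i < j → ((j : ℕ) ≤ a ∨ a < (i : ℕ)) → ρ i < ρ j) ↔
      (∀ j < a + 1, ∀ i < j, valSeq ρ i < valSeq ρ j) ∧
        ∀ j < b, ∀ i < j, valSeq ρ (a + 1 + i) < valSeq ρ (a + 1 + j) := by
  constructor
  · intro H
    have key (i j : ℕ) (hij : i < j) (hj : j < n + 1) (hc : j ≤ a ∨ a < i) :
        valSeq ρ i < valSeq ρ j := by
      have := H ⟨i, by omega⟩ ⟨j, hj⟩ hij hc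
      rwa [Fin.lt_def, ← valSeq_val, ← valSeq_val] at this
    exact ⟨fun j hj i hi => key i j hi (by omega) (by omega),
      fun j hj i hi => key _ _ (by omega) (by omega) (by omega)⟩
  · rintro ⟨H1, H2⟩ i j hij hc
    rw [Fin.lt_def] at hij ⊢
    rw [← valSeq_val, ← valSeq_val]
    rcases hc with hc | hc
    · exact H1 j (by omega) i hij
    · have := H2 (j - (a + 1)) (by omega) (i - (a + 1)) (by omega)
      rwa [Nat.add_sub_cancel' (by omega), Nat.add_sub_cancel' (by omega)] at this

/-- Within each of the two increasing blocks there are no inversions. -/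
theorem koszulSign_of_shuffle {a b : ℕ} (h : a + b = n) (e : Fin (n + 1) → ℤ)
    (h1 : ∀ j < a + 1, ∀ i < j, valSeq ρ i < valSeq ρ j)
    (h2 : ∀ j < b, ∀ i < j, valSeq ρ (a + 1 + i) < valSeq ρ (a + 1 + j)) :
    koszulSign ρ e = ∏ i ∈ range (a + 1), ∏ j ∈ range b,
      if valSeq ρ (a + 1 + j) < valSeq ρ i then
        paritySign (permSeq e ρ i * permSeq e ρ (a + 1 + j)) else 1 := by
  have h3 : koszulSign ρ e = ∏ i ∈ range (a + 1 + b), ∏ j ∈ range (a + 1 + b),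
      if i < j ∧ valSeq ρ j < valSeq ρ i then paritySign (permSeq e ρ i * permSeq e ρ j) else 1 := by
    have h4 : a + 1 + b = n + 1 := by omega
    rw [h4, ← Fin.prod_univ_eq_prod_range]
    refine prod_congr rfl fun i _ => ?_
    rw [← Fin.prod_univ_eq_prod_range]
    refine prod_congr rfl fun j _ => ?_
    rw [valSeq_val, valSeq_val, permSeq_apply, permSeq_apply]
    rfl
  rw [h3, prod_range_add, prod_eq_one (s := range b), mul_one]
  · refine prod_congr rfl fun i hi => ?_
    rw [mem_range] at hi
    rw [prod_range_add, prod_eq_one, one_mul]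
    · refine prod_congr rfl fun j _ => ?_
      have : i < a + 1 + j := by omega
      simp [this]
    · intro j hj
      rw [mem_range] at hj
      exact if_neg fun hc => absurd (h1 j hj i hc.1) (by omega)
  · intro i hi
    rw [mem_range] at hi
    rw [prod_range_add, prod_eq_one, prod_eq_one, mul_one]
    · intro j hj
      rw [mem_range] at hj
      exact if_neg fun hc => absurd (h2 j hj i (by omega)) (by omega)
    · intro j hj
      rw [mem_range] at hj
      exact if_neg fun hc => by omega

end Shuffles

/-! ### Coefficients of the weight-zero relation -/

section Jacobi

variable {K E : Type*} [Field K] [AddCommGroup E] [Module K E]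

open EilhTree Eilh ShuffleOne TensorProduct

variable (μ : (n : ℕ) → MultilinearMap K (fun _ : Fin (n + 1) => E) E) {𝓔 : ℤ → Submodule K E}
variable {n : ℕ}

theorem coeff_uword_letter_mul_uword_letter (e : Fin (n + 1) → ℤ) (τ ρ : Equiv.Perm (Fin (n + 1)))
    {a b : ℕ} (h : a + b = n) :
    coeff (permSeq (letterForm K e) τ) (n + 1)
      (uword (a + 1) (permSeq (letter K e) (τ * ρ)) *
        uword b fun l => permSeq (letter K e) (τ * ρ) (a + 1 + l)) =
      if ∀ i j : Fin (n + 1), i < j → ((j : ℕ) ≤ a ∨ a < (i : ℕ)) → ρ i < ρ j then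
        koszulSign ρ (fun i => e (τ i)) • (1 : K) else 0 := by
  have h0 := coeff_uword_mul_uword (M := n + 1) (f := permSeq (letterForm K e) τ)
    (d := permSeq e τ) (v := fun l => letterVec K e (τ (Fin.ofNat (n + 1) l)))
    (fun l j hl hj => ?_) le_rfl (a := a + 1) (b := b) (s := valSeq ρ)
    (s' := fun l => valSeq ρ (a + 1 + l)) (fun i _ => valSeq_lt ρ i) (fun i _ => valSeq_lt ρ _)
    (fun i hi j hj => valSeq_inj ρ (by omega) (by omega))
    (fun i hi j hj hij => by have := valSeq_inj ρ (by omega) (by omega) hij; omega)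
    (fun i hi j hj hij => by have := valSeq_inj ρ (by omega) (by omega) hij; omega)
    (fun l hl => ?_)
  · have h1 (l : ℕ) : leaf (permSeq e τ (valSeq ρ l))
        (letterVec K e (τ (Fin.ofNat (n + 1) (valSeq ρ l)))) = permSeq (letter K e) (τ * ρ) l :=
      permSeq_valSeq ρ (letter K e) τ l
    simp only [h1] at h0
    refine h0.trans ?_
    simp only [← shuffle_iff ρ h]
    split_ifs with hs
    · rw [koszulSign_of_shuffle ρ h _ ((shuffle_iff ρ h).1 hs).1 ((shuffle_iff ρ h).1 hs).2]
      simp only [permSeq_valSeq]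
      rfl
    · rfl
  · refine (letterForm_letterVec (K := K) e _ _).trans ?_
    have : τ (Fin.ofNat (n + 1) l) = τ (Fin.ofNat (n + 1) j) ↔ l = j := by
      rw [τ.injective.eq_iff, Fin.ext_iff]
      simp [Nat.mod_eq_of_lt hl, Nat.mod_eq_of_lt hj]
    simp only [this]
  · obtain ⟨i, hi, hil⟩ := exists_valSeq_eq ρ hl
    by_cases hia : i < a + 1
    · exact Or.inl ⟨i, hia, hil⟩
    · exact Or.inr ⟨i - (a + 1), by omega, by rwa [Nat.add_sub_cancel' (by omega)]⟩

/-- The product is a combination of words in rearrangements of the `n + 1` distinct letters, and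
each rearrangement is given by a permutation. -/
theorem proj_uword_letter_mul_mem_span (e : Fin (n + 1) → ℤ) (σ : Equiv.Perm (Fin (n + 1)))
    {a b : ℕ} (h : a + b = n) :
    proj (uword (a + 1) (permSeq (letter K e) σ) *
        uword b fun l => permSeq (letter K e) σ (a + 1 + l)) ∈
      Submodule.span K (Set.range (zeroWord e (letterVec K e))) := by
  set g : ℕ → Fin (n + 1) := fun l => σ (Fin.ofNat (n + 1) l) with hg
  have hgi : ∀ i < n + 1, ∀ j < n + 1, g i = g j → i = j := fun i hi j hj hij =>
    valSeq_inj σ hi hj (congrArg Fin.val hij)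
  have h1 := listWord_mul_listWord_mem_span (letter K e)
    ((List.range (a + 1)).map g).reverse ((List.range b).map fun l => g (a + 1 + l)).reverse
  rw [listWord_map_range, listWord_map_range] at h1
  have h2 := Submodule.mem_map_of_mem (f := proj) h1
  rw [Submodule.map_span] at h2
  refine Submodule.span_mono ?_ h2
  rintro _ ⟨_, ⟨P, hP, rfl⟩, rfl⟩
  have hP2 : P.Perm ((List.range (n + 1)).map g) := by
    refine List.Perm.trans hP ((List.Perm.append (List.reverse_perm _) (List.reverse_perm _)).trans
      (List.Perm.of_eq ?_))
    have : List.range (n + 1) = List.range (a + 1) ++ (List.range b).map (a + 1 + ·) := by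
      rw [← List.range_add, show a + 1 + b = n + 1 by omega]
    rw [this, List.map_append, List.map_map]
    rfl
  have hnd : P.reverse.Nodup := by
    rw [List.nodup_reverse, hP2.nodup_iff]
    exact List.Nodup.map_on (fun i hi j hj => hgi i (by simpa using hi) j (by simpa using hj))
      List.nodup_range
  have hlen : P.reverse.length = n + 1 := by simp [hP2.length_eq]
  set τ : Equiv.Perm (Fin (n + 1)) := Equiv.ofBijective
    (fun i => P.reverse.get (i.cast hlen.symm)) (Finite.injective_iff_bijective.1
      ((List.nodup_iff_injective_get.1 hnd).comp (Fin.cast_injective _))) with hτ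
  refine ⟨τ, ?_⟩
  have h3 : P = ((List.range (n + 1)).map fun l => τ (Fin.ofNat (n + 1) l)).reverse := by
    rw [← List.reverse_eq_iff]
    refine List.ext_getElem (by simpa using hlen) fun i hi hi' => ?_
    have : i < n + 1 := by omega
    simp [hτ, Nat.mod_eq_of_lt this]
  rw [h3, listWord_map_range, uword_succ, proj_incl]
  rfl

/-- The left-hand side of the homotopy Jacobi identity. -/
noncomputable def jacobiator (d : Fin (n + 1) → ℤ) (x : Fin (n + 1) → E) : E :=
  ∑ ij ∈ HasAntidiagonal.antidiagonal n,
    ∑ σ : Equiv.Perm (Fin (n + 1)) with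
        ∀ a b : Fin (n + 1), a < b → ((b : ℕ) ≤ ij.1 ∨ ij.1 < (a : ℕ)) → σ a < σ b,
      (koszulAltSign σ d * paritySign ij.2) •
        μ ij.2 (fun l => splice (permSeq x σ) ij.1 0 (μ ij.1 fun j => permSeq x σ j) l)

/-- Writing `σ = τ * ρ`, the coefficient at `τ` is zero unless `ρ` is a shuffle, and is then the
Koszul sign of `ρ` on the letters. The cocycle property splits off the signs of `τ`. -/
theorem contract_jacobiTensor (d : Fin (n + 1) → ℤ) (x : Fin (n + 1) → E)
    (τ : Equiv.Perm (Fin (n + 1))) :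
    contract (coeff (permSeq (letterForm K fun i => 1 - d i) τ) (n + 1) ∘ₗ incl)
        (jacobiTensor μ d x) =
      (koszulAltSign τ d * koszulSign τ fun i => 1 - d i) •
        jacobiator μ (fun i => d (τ i)) fun i => x (τ i) := by
  rw [jacobiTensor, map_sum, jacobiator, smul_sum]
  refine sum_congr rfl fun ij hij => ?_
  rw [HasAntidiagonal.mem_antidiagonal] at hij
  rw [map_sum, smul_sum, sum_filter, ← Equiv.sum_comp (Equiv.mulLeft τ)]
  refine sum_congr rfl fun ρ _ => ?_
  rw [LinearMap.map_units_int_smul, contract_tmul, Equiv.coe_mulLeft]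
  have h := coeff_uword_letter_mul_uword_letter (K := K) (fun i => 1 - d i) τ ρ hij
  change _ • coeff _ (n + 1) _ • _ = _
  erw [h]
  split_ifs with hs
  · rw [units_smul_one_smul, smul_smul, smul_smul, koszulSign_mul, koszulAltSign_mul]
    -- The letter sign of `ρ` occurs twice, once in the tensor and once in the coefficient, and
    -- drops out.
    have h3 (p q r s t : ℤˣ) : p * q * r * (s * t) * t = p * s * (q * r) := by
      rw [mul_assoc, mul_assoc s, units_mul_self, mul_one]
      ac_rfl
    rw [h3]
    rfl
  · rw [zero_smul, smul_zero]

theorem eq_sum_coeff_smul_zeroWord (e : Fin (n + 1) → ℤ) {z : Eilh (letterGrading K e)}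
    (hz : z ∈ Submodule.span K (Set.range (zeroWord e (letterVec K e)))) :
    ∑ τ, coeff (permSeq (letterForm K e) τ) (n + 1) (incl z) • zeroWord e (letterVec K e) τ =
      z := by
  induction hz using Submodule.span_induction with
  | mem z hz =>
    obtain ⟨σ, rfl⟩ := hz
    simp [coeff_zeroWord_letterVec]
  | zero => simp
  | add z w _ _ hz hw => simp only [map_add, add_smul, sum_add_distrib, hz, hw]
  | smul c z _ hz => simp only [map_smul, smul_eq_mul, mul_smul, ← smul_sum, hz]

/-- The first tensor factors lie in the span of words in the letters, on which the coefficients are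
dual to the words. The tensor is thus rebuilt from its contractions, all of which vanish. -/
theorem jacobiTensor_eq_zero (d : Fin (n + 1) → ℤ) (x : Fin (n + 1) → E)
    (h : ∀ τ : Equiv.Perm (Fin (n + 1)),
      jacobiator μ (fun i => d (τ i)) (fun i => x (τ i)) = 0) : jacobiTensor μ d x = 0 := by
  set e : Fin (n + 1) → ℤ := fun i => 1 - d i with he
  set Θ : Eilh (letterGrading K e) ⊗[K] E →ₗ[K] Eilh (letterGrading K e) ⊗[K] E :=
    ∑ τ : Equiv.Perm (Fin (n + 1)), TensorProduct.mk K _ E (zeroWord e (letterVec K e) τ) ∘ₗ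
      contract (coeff (permSeq (letterForm K e) τ) (n + 1) ∘ₗ incl) with hΘ
  have hΘ1 : Θ (jacobiTensor μ d x) = jacobiTensor μ d x := by
    rw [jacobiTensor, map_sum]
    refine sum_congr rfl fun ij hij => ?_
    rw [map_sum]
    refine sum_congr rfl fun σ _ => ?_
    rw [LinearMap.map_units_int_smul]
    congr 1
    rw [HasAntidiagonal.mem_antidiagonal] at hij
    conv_rhs => rw [← eq_sum_coeff_smul_zeroWord e (proj_uword_letter_mul_mem_span e σ hij),
      TensorProduct.sum_tmul]
    rw [hΘ, LinearMap.sum_apply]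
    refine sum_congr rfl fun τ _ => ?_
    rw [LinearMap.comp_apply, contract_tmul, TensorProduct.mk_apply, TensorProduct.smul_tmul]
    rfl
  rw [← hΘ1, hΘ, LinearMap.sum_apply]
  refine sum_eq_zero fun τ _ => ?_
  rw [LinearMap.comp_apply, contract_jacobiTensor, h, smul_zero, map_zero]

end Jacobi

/-! ### Semistrict `EL∞`-algebras and `L∞`-algebras -/

section Algebras

variable {K E : Type*} [Field K] [AddCommGroup E] [Module K E] {𝓔 : ℤ → Submodule K E}

theorem ELInfinityAlgebra.Semistrict.ε_eq {A : ELInfinityAlgebra 𝓔} (hA : A.Semistrict) :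
    A.ε = strict fun n => A.ε n 0 := by
  funext n I
  by_cases h : I = 0
  · rw [h, strict_zero]
  · rw [hA n I h, strict_of_ne _ h]

/-- The `L∞`-algebra of a semistrict `EL∞`-algebra. -/
noncomputable def ELInfinityAlgebra.Semistrict.toLInfinityAlgebra {A : ELInfinityAlgebra 𝓔}
    (hA : A.Semistrict) : LInfinityAlgebra 𝓔 :=
  have hdeg (n : ℕ) (d : Fin (n + 1) → ℤ) (x : Fin (n + 1) → E) (hx : ∀ i, x i ∈ 𝓔 (d i)) :
      A.ε n 0 x ∈ 𝓔 (∑ i, d i + 1 - n) := by simpa using A.degree n 0 d x hx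
  have hrel (n p : ℕ) (d : Fin (n + 1) → ℤ) (x : Fin (n + 1) → E) (hx : ∀ i, x i ∈ 𝓔 (d i)) :
      homotopyRelation (strict fun n => A.ε n 0) n p d x = 0 :=
    hA.ε_eq ▸ A.relation n p d x hx
  have hanti : IsGradedAntisymm (fun n => A.ε n 0) 𝓔 :=
    isGradedAntisymm_of_homotopyRelation _ fun n => hrel n 1
  { μ := fun n => A.ε n 0
    degree := hdeg
    antisymm := hanti
    jacobi := fun n d x hx => by
      obtain ⟨u, hu⟩ := hanti.homotopyRelation_zero hdeg d x hx
      rw [hrel n 0 d x hx] at hu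
      -- The coefficient of the word in the given order, `τ = 1`, already yields the Jacobi identity
      -- for `x`.
      have h1 := contract_jacobiTensor (fun n => A.ε n 0) d x 1
      rw [(smul_eq_zero_iff_eq u).1 hu.symm, map_zero] at h1
      exact (smul_eq_zero_iff_eq _).1 h1.symm }

theorem LInfinityAlgebra.homotopyRelation_strict (L : LInfinityAlgebra 𝓔) (n p : ℕ)
    (d : Fin (n + 1) → ℤ) (x : Fin (n + 1) → E) (hx : ∀ i, x i ∈ 𝓔 (d i)) :
    homotopyRelation (strict L.μ) n p d x = 0 := by
  have hanti : IsGradedAntisymm L.μ 𝓔 := L.antisymm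
  rcases p with _ | _ | p
  · obtain ⟨u, hu⟩ := hanti.homotopyRelation_zero L.degree d x hx
    rw [hu, jacobiTensor_eq_zero, smul_zero]
    exact fun τ => L.jacobi n _ _ fun i => hx (τ i)
  · exact hanti.homotopyRelation_one _ d x hx
  · exact homotopyRelation_strict_add_two _ p d x

/-- The semistrict `EL∞`-algebra of an `L∞`-algebra. -/
noncomputable def LInfinityAlgebra.toELInfinityAlgebra (L : LInfinityAlgebra 𝓔) :
    ELInfinityAlgebra 𝓔 where
  ε := strict L.μ
  degree n I d x hx := by
    by_cases h : I = 0
    · rw [h, strict_zero]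
      simpa using L.degree n d x hx
    · rw [strict_of_ne _ h]
      exact zero_mem _
  relation := L.homotopyRelation_strict

variable (𝓔) in
/-- Semistrict `EL∞`-algebra structures are the same as `L∞`-algebra structures. -/
noncomputable def semistrictEquiv :
    {A : ELInfinityAlgebra 𝓔 // A.Semistrict} ≃ LInfinityAlgebra 𝓔 where
  toFun A := A.2.toLInfinityAlgebra
  invFun L := ⟨L.toELInfinityAlgebra, fun _ _ h => strict_of_ne _ h⟩
  left_inv A := by
    obtain ⟨A, hA⟩ := A
    have h := hA.ε_eq
    obtain ⟨ε, _, _⟩ := A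
    refine Subtype.ext ?_
    simp only [LInfinityAlgebra.toELInfinityAlgebra, ELInfinityAlgebra.mk.injEq]
    exact h.symm
  right_inv L := by
    obtain ⟨μ, _, _, _⟩ := L
    exact (LInfinityAlgebra.mk.injEq ..).mpr (funext fun n => strict_zero μ n)

end Algebras
theorem mainTheorem7 {K : Type*} [Field K] [CharZero K] :
    (∀ {E : Type*} [AddCommGroup E] [Module K E] (𝓔 : ℤ → Submodule K E)
      [DirectSum.Decomposition 𝓔],
      ∃ Φ : {A : ELInfinityAlgebra 𝓔 // A.Semistrict} ≃ LInfinityAlgebra 𝓔,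
        ∀ (A : {A : ELInfinityAlgebra 𝓔 // A.Semistrict}) (n : ℕ), (Φ A).μ n = A.1.ε n 0) ∧
    (∀ {V : Type*} [AddCommGroup V] [Module K V] (𝒱 : ℤ → Submodule K V)
      [DirectSum.Decomposition 𝒱],
      ∃ S : GradedSym 𝒱 →ₗ[K] Eilh 𝒱, IsSymmetrization S ∧
        ∃ Ψ : {D : EilhDifferential 𝒱 //
                ∀ (d : ℤ) (v : 𝒱 d), D.Q (Eilh.gen v) ∈ Eilh.zeroWords 𝒱} ≃
              GradedSymDifferential 𝒱,
          ∀ (D : {D : EilhDifferential 𝒱 //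
                ∀ (d : ℤ) (v : 𝒱 d), D.Q (Eilh.gen v) ∈ Eilh.zeroWords 𝒱})
            (d : ℤ) (v : 𝒱 d), D.1.Q (Eilh.gen v) = S ((Ψ D).Q (GradedSym.gen v))) := by
  exact ⟨fun 𝓔 _ => ⟨semistrictEquiv 𝓔, fun _ _ => rfl⟩, fun 𝒱 _ => ⟨GradedSym.symmetrization,
    GradedSym.isSymmetrization, exists_equiv_gradedSymDifferential 𝒱⟩⟩
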